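/- Two vertices $u,v$ of a graph $G$ are \emph{twins} if $N(u)\setminus\{v\}=N(v)\setminus\{u\}$; this is an equivalence relation, and $\Pi_{tc}(G)$ denotes the partition of $V(G)$ into its classes (twinclasses). The quotient graph $G/\Pi_{tc}(G)$ has the twinclasses as vertices, and two distinct classes are adjacent if $G$ has an edge between them. The problem Feedback Vertex Set asks, for a graph $G=(V,E)$, positive integer vertex costs $\mathbf c$ and a budget $\bar b\in\mathbb N$, whether there is a set $X\subseteq V$ with $\mathbf c(X)\le\bar b$ such that $G-X$ contains no cycle. Algorithms are deterministic programs of a random access machine with logarithmic cost. The Strong Exponential-Time Hypothesis (SETH) states that for every $\delta<1$ there is some $q$ such that $q$-Satisfiability (satisfiability of a set of clauses with at most $q$ literals each) on $n$ variables cannot be solved in time $O(2^{\delta n})$. The notation $O^*(f(k))$ means $f(k)\cdot N^{O(1)}$, where $N$ is the size of the input. \textbf{Theorem.} Unless SETH fails, for every real $\varepsilon>0$ there is no algorithm that solves Feedback Vertex Set in time $O^*((5-\varepsilon)^k)$ when a path decomposition of width $k$ of $G/\Pi_{tc}(G)$ is given together with the instance. This holds even if the algorithm only has to handle the instances in which all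 vertex costs equal $1$. -/

import Mathlib

/-! ## Random access machines with logarithmic cost -/

namespace RAM

/-- Programs of a random access machine. The machine has registers `R 0, R 1, ...` and a memory
`M 0, M 1, ...`, all holding natural numbers. -/
inductive Prog : Type
  /-- do nothing -/
  | skip : Prog
  /-- `R r := c` -/
  | const (r c : ℕ) : Prog
  /-- `R r := R a + R b` -/
  | add (r a b : ℕ) : Prog
  /-- `R r := R a - R b` (cut off at zero) -/
  | sub (r a b : ℕ) : Prog
  /-- `R r := M (R a)` -/
  | load (r a : ℕ) : Prog
  /-- `M (R a) := R b` -/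
  | store (a b : ℕ) : Prog
  /-- first `P`, then `Q` -/
  | seq (P Q : Prog) : Prog
  /-- if `R r` is nonzero then `P`, else `Q` -/
  | cond (r : ℕ) (P Q : Prog) : Prog
  /-- as long as `R r` is nonzero, repeat `P` -/
  | loop (r : ℕ) (P : Prog) : Prog

/-- The contents of the registers and of the memory. -/
@[ext]
structure State where
  reg : ℕ → ℕ
  mem : ℕ → ℕ

/-- The state `s` after writing `x` into register `r`. -/
def State.setReg (s : State) (r x : ℕ) : State :=
  { s with reg := Function.update s.reg r x }

/-- The state `s` after writing `x` into memory cell `i`. -/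
def State.setMem (s : State) (i x : ℕ) : State :=
  { s with mem := Function.update s.mem i x }

/-- `Exec P s t s'`: started in the state `s`, the program `P` halts in the state `s'` after time
exactly `t`. Every executed instruction and every test costs one plus the bit lengths of the
numbers (including memory addresses) it works on. -/
inductive Exec : Prog → State → ℕ → State → Prop
  | skip (s : State) : Exec .skip s 1 s
  | const (s : State) (r c : ℕ) : Exec (.const r c) s (1 + c.size) (s.setReg r c)
  | add (s : State) (r a b : ℕ) :
      Exec (.add r a b) s (1 + (s.reg a).size + (s.reg b).size) (s.setReg r (s.reg a + s.reg b))
  | sub (s : State) (r a b : ℕ) :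
      Exec (.sub r a b) s (1 + (s.reg a).size + (s.reg b).size) (s.setReg r (s.reg a - s.reg b))
  | load (s : State) (r a : ℕ) :
      Exec (.load r a) s (1 + (s.reg a).size + (s.mem (s.reg a)).size)
        (s.setReg r (s.mem (s.reg a)))
  | store (s : State) (a b : ℕ) :
      Exec (.store a b) s (1 + (s.reg a).size + (s.reg b).size) (s.setMem (s.reg a) (s.reg b))
  | seq {P Q : Prog} {s s' s'' : State} {t t' : ℕ} (hP : Exec P s t s') (hQ : Exec Q s' t' s'') :
      Exec (.seq P Q) s (t + t') s''
  | cond_true {r : ℕ} {P Q : Prog} {s s' : State} {t : ℕ} (hr : s.reg r ≠ 0)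
      (hP : Exec P s t s') : Exec (.cond r P Q) s (1 + (s.reg r).size + t) s'
  | cond_false {r : ℕ} {P Q : Prog} {s s' : State} {t : ℕ} (hr : s.reg r = 0)
      (hQ : Exec Q s t s') : Exec (.cond r P Q) s (1 + (s.reg r).size + t) s'
  | loop_stop {r : ℕ} {P : Prog} {s : State} (hr : s.reg r = 0) :
      Exec (.loop r P) s (1 + (s.reg r).size) s
  | loop_step {r : ℕ} {P : Prog} {s s' s'' : State} {t t' : ℕ} (hr : s.reg r ≠ 0)
      (hP : Exec P s t s') (hL : Exec (.loop r P) s' t' s'') :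
      Exec (.loop r P) s (1 + (s.reg r).size + t + t') s''

/-- The initial state on the input `w`: the word `w` stands in the memory cells
`0, ..., w.length - 1`, its length in register `0`, and everything else is zero. -/
def init (w : List ℕ) : State where
  reg := fun r => if r = 0 then w.length else 0
  mem := fun i => w.getD i 0

/-- The size in bits of an input. -/
def inputSize (w : List ℕ) : ℕ := (w.map fun x => x.size + 1).sum

/-- On the input `w`, the program `P` halts within time `T` and answers the yes/no question `Yes`
correctly; the answer "yes" is a nonzero number in register `0`. -/
def Answers (P : Prog) (w : List ℕ) (Yes : Prop) (T : ℝ) : Prop :=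
  ∃ (t : ℕ) (s : State), Exec P (init w) t s ∧ (t : ℝ) ≤ T ∧ (s.reg 0 ≠ 0 ↔ Yes)

end RAM

/-! ## Satisfiability and the Strong Exponential-Time Hypothesis -/

/-- A CNF formula over the variables `0, ..., n - 1`, given as a list of pairwise distinct clauses.
The literal `(v, true)` is the variable `v`, the literal `(v, false)` is its negation. -/
structure CNF where
  n : ℕ
  clauses : List (List (Fin n × Bool))
  nodup : clauses.Nodup

namespace CNF

/-- Some truth assignment makes some literal of each clause true. -/
def Satisfiable (φ : CNF) : Prop :=
  ∃ τ : Fin φ.n → Bool, ∀ c ∈ φ.clauses, ∃ l ∈ c, τ l.1 = l.2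

/-- `φ` is an instance of `q`-Satisfiability. -/
def IsQCNF (q : ℕ) (φ : CNF) : Prop := ∀ c ∈ φ.clauses, c.length ≤ q

/-- The number of variables, the number of clauses, and then for each clause its length and its
literals, where the literals of the variable `v` are written `2v` and `2v + 1`. -/
def encode (φ : CNF) : List ℕ :=
  [φ.n, φ.clauses.length] ++
    φ.clauses.flatMap fun c => c.length :: c.map fun l => 2 * l.1.val + (if l.2 then 1 else 0)

end CNF

/-- `q`-Satisfiability with `n` variables can be solved in time `O(2 ^ (δ n))`. -/
def QSatSolvable (q : ℕ) (δ : ℝ) : Prop :=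
  ∃ (P : RAM.Prog) (C : ℝ), ∀ φ : CNF, φ.IsQCNF q →
    RAM.Answers P φ.encode φ.Satisfiable (C * (2 : ℝ) ^ (δ * φ.n))

/-- The Strong Exponential-Time Hypothesis: for every `δ < 1` there is some `q` such that
`q`-Satisfiability cannot be solved in time `O(2 ^ (δ n))`. -/
def SETH : Prop := ∀ δ : ℝ, δ < 1 → ∃ q : ℕ, ¬ QSatSolvable q δ

/-! ## Twinclasses, quotient graphs, path decompositions -/

/-- Two vertices are twins if `N(u) \ {v} = N(v) \ {u}`. -/
def Twins {V : Type*} (G : SimpleGraph V) (u v : V) : Prop :=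
  G.neighborSet u \ {v} = G.neighborSet v \ {u}

theorem twins_equivalence {V : Type*} (G : SimpleGraph V) : Equivalence (Twins G) where
  refl u := rfl
  symm h := Eq.symm h
  trans := by
    intro u v w huv hvw
    simp only [Twins, Set.ext_iff, Set.mem_sdiff, SimpleGraph.mem_neighborSet,
      Set.mem_singleton_iff] at *
    intro x
    have h1 := huv x
    have h2 := hvw x
    have h3 := huv w
    have h4 := hvw u
    have e1 := G.adj_comm u v
    have e2 := G.adj_comm u w
    have e3 := G.adj_comm v w
    have i1 := G.irrefl (v := u)
    have i2 := G.irrefl (v := v)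
    have i3 := G.irrefl (v := w)
    grind

/-- The partition of the vertex set into twinclasses. -/
def twinclasses {V : Type*} (G : SimpleGraph V) : Setoid V := ⟨Twins G, twins_equivalence G⟩

/-- The quotient graph of `G` by a partition of its vertex set: distinct classes are adjacent if
some vertex of the one is adjacent to some vertex of the other. -/
def quotientGraph {V : Type*} (G : SimpleGraph V) (p : Setoid V) : SimpleGraph (Quotient p) where
  Adj a b := a ≠ b ∧ ∃ u v : V, Quotient.mk p u = a ∧ Quotient.mk p v = b ∧ G.Adj u v
  symm := ⟨fun _ _ ⟨hne, u, v, hu, hv, h⟩ => ⟨hne.symm, v, u, hv, hu, h.symm⟩⟩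
  loopless := ⟨fun _ h => h.1 rfl⟩

/-- `B 0, ..., B (ℓ - 1)` are the bags, in this order, of a path decomposition of `G`. -/
structure IsPathDecomposition {V : Type*} (G : SimpleGraph V) {ℓ : ℕ} (B : Fin ℓ → Set V) :
    Prop where
  vertex_mem : ∀ v, ∃ t, v ∈ B t
  edge_mem : ∀ u v, G.Adj u v → ∃ t, u ∈ B t ∧ v ∈ B t
  connected : ∀ v i j l, i ≤ j → j ≤ l → v ∈ B i → v ∈ B l → v ∈ B j

/-- The largest of the bags has `k + 1` elements. -/
def HasWidth {V : Type*} {ℓ : ℕ} (B : Fin ℓ → Set V) (k : ℕ) : Prop :=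
  (∀ t, (B t).ncard ≤ k + 1) ∧ ∃ t, (B t).ncard = k + 1

/-! ## Feedback Vertex Set -/

/-- The data of an instance of Feedback Vertex Set: a graph on the vertices `0, ..., n - 1` given
by a list of its edges, positive vertex costs, a budget, and a list of bags. In a bag, a vertex
stands for its twinclass. -/
structure FVSInstance where
  n : ℕ
  edges : List (Fin n × Fin n)
  edges_ne : ∀ e ∈ edges, e.1 ≠ e.2
  cost : Fin n → ℕ
  cost_pos : ∀ v, 0 < cost v
  budget : ℕ
  bags : List (List (Fin n))

namespace FVSInstance

/-- The graph of the instance. -/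
def graph (I : FVSInstance) : SimpleGraph (Fin I.n) :=
  SimpleGraph.fromRel fun u v => (u, v) ∈ I.edges

/-- The bags as sets of twinclasses. -/
def quotientBags (I : FVSInstance) :
    Fin I.bags.length → Set (Quotient (twinclasses I.graph)) :=
  fun t => {a | ∃ v ∈ I.bags.get t, Quotient.mk (twinclasses I.graph) v = a}

/-- The bags form a path decomposition of width `k` of the quotient of the graph by its
partition into twinclasses. -/
def GivenWidth (I : FVSInstance) (k : ℕ) : Prop :=
  IsPathDecomposition (quotientGraph I.graph (twinclasses I.graph)) I.quotientBags ∧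
    HasWidth I.quotientBags k

/-- Some set of vertices of total cost at most the budget meets all cycles. -/
def HasSolution (I : FVSInstance) : Prop :=
  ∃ X : Finset (Fin I.n), ∑ v ∈ X, I.cost v ≤ I.budget ∧
    (I.graph.induce {v | v ∉ X}).IsAcyclic

/-- The number of vertices, their costs, the budget, the number of edges, the ends of each edge,
the number of bags, and then for each bag its length and its vertices. -/
def encode (I : FVSInstance) : List ℕ :=
  [I.n] ++ List.ofFn I.cost ++ [I.budget] ++
    [I.edges.length] ++ (I.edges.flatMap fun e => [e.1.val, e.2.val]) ++
    [I.bags.length] ++ (I.bags.flatMap fun b => b.length :: b.map Fin.val)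

end FVSInstance

/-- The program `P` solves Feedback Vertex Set on the instances with unit costs, given a path
decomposition of width `k` of the quotient of the graph by its twinclasses, in time `O*(a ^ k)`,
that is, `a ^ k` times a polynomial in the size of the input. -/
def SolvesUnitCostFVS (P : RAM.Prog) (a : ℝ) : Prop :=
  ∃ C : ℕ, ∀ (I : FVSInstance) (k : ℕ), (∀ v, I.cost v = 1) → I.GivenWidth k →
    RAM.Answers P I.encode I.HasSolution
      (C * a ^ k * (RAM.inputSize I.encode : ℝ) ^ C)

/-!
A program for Feedback Vertex Set that runs in time `O*(a ^ k)` with `a < 5` would decide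
`q`-Satisfiability in time `O(2 ^ (δ n))`, with one `δ < 1` for all `q`, against SETH.

*The reduction.* Choose `g` and `p` such that `2 ^ p ≤ 5 ^ g` and `a ^ g ≤ 2 ^ (p - 1)`
(`exists_block`); this is possible since `a < 5`. Blocks of `p` Boolean variables are written as `g`
variables with values `0, ..., 4`, so that `N = g * (n / p + 1)` of them represent an assignment
(`satCSP`). The graph has a cell for each of these variables at each of the constraints, which stand
for the clauses. The `N` links between the cells of consecutive constraints are, but for `O(1)`
further classes in each bag, what the bags consist of; hence the width is `N + O(1)`
(`SelCSP.exists_givenWidth`), and `a ^ (N + O(1)) = O(2 ^ ((1 - 1 / p) n))`. The factor `2 ^ (n / (2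
p))` that is left pays for everything polynomial.

*The graph* (`SelCSP.Adj`). A clamp is a class of twins with more copies than the budget can delete,
so two copies remain, and at most one vertex of its neighbourhood can remain, lest there be a cycle
of length four. Clamps express all constraints of the form "at most one of these". A cell has
selectors for its five states. A link consists of two twins. What passes through it from one cell to
the next is the number of its vertices that remain and, unless it is zero, whether the vertices that
remain are connected to the root by an item on their left or by one on their right: five cases in
all. The items of a link are eight vertices; which of them may remain depends on the states of the
two cells. At most five of the ten vertices of a link and its items can remain, and if five of them
and the root do, then the state does not decrease from left to right (`block_le`,
`state_le_of_block`). The budget is so tight that equality must hold everywhere. A cell without a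
state would permit up to three additional items; so that this does not pay, each cell has its
selectors four times (`SelCSP.exists_states`).

*Back to an assignment.* States may increase from one constraint to the next, but only `4 N` times
in total. Since the sequence of constraints is repeated `4 N + 2` times, the states are constant
during some repetition (`exists_forall_eq_of_mono`), and thus encode a satisfying assignment
(`SelCSP.exists_assignment`). Conversely, given a satisfying assignment, the remaining graph is
acyclic since its vertices can be ranked so that each has at most one neighbour that is not of
higher rank (`SelCSP.hasSolution_of_holds`).

*Running time.* The functions and words that random access machines compute in polynomial time,
`RAM.PComp` and `RAM.PGen`, have closure properties by which the instance can be written down by a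
program (`SelCSP.PCSP.encode`), which then restores the initial state of the machine around its
output (`RAM.PGen.exists_prog`). The number of clauses is polynomial in `n` because the clauses are
distinct (`CNF.length_clauses_le`).

If `a ≤ 0`, then the time allowed on an instance of width `1` is not positive, which is absurd.
-/

/-! ### Polynomial bounds -/

/-- `T` is bounded by a polynomial. -/
def PolyBd (T : ℕ → ℕ) : Prop := ∃ E : ℕ, ∀ B, T B ≤ (B + 2) ^ E

namespace PolyBd

theorem const (c : ℕ) : PolyBd fun _ => c :=
  ⟨c, fun B => (Nat.lt_two_pow_self).le.trans (Nat.pow_le_pow_left (by omega) c)⟩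

theorem id : PolyBd fun B => B := ⟨1, fun B => by simp⟩

theorem add {T U : ℕ → ℕ} (hT : PolyBd T) (hU : PolyBd U) : PolyBd fun B => T B + U B := by
  obtain ⟨a, ha⟩ := hT
  obtain ⟨b, hb⟩ := hU
  refine ⟨a + b + 1, fun B => ?_⟩
  have h1 : (B + 2) ^ a ≤ (B + 2) ^ (a + b) := Nat.pow_le_pow_right (by omega) (by omega)
  have h2 : (B + 2) ^ b ≤ (B + 2) ^ (a + b) := Nat.pow_le_pow_right (by omega) (by omega)
  have h3 : (B + 2) ^ (a + b + 1) = (B + 2) ^ (a + b) * (B + 2) := pow_succ _ _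
  have := ha B
  have := hb B
  nlinarith [Nat.zero_le ((B + 2) ^ (a + b) * B)]

theorem mul {T U : ℕ → ℕ} (hT : PolyBd T) (hU : PolyBd U) : PolyBd fun B => T B * U B := by
  obtain ⟨a, ha⟩ := hT
  obtain ⟨b, hb⟩ := hU
  exact ⟨a + b, fun B => by rw [pow_add]; exact Nat.mul_le_mul (ha B) (hb B)⟩

theorem comp {T U : ℕ → ℕ} (hT : PolyBd T) (hU : PolyBd U) : PolyBd fun B => T (U B) := by
  obtain ⟨a, ha⟩ := hT
  obtain ⟨b, hb⟩ := hU.add (const 2)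
  refine ⟨b * a, fun B => (ha _).trans ?_⟩
  rw [pow_mul]
  exact Nat.pow_le_pow_left (hb B) a

end PolyBd

namespace RAM

/-! ### Running programs -/

/-- `P`, started in `s`, halts in `s'` within time `T`. -/
def Runs (P : Prog) (s : State) (T : ℕ) (s' : State) : Prop := ∃ t ≤ T, Exec P s t s'

theorem size_le_self (x : ℕ) : x.size ≤ x := Nat.size_le.2 Nat.lt_two_pow_self

namespace Runs

variable {P Q : Prog} {s s' s'' : State} {T T' : ℕ}

theorem mono (h : Runs P s T s') (hT : T ≤ T') : Runs P s T' s' :=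
  let ⟨t, ht, h⟩ := h
  ⟨t, ht.trans hT, h⟩

theorem seq (h : Runs P s T s') (h' : Runs Q s' T' s'') : Runs (.seq P Q) s (T + T') s'' :=
  let ⟨_, ht, h⟩ := h
  let ⟨_, ht', h'⟩ := h'
  ⟨_, Nat.add_le_add ht ht', .seq h h'⟩

theorem const (s : State) (r c : ℕ) : Runs (.const r c) s (1 + c) (s.setReg r c) :=
  ⟨_, Nat.add_le_add_left (size_le_self c) 1, .const s r c⟩

theorem add (s : State) (r a b : ℕ) :
    Runs (.add r a b) s (1 + s.reg a + s.reg b) (s.setReg r (s.reg a + s.reg b)) :=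
  ⟨_, by have := size_le_self (s.reg a); have := size_le_self (s.reg b); omega, .add s r a b⟩

theorem sub (s : State) (r a b : ℕ) :
    Runs (.sub r a b) s (1 + s.reg a + s.reg b) (s.setReg r (s.reg a - s.reg b)) :=
  ⟨_, by have := size_le_self (s.reg a); have := size_le_self (s.reg b); omega, .sub s r a b⟩

theorem load (s : State) (r a : ℕ) :
    Runs (.load r a) s (1 + s.reg a + s.mem (s.reg a)) (s.setReg r (s.mem (s.reg a))) :=
  ⟨_, by
    have := size_le_self (s.reg a); have := size_le_self (s.mem (s.reg a)); omega, .load s r a⟩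

theorem store (s : State) (a b : ℕ) :
    Runs (.store a b) s (1 + s.reg a + s.reg b) (s.setMem (s.reg a) (s.reg b)) :=
  ⟨_, by have := size_le_self (s.reg a); have := size_le_self (s.reg b); omega, .store s a b⟩

theorem cond_true {r : ℕ} (hr : s.reg r ≠ 0) (h : Runs P s T s') :
    Runs (.cond r P Q) s (1 + s.reg r + T) s' :=
  let ⟨_, ht, h⟩ := h
  ⟨_, by have := size_le_self (s.reg r); omega, .cond_true hr h⟩

theorem cond_false {r : ℕ} (hr : s.reg r = 0) (h : Runs Q s T s') :
    Runs (.cond r P Q) s (1 + T) s' :=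
  let ⟨_, ht, h⟩ := h
  ⟨_, by rw [hr]; simpa using ht, .cond_false hr h⟩

/-- A loop whose register counts down from `n` maintains an invariant. -/
theorem loop {r n : ℕ} (Inv : ℕ → State → Prop)
    (hreg : ∀ i s, i ≤ n → Inv i s → s.reg r = n - i)
    (hstep : ∀ i s, i < n → Inv i s → ∃ s', Runs P s T s' ∧ Inv (i + 1) s') (h0 : Inv 0 s) :
    ∃ s', Runs (.loop r P) s ((n + 1) * (T + n + 1)) s' ∧ Inv n s' := by
  suffices H : ∀ k i s, i + k = n → Inv i s →
      ∃ s', Runs (.loop r P) s ((k + 1) * (T + n + 1)) s' ∧ Inv n s' from H n 0 s (by omega) h0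
  intro k
  induction k with
  | zero =>
    intro i s hi h
    obtain rfl : i = n := by omega
    have hr : s.reg r = 0 := by rw [hreg i s le_rfl h, Nat.sub_self]
    have e : Exec (.loop r P) s (1 + (s.reg r).size) s := by constructor; exact hr
    refine ⟨s, ⟨_, ?_, e⟩, h⟩
    rw [hr]
    simp
  | succ k ih =>
    intro i s hi h
    obtain ⟨s1, ⟨t1, ht1, e1⟩, h1⟩ := hstep i s (by omega) h
    obtain ⟨s2, ⟨t2, ht2, e2⟩, h2⟩ := ih (i + 1) s1 (by omega) h1
    have hr := hreg i s (by omega) h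
    refine ⟨s2, ⟨_, ?_, .loop_step (by omega) e1 e2⟩, h2⟩
    have h3 := size_le_self (s.reg r)
    have : (k + 1 + 1) * (T + n + 1) = (k + 1) * (T + n + 1) + (T + n + 1) := by ring
    omega

end Runs

@[simp] theorem State.setReg_reg (s : State) (r x i : ℕ) :
    (s.setReg r x).reg i = if i = r then x else s.reg i := by
  simp [State.setReg, Function.update_apply]

@[simp] theorem State.setReg_mem (s : State) (r x : ℕ) : (s.setReg r x).mem = s.mem := rfl

@[simp] theorem State.setMem_mem (s : State) (i x j : ℕ) :
    (s.setMem i x).mem j = if j = i then x else s.mem j := by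
  simp [State.setMem, Function.update_apply]

@[simp] theorem State.setMem_reg (s : State) (i x : ℕ) : (s.setMem i x).reg = s.reg := rfl

/-! ### Functions computable in polynomial time -/

/-- The input word `w` stands at the beginning of the memory, its length in register `0`. -/
structure Inp (w : List ℕ) (s : State) : Prop where
  reg : s.reg 0 = w.length
  mem : ∀ i < w.length, s.mem i = w.getD i 0

/-- `B` bounds the length and the letters of `w`. -/
structure WB (w : List ℕ) (B : ℕ) : Prop where
  length : w.length ≤ B
  mem : ∀ x ∈ w, x ≤ B

theorem WB.mono {w : List ℕ} {B B' : ℕ} (h : WB w B) (hB : B ≤ B') : WB w B' :=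
  ⟨h.1.trans hB, fun x hx => (h.2 x hx).trans hB⟩

theorem WB.getD {w : List ℕ} {B : ℕ} (h : WB w B) (i : ℕ) : w.getD i 0 ≤ B := by
  by_cases hi : i < w.length
  · rw [List.getD_eq_getElem _ _ hi]; exact h.2 _ (List.getElem_mem _)
  · rw [List.getD_eq_default _ _ (by omega)]; omega

theorem Inp.of_eq {w : List ℕ} {s s' : State} (h : Inp w s) (hm : s'.mem = s.mem)
    (hr : s'.reg 0 = s.reg 0) : Inp w s' :=
  ⟨hr.trans h.1, fun i hi => by rw [hm]; exact h.2 i hi⟩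

/-- The environment `e` with one more value in front. -/
def push (x : ℕ) (e : ℕ → ℕ) : ℕ → ℕ
  | 0 => x
  | i + 1 => e i

@[simp] theorem push_zero (x : ℕ) (e : ℕ → ℕ) : push x e 0 = x := rfl

@[simp] theorem push_succ (x : ℕ) (e : ℕ → ℕ) (i : ℕ) : push x e (i + 1) = e i := rfl

theorem push_le {x B : ℕ} {e : ℕ → ℕ} (hx : x ≤ B) (he : ∀ i, e i ≤ B) : ∀ i, push x e i ≤ B
  | 0 => hx
  | i + 1 => he i

theorem push_lt {x B : ℕ} {e : ℕ → ℕ} (hx : x < B) (he : ∀ i, e i < B) : ∀ i, push x e i < B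
  | 0 => hx
  | i + 1 => he i

theorem reg_push (s : State) (a : ℕ) (ρ : ℕ → ℕ) :
    (fun i => s.reg (push a ρ i)) = push (s.reg a) fun i => s.reg (ρ i) := by
  funext i
  cases i <;> rfl

/-- `f w e`, for an input word `w` and an environment `e` of further arguments, is bounded by and
can be computed in time polynomial in the entries of `w` and `e`. The program finds the argument
`e i` in the register `ρ i`, below register `d`, and writes the result into register `d`; it leaves
the memory and the registers below `d` as they are. -/
def PComp (f : List ℕ → (ℕ → ℕ) → ℕ) : Prop :=
  (∃ V, PolyBd V ∧ ∀ w e B, WB w B → (∀ i, e i ≤ B) → f w e ≤ V B) ∧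
  ∀ (d : ℕ) (ρ : ℕ → ℕ), 1 < d → (∀ i, ρ i < d) → ∃ P T, PolyBd T ∧ ∀ w s B, Inp w s → WB w B →
    (∀ i, s.reg (ρ i) ≤ B) → ∃ s', Runs P s (T B) s' ∧ s'.mem = s.mem ∧
      (∀ i < d, s'.reg i = s.reg i) ∧ s'.reg d = f w fun i => s.reg (ρ i)

namespace PComp

variable {f g c : List ℕ → (ℕ → ℕ) → ℕ}

theorem const (k : ℕ) : PComp fun _ _ => k := by
  refine ⟨⟨_, PolyBd.const k, fun _ _ _ _ _ => le_rfl⟩, fun d ρ hd hρ => ⟨.const d k, _,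
    PolyBd.const (1 + k), fun w s B hi hB he => ⟨_, Runs.const s d k, rfl, fun i hi => ?_, ?_⟩⟩⟩
  · simp; omega
  · simp

theorem var (k : ℕ) : PComp fun _ e => e k := by
  refine ⟨⟨_, PolyBd.id, fun _ e B _ he => he k⟩, fun d ρ hd hρ =>
    ⟨.seq (.const d 0) (.add d (ρ k) d), _,
      ((PolyBd.const 2).add PolyBd.id), fun w s B hi hB he =>
      ⟨_, ((Runs.const s d 0).seq (Runs.add _ d (ρ k) d)).mono ?_, rfl, fun i hi => ?_, ?_⟩⟩⟩
  · have := he k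
    have := (hρ k).ne
    simp [this]; omega
  · simp [hi.ne]
  · have := (hρ k).ne
    simp [this]

theorem rename (hf : PComp f) (σ : ℕ → ℕ) : PComp fun w e => f w fun i => e (σ i) := by
  obtain ⟨⟨V, hV, hfV⟩, h⟩ := hf
  refine ⟨⟨V, hV, fun w e B hw he => hfV w _ B hw fun i => he _⟩, fun d ρ hd hρ => ?_⟩
  obtain ⟨P, T, hT, h⟩ := h d (fun i => ρ (σ i)) hd fun i => hρ _
  exact ⟨P, T, hT, fun w s B hi hB he => h w s B hi hB fun i => he _⟩

theorem shift (hf : PComp f) : PComp fun w e => f w fun i => e (i + 1) := hf.rename (· + 1)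

/-- Composition: the value of `f` becomes the first argument of `g`. -/
theorem bind (hf : PComp f) (hg : PComp g) : PComp fun w e => g w (push (f w e) e) := by
  obtain ⟨⟨V, hV, hfV⟩, hf⟩ := hf
  obtain ⟨⟨U, hU, hgU⟩, hg⟩ := hg
  have hBV : PolyBd fun B => B + V B := PolyBd.id.add hV
  refine ⟨⟨_, hU.comp hBV, fun w e B hw he => hgU w _ (B + V B) (hw.mono (by omega))
    (push_le ((hfV w e B hw he).trans (by omega)) fun i => (he i).trans (by omega))⟩,
    fun d ρ hd hρ => ?_⟩
  obtain ⟨P, T, hT, hP⟩ := hf d ρ hd hρ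
  obtain ⟨Q, S, hS, hQ⟩ := hg (d + 1) (push d ρ) (by omega)
    (push_lt (by omega) fun i => (hρ i).trans (by omega))
  refine ⟨.seq P (.seq Q (.seq (.const (d + 2) 0) (.add d (d + 1) (d + 2)))), _,
    hT.add ((hS.comp hBV).add ((PolyBd.const 2).add (hU.comp hBV))), fun w s B hi hB he => ?_⟩
  obtain ⟨s1, r1, m1, k1, v1⟩ := hP w s B hi hB he
  have hreg : (fun i => s1.reg (ρ i)) = fun i => s.reg (ρ i) := funext fun i => k1 _ (hρ i)
  have hv := hfV w _ B hB he
  have henv : ∀ i, s1.reg (push d ρ i) ≤ B + V B := fun i => by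
    have : s1.reg (push d ρ i) = push (s1.reg d) (fun i => s1.reg (ρ i)) i :=
      congrFun (reg_push s1 d ρ) i
    rw [this, hreg, v1]
    exact push_le (hv.trans (by omega)) (fun i => (he i).trans (by omega)) i
  obtain ⟨s2, r2, m2, k2, v2⟩ := hQ w s1 (B + V B) (hi.of_eq m1 (k1 0 (by omega)))
    (hB.mono (by omega)) henv
  rw [reg_push, hreg, v1] at v2
  have hb := hgU w (push (f w fun i => s.reg (ρ i)) fun i => s.reg (ρ i)) (B + V B)
    (hB.mono (by omega)) (push_le (hv.trans (by omega)) fun i => (he i).trans (by omega))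
  refine ⟨_, (r1.seq (r2.seq ((Runs.const s2 (d + 2) 0).seq (Runs.add _ d (d + 1) (d + 2))))).mono
    ?_, ?_, fun i hi => ?_, ?_⟩
  · simp [v2]; omega
  · simp [m1, m2]
  · have : i ≠ d := by omega
    have : i ≠ d + 2 := by omega
    simp [*, k2 i (by omega), k1 i hi]
  · simp [v2]

/-- Composition with a function of two arguments. -/
theorem comp₂ {op : List ℕ → ℕ → ℕ → ℕ} (h : PComp fun w e => op w (e 0) (e 1)) (hf : PComp f)
    (hg : PComp g) : PComp fun w e => op w (f w e) (g w e) := by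
  have := hf.bind (hg.shift.bind (h.rename fun i => if i = 0 then 1 else 0))
  simpa using this

theorem comp₁ {op : List ℕ → ℕ → ℕ} (h : PComp fun w e => op w (e 0)) (hf : PComp f) :
    PComp fun w e => op w (f w e) := by
  simpa using hf.bind h

theorem add (hf : PComp f) (hg : PComp g) : PComp fun w e => f w e + g w e := by
  refine comp₂ (op := fun _ => (· + ·)) ⟨⟨_, PolyBd.id.add PolyBd.id, fun w e B hw he =>
    Nat.add_le_add (he 0) (he 1)⟩, fun d ρ hd hρ => ⟨.add d (ρ 0) (ρ 1), _,
      (PolyBd.const 1).add (PolyBd.id.add PolyBd.id), fun w s B hi hB he =>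
      ⟨_, (Runs.add s _ _ _).mono ?_, rfl, fun i hi => ?_, ?_⟩⟩⟩ hf hg
  · have := he 0; have := he 1; omega
  · simp; omega
  · simp

theorem sub (hf : PComp f) (hg : PComp g) : PComp fun w e => f w e - g w e := by
  refine comp₂ (op := fun _ => (· - ·)) ⟨⟨_, PolyBd.id, fun w e B hw he =>
    (Nat.sub_le _ _).trans (he 0)⟩, fun d ρ hd hρ => ⟨.sub d (ρ 0) (ρ 1), _,
      (PolyBd.const 1).add (PolyBd.id.add PolyBd.id), fun w s B hi hB he =>
      ⟨_, (Runs.sub s _ _ _).mono ?_, rfl, fun i hi => ?_, ?_⟩⟩⟩ hf hg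
  · have := he 0; have := he 1; omega
  · simp; omega
  · simp

theorem ite (hc : PComp c) (hf : PComp f) (hg : PComp g) :
    PComp fun w e => if c w e ≠ 0 then f w e else g w e := by
  obtain ⟨⟨V, hV, hcV⟩, hc⟩ := hc
  obtain ⟨⟨U, hU, hfU⟩, hf⟩ := hf
  obtain ⟨⟨W, hW, hgW⟩, hg⟩ := hg
  refine ⟨⟨_, hU.add hW, fun w e B hw he => ?_⟩, fun d ρ hd hρ => ?_⟩
  · have := hfU w e B hw he
    have := hgW w e B hw he
    dsimp only
    split_ifs <;> omega
  obtain ⟨P, T, hT, hP⟩ := hc d ρ hd hρ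
  obtain ⟨Q, S, hS, hQ⟩ := hf d ρ hd hρ
  obtain ⟨R, S', hS', hR⟩ := hg d ρ hd hρ
  refine ⟨.seq P (.cond d Q R), _, hT.add ((PolyBd.const 1).add (hV.add (hS.add hS'))),
    fun w s B hi hB he => ?_⟩
  obtain ⟨s1, r1, m1, k1, v1⟩ := hP w s B hi hB he
  have hreg : (fun i => s1.reg (ρ i)) = fun i => s.reg (ρ i) := funext fun i => k1 _ (hρ i)
  have he1 : ∀ i, s1.reg (ρ i) ≤ B := fun i => by rw [k1 _ (hρ i)]; exact he i
  have hi1 := hi.of_eq m1 (k1 0 (by omega))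
  have hv := hcV w _ B hB he
  by_cases h : c w (fun i => s.reg (ρ i)) = 0
  · obtain ⟨s2, r2, m2, k2, v2⟩ := hR w s1 B hi1 hB he1
    refine ⟨s2, (r1.seq (Runs.cond_false (v1.trans h) r2)).mono (by omega), m2.trans m1,
      fun i hi => (k2 i hi).trans (k1 i hi), ?_⟩
    rw [v2, hreg]
    exact (if_neg (not_not.2 h)).symm
  · obtain ⟨s2, r2, m2, k2, v2⟩ := hQ w s1 B hi1 hB he1
    refine ⟨s2, (r1.seq (Runs.cond_true (by rwa [v1]) r2)).mono (by rw [v1]; omega), m2.trans m1,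
      fun i hi => (k2 i hi).trans (k1 i hi), ?_⟩
    rw [v2, hreg]
    exact (if_pos h).symm

/-- Reading a letter of the input. -/
theorem read (hf : PComp f) : PComp fun w e => w.getD (f w e) 0 := by
  -- beyond the input the memory may hold other things, so the address is compared first
  have key : PComp fun w e => if w.length - e 0 ≠ 0 then w.getD (e 0) 0 else 0 := by
    refine ⟨⟨_, PolyBd.id, fun w e B hw he => ?_⟩, fun d ρ hd hρ => ?_⟩
    · dsimp only
      split_ifs
      · exact hw.getD _
      · omega
    refine ⟨.seq (.sub d 0 (ρ 0)) (.cond d (.load d (ρ 0)) (.const d 0)), _,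
      (PolyBd.const 4).add ((PolyBd.id.add PolyBd.id).add ((PolyBd.id.add PolyBd.id).add PolyBd.id)),
      fun w s B hi hB he => ?_⟩
    have h0 := he 0
    have hl := hB.1
    have hr := hi.1
    have hne := (hρ 0).ne
    by_cases h : w.length - s.reg (ρ 0) = 0
    · refine ⟨_, ((Runs.sub s d 0 (ρ 0)).seq (Runs.cond_false (by simp [hr, h])
        (Runs.const _ d 0))).mono ?_, rfl, fun i hi => ?_, ?_⟩
      · omega
      · simp [hi.ne]
      · simp [h]
    · refine ⟨_, ((Runs.sub s d 0 (ρ 0)).seq (Runs.cond_true (by simpa [hr] using h)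
        (Runs.load _ d (ρ 0)))).mono ?_, rfl, fun i hi => ?_, ?_⟩
      · have := hB.getD (s.reg (ρ 0))
        simp only [State.setReg_reg, State.setReg_mem, if_neg hne, hi.2 _ (show s.reg (ρ 0) <
          w.length by omega), if_true]
        omega
      · simp [hi.ne]
      · have hlt : s.reg (ρ 0) < w.length := by omega
        have := hi.2 _ hlt
        simp [hne, h, this, hlt]
  have h2 : (fun (w : List ℕ) (e : ℕ → ℕ) => w.getD (e 0) 0) =
      fun w e => if w.length - e 0 ≠ 0 then w.getD (e 0) 0 else 0 := by
    funext w e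
    split_ifs with h
    · rfl
    · exact List.getD_eq_default _ _ (by omega)
  exact comp₁ (op := fun w x => w.getD x 0) (h2 ▸ key) hf

/-- Iteration, as long as the iterates stay polynomially bounded. The argument `0` of `g` is the
previous iterate. -/
theorem iterate (hc : PComp c) (hf : PComp f) (hg : PComp g) {U : ℕ → ℕ} (hU : PolyBd U)
    (hgU : ∀ w e B, WB w B → (∀ i, e i ≤ B) → ∀ k ≤ c w e,
      (fun x => g w (push x e))^[k] (f w e) ≤ U B) :
    PComp fun w e => (fun x => g w (push x e))^[c w e] (f w e) := by
  obtain ⟨⟨V, hV, hcV⟩, hc⟩ := hc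
  obtain ⟨-, hf⟩ := hf
  obtain ⟨-, hg⟩ := hg
  have hBU : PolyBd fun B => B + U B := PolyBd.id.add hU
  refine ⟨⟨_, hU, fun w e B hw he => hgU w e B hw he _ le_rfl⟩, fun d ρ hd hρ => ?_⟩
  obtain ⟨P, T, hT, hP⟩ := hc d ρ hd hρ
  obtain ⟨Q, S, hS, hQ⟩ := hf (d + 1) ρ (by omega) fun i => (hρ i).trans (by omega)
  obtain ⟨R, S', hS', hR⟩ := hg (d + 2) (push (d + 1) ρ) (by omega)
    (push_lt (by omega) fun i => (hρ i).trans (by omega))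
  let body : Prog := .seq R (.seq (.const (d + 3) 0) (.seq (.add (d + 1) (d + 2) (d + 3))
    (.seq (.const (d + 3) 1) (.sub d d (d + 3)))))
  let Tb : ℕ → ℕ := fun B => S' (B + U B) + (U B + V B + 6)
  have hTb : PolyBd Tb := (hS'.comp hBU).add ((hU.add hV).add (PolyBd.const 6))
  refine ⟨.seq P (.seq Q (.seq (.loop d body) (.seq (.const (d + 3) 0) (.add d (d + 1) (d + 3))))),
    _, hT.add (hS.add (((hV.add (PolyBd.const 1)).mul ((hTb.add hV).add (PolyBd.const 1))).add
      ((PolyBd.const 2).add hU))), fun w s B hi hB he => ?_⟩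
  obtain ⟨s1, r1, m1, k1, v1⟩ := hP w s B hi hB he
  have hreg1 : (fun i => s1.reg (ρ i)) = fun i => s.reg (ρ i) := funext fun i => k1 _ (hρ i)
  obtain ⟨s2, r2, m2, k2, v2⟩ := hQ w s1 B (hi.of_eq m1 (k1 0 (by omega))) hB
    fun i => by rw [k1 _ (hρ i)]; exact he i
  rw [hreg1] at v2
  set e : ℕ → ℕ := fun i => s.reg (ρ i) with he_def
  set n := c w e with hn
  have hnV : n ≤ V B := hcV w e B hB he
  obtain ⟨s3, r3, i3⟩ := Runs.loop (r := d) (n := n) (P := body) (T := Tb B) (s := s2)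
    (fun i t => t.mem = s.mem ∧ (∀ j < d, t.reg j = s.reg j) ∧ t.reg d = n - i ∧
      t.reg (d + 1) = (fun x => g w (push x e))^[i] (f w e)) (fun i t _ h => h.2.2.1)
    (fun i t hin ⟨hm, hk, hd', hv⟩ => by
      have hreg : (fun i => t.reg (ρ i)) = e := funext fun i => hk _ (hρ i)
      have hb := hgU w e B hB he i hin.le
      have henv : ∀ i, t.reg (push (d + 1) ρ i) ≤ B + U B := fun i => by
        have : t.reg (push (d + 1) ρ i) = push (t.reg (d + 1)) (fun i => t.reg (ρ i)) i :=
      congrFun (reg_push t (d + 1) ρ) i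
        rw [this, hreg, hv]
        exact push_le (hb.trans (by omega)) (fun i => (he i).trans (by omega)) i
      obtain ⟨t1, r1, m1, k1, v1⟩ := hR w t (B + U B) (hi.of_eq hm (hk 0 (by omega)))
        (hB.mono (by omega)) henv
      rw [reg_push, hreg, hv] at v1
      have hb' := hgU w e B hB he (i + 1) hin
      rw [Function.iterate_succ_apply'] at hb'
      refine ⟨_, (r1.seq ((Runs.const t1 (d + 3) 0).seq ((Runs.add _ (d + 1) (d + 2) (d + 3)).seq
        ((Runs.const _ (d + 3) 1).seq (Runs.sub _ d d (d + 3)))))).mono ?_, ?_, fun j hj => ?_, ?_,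
        ?_⟩
      · simp [v1, k1 d (by omega), hd', Tb]; omega
      · simp [m1, hm]
      · have h1 : j ≠ d := by omega
        have h2 : j ≠ d + 1 := by omega
        have h3 : j ≠ d + 3 := by omega
        simp [h1, h2, h3, k1 j (by omega), hk j hj]
      · simp [k1 d (by omega), hd']; omega
      · simp only [Function.iterate_succ_apply']
        simp [v1])
    ⟨m2.trans m1, fun j hj => (k2 j (by omega)).trans (k1 j hj), by
      rw [k2 d (by omega), v1, Nat.sub_zero], by simpa using v2⟩
  obtain ⟨hm, hk, hd', hv⟩ := i3
  refine ⟨_, (r1.seq (r2.seq (r3.seq ((Runs.const s3 (d + 3) 0).seq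
    (Runs.add _ d (d + 1) (d + 3)))))).mono ?_, ?_, fun j hj => ?_, ?_⟩
  · have h1 : (n + 1) * (Tb B + n + 1) ≤ (V B + 1) * (Tb B + V B + 1) :=
      Nat.mul_le_mul (by omega) (by omega)
    have h2 := hgU w e B hB he n le_rfl
    simp [hv]
    omega
  · simp [hm]
  · have h1 : j ≠ d := by omega
    have h3 : j ≠ d + 3 := by omega
    simp [h1, h3, hk j hj]
  · simp [hv, hn]

end PComp
end RAM

namespace RAM

namespace PComp

variable {f g c : List ℕ → (ℕ → ℕ) → ℕ}

theorem mul (hf : PComp f) (hg : PComp g) : PComp fun w e => f w e * g w e := by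
  have key : ∀ (a k : ℕ), (fun x => x + a)^[k] 0 = a * k := fun a k => by
    induction k with
    | zero => simp
    | succ k ih => rw [Function.iterate_succ_apply', ih, mul_add, mul_one]
  obtain ⟨V, hV, hfV⟩ := hf.1
  obtain ⟨W, hW, hgW⟩ := hg.1
  have := iterate hg (const 0) ((var 0).add hf.shift) (hV.mul hW) fun w e B hw he k hk => by
    simp only [push_zero, push_succ, key]
    exact Nat.mul_le_mul (hfV w e B hw he) (hk.trans (hgW w e B hw he))
  simpa only [push_zero, push_succ, key] using this

end PComp

/-- The proposition `p w e` can be decided in polynomial time. -/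
def PDec (p : List ℕ → (ℕ → ℕ) → Prop) : Prop :=
  ∃ f, PComp f ∧ ∀ w e, f w e ≠ 0 ↔ p w e

namespace PDec

variable {f g c : List ℕ → (ℕ → ℕ) → ℕ} {p q : List ℕ → (ℕ → ℕ) → Prop}

theorem lt (hf : PComp f) (hg : PComp g) : PDec fun w e => f w e < g w e :=
  ⟨_, hg.sub hf, fun w e => by dsimp only; omega⟩

theorem le (hf : PComp f) (hg : PComp g) : PDec fun w e => f w e ≤ g w e :=
  ⟨_, (hg.add (.const 1)).sub hf, fun w e => by omega⟩

theorem and (hp : PDec p) (hq : PDec q) : PDec fun w e => p w e ∧ q w e :=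
  let ⟨_, hf, h⟩ := hp
  let ⟨_, hg, h'⟩ := hq
  ⟨_, hf.mul hg, fun w e => by dsimp only; rw [← h, ← h']; simp⟩

theorem or (hp : PDec p) (hq : PDec q) : PDec fun w e => p w e ∨ q w e :=
  let ⟨_, hf, h⟩ := hp
  let ⟨_, hg, h'⟩ := hq
  ⟨_, hf.add hg, fun w e => by dsimp only; rw [← h, ← h']; omega⟩

theorem not (hp : PDec p) : PDec fun w e => ¬ p w e :=
  let ⟨_, hf, h⟩ := hp
  ⟨_, (PComp.const 1).sub hf, fun w e => by dsimp only; rw [← h]; omega⟩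

theorem imp (hp : PDec p) (hq : PDec q) : PDec fun w e => p w e → q w e := by
  simpa only [imp_iff_not_or] using hp.not.or hq

theorem eq (hf : PComp f) (hg : PComp g) : PDec fun w e => f w e = g w e := by
  simpa only [le_antisymm_iff] using (le hf hg).and (le hg hf)

theorem ite (hp : PDec p) [∀ w e, Decidable (p w e)] (hf : PComp f) (hg : PComp g) :
    PComp fun w e => if p w e then f w e else g w e := by
  obtain ⟨c, hc, h⟩ := hp
  simpa only [h] using hc.ite hf hg

end PDec

namespace PComp

variable {f g c : List ℕ → (ℕ → ℕ) → ℕ}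

theorem mod (hf : PComp f) (hg : PComp g) : PComp fun w e => f w e % g w e := by
  have key : ∀ (a b : ℕ), (fun x => if x + 1 = b then 0 else x + 1)^[a] 0 = a % b := fun a b => by
    induction a with
    | zero => simp
    | succ k ih =>
      rw [Function.iterate_succ_apply', ih, Nat.add_mod_eq_ite]
      rcases Nat.lt_trichotomy b 1 with hb | rfl | hb
      · obtain rfl : b = 0 := by omega
        simp
      · simp [Nat.mod_one]
      · have := Nat.mod_lt k (show 0 < b by omega)
        rw [Nat.mod_eq_of_lt hb]
        split_ifs <;> omega
  obtain ⟨V, hV, hfV⟩ := hf.1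
  have := iterate hf (const 0) (PDec.ite (PDec.eq ((var 0).add (const 1)) hg.shift) (const 0)
    ((var 0).add (const 1))) hV fun w e B hw he k hk => by
      exact (key k (g w e)).trans_le ((Nat.mod_le _ _).trans (hk.trans (hfV w e B hw he)))
  refine (congrArg PComp ?_).mp this
  funext w e
  exact key (f w e) (g w e)

theorem div (hf : PComp f) (hg : PComp g) : PComp fun w e => f w e / g w e := by
  have key : ∀ (a b n : ℕ), (fun x => if 0 < b ∧ (x + 1) * b ≤ a then x + 1 else x)^[n] 0 =
      min n (a / b) := fun a b n => by
    induction n with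
    | zero => simp
    | succ k ih =>
      rw [Function.iterate_succ_apply', ih]
      rcases Nat.eq_zero_or_pos b with rfl | hb
      · simp
      · simp only [← Nat.le_div_iff_mul_le hb, hb, true_and]
        split_ifs <;> omega
  obtain ⟨V, hV, hfV⟩ := hf.1
  have := iterate hf (const 0) (PDec.ite (PDec.and (PDec.lt (const 0) hg.shift)
    (PDec.le (((var 0).add (const 1)).mul hg.shift) hf.shift))
    ((var 0).add (const 1)) (var 0)) hV fun w e B hw he k hk => by
      exact (key (f w e) (g w e) k).trans_le ((min_le_left _ _).trans (hk.trans (hfV w e B hw he)))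
  refine (congrArg PComp ?_).mp this
  funext w e
  exact (key (f w e) (g w e) (f w e)).trans (min_eq_right (Nat.div_le_self _ _))

end PComp

/-! ### Words computable in polynomial time -/

/-- The memory `m` after writing the word `l` into the cells from `p` on. -/
def writeWord (m : ℕ → ℕ) (p : ℕ) (l : List ℕ) : ℕ → ℕ :=
  fun a => if p ≤ a ∧ a < p + l.length then l.getD (a - p) 0 else m a

theorem writeWord_nil (m : ℕ → ℕ) (p : ℕ) : writeWord m p [] = m := by
  funext a
  simp only [writeWord, List.length_nil]
  rw [if_neg (by omega)]

theorem writeWord_append (m : ℕ → ℕ) (p : ℕ) (l l' : List ℕ) :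
    writeWord (writeWord m p l) (p + l.length) l' = writeWord m p (l ++ l') := by
  funext a
  simp only [writeWord, List.length_append]
  by_cases h1 : p + l.length ≤ a
  · by_cases h2 : a < p + l.length + l'.length
    · rw [if_pos ⟨h1, h2⟩, if_pos ⟨by omega, by omega⟩, List.getD_append_right _ _ _ _ (by omega),
        Nat.sub_sub]
    · rw [if_neg (by omega), if_neg (by omega), if_neg (by omega)]
  · rw [if_neg (by omega)]
    by_cases h2 : p ≤ a
    · rw [if_pos ⟨h2, by omega⟩, if_pos ⟨h2, by omega⟩, List.getD_append _ _ _ _ (by omega)]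
    · rw [if_neg (by omega), if_neg (by omega)]

theorem writeWord_of_lt {m : ℕ → ℕ} {p a : ℕ} (l : List ℕ) (h : a < p) :
    writeWord m p l a = m a := if_neg (by omega)

/-- The word `g w e` has polynomial length and polynomially bounded letters, and can be written in
polynomial time. The program writes it into the memory from the address in register `1` on, and
moves that address behind the word; the memory and the registers below `d` are otherwise left as
they are. -/
def PGen (g : List ℕ → (ℕ → ℕ) → List ℕ) : Prop :=
  (∃ V, PolyBd V ∧ ∀ w e B, WB w B → (∀ i, e i ≤ B) → (g w e).length ≤ V B ∧ ∀ x ∈ g w e, x ≤ V B) ∧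
  ∀ (d : ℕ) (ρ : ℕ → ℕ), 1 < d → (∀ i, ρ i < d) → (∀ i, ρ i ≠ 1) → ∃ P T, PolyBd T ∧
    ∀ w s B, Inp w s → WB w B → (∀ i, s.reg (ρ i) ≤ B) → w.length ≤ s.reg 1 →
    ∃ s', Runs P s (T (B + s.reg 1)) s' ∧
      s'.mem = writeWord s.mem (s.reg 1) (g w fun i => s.reg (ρ i)) ∧
      (∀ i < d, i ≠ 1 → s'.reg i = s.reg i) ∧
      s'.reg 1 = s.reg 1 + (g w fun i => s.reg (ρ i)).length

theorem Inp.of_writeWord {w : List ℕ} {s s' : State} {p : ℕ} {l : List ℕ} (h : Inp w s)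
    (hm : s'.mem = writeWord s.mem p l) (hp : w.length ≤ p)
    (hr : s'.reg 0 = s.reg 0) : Inp w s' :=
  ⟨hr.trans h.1, fun i hi => by rw [hm, writeWord_of_lt _ (by omega)]; exact h.2 i hi⟩

/-- Polynomial bounds can be taken to be monotone. -/
theorem _root_.PolyBd.exists_mono {T : ℕ → ℕ} (hT : PolyBd T) :
    ∃ U, PolyBd U ∧ Monotone U ∧ ∀ B, T B ≤ U B :=
  let ⟨E, hE⟩ := hT
  ⟨fun B => (B + 2) ^ E, ⟨E, fun _ => le_rfl⟩, fun _ _ h => Nat.pow_le_pow_left (by omega) E, hE⟩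

namespace PGen

variable {f : List ℕ → (ℕ → ℕ) → ℕ} {g h : List ℕ → (ℕ → ℕ) → List ℕ}

theorem emit (hf : PComp f) : PGen fun w e => [f w e] := by
  obtain ⟨⟨V, hV, hfV⟩, hf⟩ := hf
  refine ⟨⟨_, hV.add (.const 1), fun w e B hw he => ⟨by simp, fun x hx => ?_⟩⟩,
    fun d ρ hd hρ hρ1 => ?_⟩
  · obtain rfl := List.mem_singleton.1 hx
    exact (hfV w e B hw he).trans (by omega)
  obtain ⟨P, T, hT, hP⟩ := hf d ρ hd hρ
  obtain ⟨T', hT', mT', hTT'⟩ := hT.exists_mono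
  obtain ⟨V', hV', mV', hVV'⟩ := hV.exists_mono
  refine ⟨.seq P (.seq (.store 1 d) (.seq (.const (d + 1) 1) (.add 1 1 (d + 1)))), _,
    hT'.add ((PolyBd.id.add hV').add ((PolyBd.const 5).add PolyBd.id)),
    fun w s B hi hB he hp => ?_⟩
  obtain ⟨s1, r1, m1, k1, v1⟩ := hP w s B hi hB he
  have h1 : d ≠ 0 := by omega
  refine ⟨_, (r1.seq ((Runs.store s1 1 d).seq ((Runs.const _ (d + 1) 1).seq
    (Runs.add _ 1 1 (d + 1))))).mono ?_, ?_, fun i hi h => ?_, ?_⟩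
  · have h2 := (hfV w _ B hB he).trans ((hVV' B).trans (mV' (show B ≤ B + s.reg 1 by omega)))
    have h3 := (hTT' B).trans (mT' (show B ≤ B + s.reg 1 by omega))
    simp [v1, k1 1 hd, h1]
    omega
  · funext a
    by_cases ha : a = s.reg 1
    · subst ha
      simp [writeWord, k1 1 hd, v1]
    · simp [writeWord, k1 1 hd, m1, ha]
      omega
  · have : i ≠ d + 1 := by omega
    simp [h, this, k1 i hi]
  · simp [h1, k1 1 hd]

theorem append (hg : PGen g) (hh : PGen h) : PGen fun w e => g w e ++ h w e := by
  obtain ⟨⟨V, hV, hgV⟩, hg⟩ := hg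
  obtain ⟨⟨U, hU, hhU⟩, hh⟩ := hh
  refine ⟨⟨_, hV.add hU, fun w e B hw he => ?_⟩, fun d ρ hd hρ hρ1 => ?_⟩
  · obtain ⟨a, b⟩ := hgV w e B hw he
    obtain ⟨a', b'⟩ := hhU w e B hw he
    refine ⟨by simp; omega, fun x hx => ?_⟩
    rcases List.mem_append.1 hx with hx | hx
    · exact (b x hx).trans (by omega)
    · exact (b' x hx).trans (by omega)
  obtain ⟨P, T, hT, hP⟩ := hg d ρ hd hρ hρ1
  obtain ⟨Q, S, hS, hQ⟩ := hh d ρ hd hρ hρ1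
  obtain ⟨S', hS', mS', hSS'⟩ := hS.exists_mono
  obtain ⟨V', hV', mV', hVV'⟩ := hV.exists_mono
  refine ⟨.seq P Q, _, hT.add (hS'.comp (PolyBd.id.add hV')), fun w s B hi hB he hp => ?_⟩
  obtain ⟨s1, r1, m1, k1, v1⟩ := hP w s B hi hB he hp
  have hreg1 : (fun i => s1.reg (ρ i)) = fun i => s.reg (ρ i) :=
    funext fun i => k1 _ (hρ i) (hρ1 i)
  obtain ⟨s2, r2, m2, k2, v2⟩ := hQ w s1 B (hi.of_writeWord m1 hp (k1 0 (by omega) (by omega))) hB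
    (fun i => (congrFun hreg1 i).trans_le (he i)) (by omega)
  rw [hreg1] at m2 v2
  have hl := ((hgV w _ B hB he).1.trans (hVV' B)).trans (mV' (show B ≤ B + s.reg 1 by omega))
  refine ⟨s2, (r1.seq r2).mono (Nat.add_le_add_left ((hSS' _).trans (mS' ?_)) _), ?_,
    fun i hi h1 => (k2 i hi h1).trans (k1 i hi h1), ?_⟩
  · omega
  · rw [m2, m1, v1, writeWord_append]
  · rw [v2, v1, List.length_append]; omega

/-- The concatenation of the words `g 0, ..., g (n - 1)`. -/
theorem flatMap (hf : PComp f) (hg : PGen g) :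
    PGen fun w e => (List.range (f w e)).flatMap fun i => g w (push i e) := by
  obtain ⟨⟨V, hV, hfV⟩, hf⟩ := hf
  obtain ⟨⟨U, hU, hgU⟩, hg⟩ := hg
  have hBV : PolyBd fun B => B + V B := PolyBd.id.add hV
  have hlen : ∀ w e B, WB w B → (∀ i, e i ≤ B) → ∀ n ≤ f w e,
      ((List.range n).flatMap fun i => g w (push i e)).length ≤ n * U (B + V B) := by
    intro w e B hw he n hn
    induction n with
    | zero => simp
    | succ n ih =>
      have := (hgU w (push n e) (B + V B) (hw.mono (by omega)) (push_le
        (by have := hfV w e B hw he; omega) fun i => (he i).trans (by omega))).1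
      have := ih (by omega)
      rw [List.range_succ, List.flatMap_append, List.length_append, add_mul, one_mul,
        List.flatMap_singleton]
      omega
  refine ⟨⟨fun B => V B * U (B + V B) + U (B + V B), (hV.mul (hU.comp hBV)).add (hU.comp hBV),
    fun w e B hw he => ⟨?_, fun x hx => ?_⟩⟩, fun d ρ hd hρ hρ1 => ?_⟩
  · exact (hlen w e B hw he _ le_rfl).trans
      ((Nat.mul_le_mul_right _ (hfV w e B hw he)).trans (Nat.le_add_right _ _))
  · obtain ⟨i, hi, hx⟩ := List.mem_flatMap.1 hx
    have hi := List.mem_range.1 hi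
    exact ((hgU w (push i e) (B + V B) (hw.mono (by omega)) (push_le
      (by have := hfV w e B hw he; omega) fun i => (he i).trans (by omega))).2 x hx).trans
      (Nat.le_add_left _ _)
  obtain ⟨P, T, hT, hP⟩ := hf d ρ hd hρ
  obtain ⟨Q, S, hS, hQ⟩ := hg (d + 2) (push (d + 1) ρ) (by omega)
    (push_lt (by omega) fun i => (hρ i).trans (by omega))
    (by rintro (_ | i); exacts [show d + 1 ≠ 1 by omega, hρ1 i])
  obtain ⟨T', hT', mT', hTT'⟩ := hT.exists_mono
  obtain ⟨S', hS', mS', hSS'⟩ := hS.exists_mono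
  obtain ⟨V', hV', mV', hVV'⟩ := hV.exists_mono
  let L : ℕ → ℕ := fun B => V B * U (B + V B)
  obtain ⟨L', hL', mL', hLL'⟩ := (show PolyBd L from hV.mul (hU.comp hBV)).exists_mono
  let body : Prog := .seq Q (.seq (.const (d + 2) 1) (.seq (.add (d + 1) (d + 1) (d + 2))
    (.sub d d (d + 2))))
  let Tb : ℕ → ℕ := fun C => S' (C + V' C + L' C) + (V' C + V' C + 7)
  have hTb : PolyBd Tb := (hS'.comp ((PolyBd.id.add hV').add hL')).add
    ((hV'.add hV').add (PolyBd.const 7))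
  refine ⟨.seq P (.seq (.const (d + 1) 0) (.loop d body)), _, hT'.add ((PolyBd.const 1).add
    ((hV'.add (PolyBd.const 1)).mul ((hTb.add hV').add (PolyBd.const 1)))),
    fun w s B hi hB he hp => ?_⟩
  obtain ⟨s1, r1, m1, k1, v1⟩ := hP w s B hi hB he
  set e : ℕ → ℕ := fun i => s.reg (ρ i) with he_def
  set n := f w e with hn
  set C := B + s.reg 1 with hC
  have hnV : n ≤ V B := hfV w e B hB he
  have hVC : V B ≤ V' C := (hVV' B).trans (mV' (by omega))
  have hLC : L B ≤ L' C := (hLL' B).trans (mL' (by omega))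
  let G : ℕ → List ℕ := fun k => (List.range k).flatMap fun i => g w (push i e)
  have hG : ∀ k ≤ n, (G k).length ≤ L' C := fun k hk => (hlen w e B hB he k hk).trans
    ((Nat.mul_le_mul_right _ (hk.trans hnV)).trans hLC)
  obtain ⟨s3, r3, hm, hk, hd', hv, hq⟩ := Runs.loop (r := d) (n := n) (P := body) (T := Tb C)
    (s := s1.setReg (d + 1) 0)
    (fun i t => t.mem = writeWord s.mem (s.reg 1) (G i) ∧ (∀ j < d, j ≠ 1 → t.reg j = s.reg j) ∧
      t.reg d = n - i ∧ t.reg (d + 1) = i ∧ t.reg 1 = s.reg 1 + (G i).length)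
    (fun i t _ h => h.2.2.1)
    (fun i t hin ⟨hm, hk, hd', hv, hq⟩ => by
      have hreg : (fun i => t.reg (ρ i)) = e := funext fun i => hk _ (hρ i) (hρ1 i)
      have henv : ∀ j, t.reg (push (d + 1) ρ j) ≤ B + V B := fun j => by
        have : t.reg (push (d + 1) ρ j) = push (t.reg (d + 1)) (fun i => t.reg (ρ i)) j :=
          congrFun (reg_push t (d + 1) ρ) j
        rw [this, hreg, hv]
        exact push_le (by omega) (fun i => (he i).trans (by omega)) j
      obtain ⟨t1, r1, m1, k1, v1⟩ := hQ w t (B + V B)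
        (hi.of_writeWord hm hp (hk 0 (by omega) (by omega))) (hB.mono (by omega)) henv (by omega)
      rw [reg_push, hreg, hv] at v1 m1
      have hG1 : G (i + 1) = G i ++ g w (push i e) := by
        simp [G, List.range_succ]
      have h1 := hG i hin.le
      refine ⟨_, (r1.seq ((Runs.const t1 (d + 2) 1).seq ((Runs.add _ (d + 1) (d + 1) (d + 2)).seq
        (Runs.sub _ d d (d + 2))))).mono ?_, ?_, fun j hj hj1 => ?_, ?_, ?_, ?_⟩
      · have : S (B + V B + t.reg 1) ≤ S' (C + V' C + L' C) :=
          (hSS' _).trans (mS' (by omega))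
        simp [k1 d (by omega) (by omega), hd', k1 (d + 1) (by omega) (by omega), hv, Tb]
        omega
      · simp only [State.setReg_mem]
        rw [m1, hm, hq, writeWord_append, hG1]
      · have h1 : j ≠ d := by omega
        have h2 : j ≠ d + 1 := by omega
        have h3 : j ≠ d + 2 := by omega
        simp [h1, h2, h3, k1 j (by omega) hj1, hk j hj hj1]
      · simp [k1 d (by omega) (by omega), hd']; omega
      · simp [k1 (d + 1) (by omega) (by omega), hv]
      · have h1 : 1 ≠ d := by omega
        have h2 : d ≠ 0 := by omega
        simp [h1, h2, v1, hq, hG1]; omega)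
    ⟨by simp [G, writeWord_nil, m1], fun j hj _ => by
      have : j ≠ d + 1 := by omega
      simp [this, k1 j hj], by simp [v1], by simp, by
      have : d ≠ 0 := by omega
      simp [this, k1 1 hd, G]⟩
  refine ⟨s3, (r1.seq ((Runs.const s1 (d + 1) 0).seq r3)).mono ?_, hm, hk, hq⟩
  have h1 : (n + 1) * (Tb C + n + 1) ≤ (V' C + 1) * (Tb C + V' C + 1) :=
    Nat.mul_le_mul (by omega) (by omega)
  have h2 := (hTT' B).trans (mT' (show B ≤ C by omega))
  omega

end PGen
end RAM

namespace RAM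

/-- A program changes only finitely many registers. -/
theorem exists_reg_bound (P : Prog) :
    ∃ r, ∀ s t s', Exec P s t s' → ∀ i, r ≤ i → s'.reg i = s.reg i := by
  induction P with
  | skip => exact ⟨0, fun s t s' h i hi => by cases h; rfl⟩
  | const r c | add r a b | sub r a b | load r a =>
    exact ⟨r + 1, fun s t s' h i hi => by
      cases h
      have : i ≠ r := by omega
      simp [this]⟩
  | store a b => exact ⟨0, fun s t s' h i hi => by cases h; rfl⟩
  | seq P Q hP hQ =>
    obtain ⟨p, hP⟩ := hP
    obtain ⟨q, hQ⟩ := hQ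
    refine ⟨max p q, fun s t s' h i hi => ?_⟩
    cases h with
    | seq h1 h2 => exact (hQ _ _ _ h2 i (by omega)).trans (hP _ _ _ h1 i (by omega))
  | cond r P Q hP hQ =>
    obtain ⟨p, hP⟩ := hP
    obtain ⟨q, hQ⟩ := hQ
    refine ⟨max p q, fun s t s' h i hi => ?_⟩
    cases h with
    | cond_true _ h => exact hP _ _ _ h i (by omega)
    | cond_false _ h => exact hQ _ _ _ h i (by omega)
  | loop r P hP =>
    obtain ⟨p, hP⟩ := hP
    refine ⟨p, fun s t s' h => ?_⟩
    generalize hL : Prog.loop r P = L at h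
    induction h with
    | loop_stop => intros; rfl
    | loop_step _ h1 h2 _ ih =>
      obtain ⟨rfl, rfl⟩ := Prog.loop.inj hL
      exact fun i hi => (ih rfl i hi).trans (hP _ _ _ h1 i hi)
    | _ => cases hL

/-- The registers `1, ..., k` can be cleared. -/
theorem exists_clear (k : ℕ) : ∃ Z T, ∀ s : State, ∃ s', Runs Z s T s' ∧ s'.mem = s.mem ∧
    ∀ i, s'.reg i = if 1 ≤ i ∧ i ≤ k then 0 else s.reg i := by
  induction k with
  | zero => exact ⟨.skip, 1, fun s => ⟨s, ⟨1, le_rfl, .skip s⟩, rfl, fun i => by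
      rw [if_neg (by omega)]⟩⟩
  | succ k ih =>
    obtain ⟨Z, T, h⟩ := ih
    refine ⟨.seq Z (.const (k + 1) 0), T + (1 + 0), fun s => ?_⟩
    obtain ⟨s1, r1, m1, k1⟩ := h s
    refine ⟨_, r1.seq (Runs.const _ _ _), m1, fun i => ?_⟩
    simp only [State.setReg_reg, k1]
    split_ifs <;> first | rfl | omega

/-- A word computable in polynomial time can take the place of the input, with the machine as in
its initial state. -/
theorem PGen.exists_prog {g : List ℕ → (ℕ → ℕ) → List ℕ} (hg : PGen g) :
    ∃ Q T, PolyBd T ∧ ∀ w B, WB w B → Runs Q (init w) (T B) (init (g w fun _ => w.length)) := by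
  obtain ⟨⟨V, hV, hgV⟩, hg⟩ := hg
  obtain ⟨P, T, hT, hP⟩ := hg 2 (fun _ => 0) (by omega) (fun _ => by omega) (fun _ => by omega)
  obtain ⟨T', hT', mT', hTT'⟩ := hT.exists_mono
  let copy : Prog := .seq (.add 4 3 0) (.seq (.load 4 4) (.seq (.store 3 4)
    (.seq (.const 5 1) (.seq (.add 3 3 5) (.sub 2 2 5)))))
  let wipe : Prog := .seq (.const 5 0) (.seq (.store 3 5) (.seq (.const 5 1)
    (.seq (.add 3 3 5) (.sub 2 2 5))))
  let main : Prog := .seq (.const 5 0) (.seq (.add 1 0 5) (.seq P (.seq (.sub 2 1 0)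
    (.seq (.const 3 0) (.seq (.loop 2 copy) (.seq (.const 5 0) (.seq (.add 2 0 5)
    (.seq (.loop 2 wipe) (.sub 0 1 0)))))))))
  obtain ⟨r, hr⟩ := exists_reg_bound main
  obtain ⟨Z, TZ, hZ⟩ := exists_clear r
  let Tl : ℕ → ℕ := fun B => 10 * (V B + B) + 20
  have hTl : PolyBd Tl := ((PolyBd.const 10).mul (hV.add PolyBd.id)).add (PolyBd.const 20)
  let Tm : ℕ → ℕ := fun B => T' (B + B) + (V B + 1) * (Tl B + V B + 1) +
    (B + 1) * (Tl B + B + 1) + Tl B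
  have hTm : PolyBd Tm := (((hT'.comp (PolyBd.id.add PolyBd.id)).add ((hV.add (.const 1)).mul
    ((hTl.add hV).add (.const 1)))).add ((PolyBd.id.add (.const 1)).mul
    ((hTl.add PolyBd.id).add (.const 1)))).add hTl
  refine ⟨.seq main Z, _, hTm.add (.const TZ), fun w B hB => ?_⟩
  set out := g w fun _ => w.length with hout
  have hL := hB.1
  obtain ⟨hM, hx⟩ := hgV w (fun _ => w.length) B hB fun _ => hL
  rw [← hout] at hM hx
  set s0 : State := ((init w).setReg 5 0).setReg 1 w.length with hs0
  have i0 : Inp w s0 := ⟨by simp [s0, init], fun i _ => rfl⟩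
  obtain ⟨s1, r1, m1, k1, v1⟩ := hP w s0 B i0 hB (fun _ => by rw [i0.1]; exact hL) (by simp [s0])
  have e0 : (fun _ : ℕ => s0.reg 0) = fun _ => w.length := funext fun _ => i0.1
  rw [e0, ← hout] at m1 v1
  have p0 : s0.reg 1 = w.length := by simp [s0]
  rw [p0] at m1 v1 r1
  have q0 : s1.reg 0 = w.length := (k1 0 (by omega) (by omega)).trans i0.1
  have m0 : ∀ a, s0.mem a = w.getD a 0 := fun a => rfl
  -- the output is moved to the beginning of the memory
  obtain ⟨s2, r2, a2, b2, c2, d2, f2⟩ := Runs.loop (r := 2) (n := out.length) (P := copy)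
    (T := Tl B) (s := (s1.setReg 2 out.length).setReg 3 0)
    (fun i t => (∀ a, t.mem a = if a < i then out.getD a 0 else s1.mem a) ∧
      t.reg 2 = out.length - i ∧ t.reg 3 = i ∧ t.reg 0 = w.length ∧
      t.reg 1 = w.length + out.length) (fun i t _ h => h.2.1)
    (fun i t hin ⟨ha, hb, hc, hd, hf⟩ => by
      have hrd : t.mem (i + w.length) = out.getD i 0 := by
        rw [ha, if_neg (by omega), m1, writeWord, if_pos ⟨by omega, by omega⟩]
        simp
      have hxi : out.getD i 0 ≤ V B := by
        rw [List.getD_eq_getElem _ _ hin]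
        exact hx _ (List.getElem_mem _)
      refine ⟨_, ((Runs.add t 4 3 0).seq ((Runs.load _ 4 4).seq ((Runs.store _ 3 4).seq
        ((Runs.const _ 5 1).seq ((Runs.add _ 3 3 5).seq (Runs.sub _ 2 2 5)))))).mono ?_,
        fun a => ?_, ?_, ?_, ?_, ?_⟩
      · simp only [Tl, hb, hc, hd, State.setReg_reg, State.setReg_mem, State.setMem_reg, if_true, hrd,
          reduceIte, Nat.reduceEqDiff]
        omega
      · simp only [hc, hd, State.setReg_reg, State.setReg_mem, State.setMem_mem, if_true, hrd,
          reduceIte, Nat.reduceEqDiff, ha]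
        by_cases h1 : a = i
        · subst h1; simp
        · by_cases h2 : a < i
          · simp [h1, h2, show a < i + 1 by omega]
          · simp [h1, h2, show ¬ a < i + 1 by omega]
      · simp [hb]; omega
      · simp [hc]
      · simp [hd]
      · simp [hf])
    ⟨fun a => by simp, by simp, by simp, by simp [q0], by simp [v1]⟩
  -- what is left behind it is wiped out
  obtain ⟨s3, r3, a3, b3, c3, d3, f3⟩ := Runs.loop (r := 2) (n := w.length) (P := wipe)
    (T := Tl B) (s := (s2.setReg 5 0).setReg 2 w.length)
    (fun i t => (∀ a, t.mem a = if out.length ≤ a ∧ a < out.length + i then 0 else s2.mem a) ∧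
      t.reg 2 = w.length - i ∧ t.reg 3 = out.length + i ∧ t.reg 0 = w.length ∧
      t.reg 1 = w.length + out.length) (fun i t _ h => h.2.1)
    (fun i t hin ⟨ha, hb, hc, hd, hf⟩ => by
      refine ⟨_, ((Runs.const t 5 0).seq ((Runs.store _ 3 5).seq
        ((Runs.const _ 5 1).seq ((Runs.add _ 3 3 5).seq (Runs.sub _ 2 2 5))))).mono ?_,
        fun a => ?_, ?_, ?_, ?_, ?_⟩
      · simp only [Tl, hb, hc, State.setReg_reg, State.setMem_reg, if_true,
          reduceIte, Nat.reduceEqDiff]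
        omega
      · simp only [hc, State.setReg_reg, State.setReg_mem, State.setMem_mem, if_true,
          reduceIte, Nat.reduceEqDiff, ha]
        by_cases h1 : a = out.length + i
        · subst h1; simp
        · by_cases h2 : out.length ≤ a ∧ a < out.length + i
          · rw [if_neg h1, if_pos h2, if_pos (by omega)]
          · rw [if_neg h1, if_neg h2, if_neg (by omega)]
      · simp [hb]; omega
      · simp [hc]; omega
      · simp [hd]
      · simp [hf])
    ⟨fun a => by rw [if_neg (by omega)]; simp, by simp, by simp [c2], by simp [d2], by simp [f2]⟩
  have run : Runs main (init w) (Tm B) (s3.setReg 0 (s3.reg 1 - s3.reg 0)) := by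
    have h1 : Runs (.add 1 0 5) ((init w).setReg 5 0) (1 + w.length) s0 := by
      have := Runs.add ((init w).setReg 5 0) 1 0 5
      simpa [init, s0] using this
    have h2 : Runs (.sub 2 1 0) s1 (1 + (w.length + out.length) + w.length)
        (s1.setReg 2 out.length) := by
      have := Runs.sub s1 2 1 0
      rwa [v1, q0, Nat.add_sub_cancel_left] at this
    have h3 : Runs (.add 2 0 5) (s2.setReg 5 0) (1 + w.length)
        ((s2.setReg 5 0).setReg 2 w.length) := by
      have := Runs.add (s2.setReg 5 0) 2 0 5
      simpa [d2] using this
    have h4 := Runs.sub s3 0 1 0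
    rw [d3, f3] at h4
    rw [d3, f3]
    refine ((Runs.const _ 5 0).seq (h1.seq (r1.seq (h2.seq ((Runs.const _ 3 0).seq (r2.seq
      ((Runs.const _ 5 0).seq (h3.seq (r3.seq h4))))))))).mono ?_
    have l1 : T (B + w.length) ≤ T' (B + B) := (hTT' _).trans (mT' (by omega))
    have l2 : (out.length + 1) * (Tl B + out.length + 1) ≤ (V B + 1) * (Tl B + V B + 1) :=
      Nat.mul_le_mul (by omega) (by omega)
    have l3 : (w.length + 1) * (Tl B + w.length + 1) ≤ (B + 1) * (Tl B + B + 1) :=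
      Nat.mul_le_mul (by omega) (by omega)
    simp only [Tm]
    have l4 : Tl B = 10 * (V B + B) + 20 := rfl
    omega
  obtain ⟨s4, r4, m4, k4⟩ := hZ (s3.setReg 0 (s3.reg 1 - s3.reg 0))
  have fin : s4 = init out := by
    ext i
    · rw [k4]
      rcases Nat.eq_zero_or_pos i with rfl | hi
      · simp [d3, f3, init]
      · split_ifs with h
        · simp [init, show i ≠ 0 by omega]
        · obtain ⟨t, -, ht⟩ := run
          rw [hr _ _ _ ht i (by omega)]
          simp [init, show i ≠ 0 by omega]
    · rw [m4, State.setReg_mem, a3, a2]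
      simp only [init]
      split_ifs with h1 h2
      · rw [List.getD_eq_default _ _ h1.1]
      · rfl
      · rw [m1, writeWord, if_neg (by omega), m0, List.getD_eq_default _ _ (by omega),
          List.getD_eq_default _ _ (by omega)]
  rw [← fin]
  exact run.seq r4

end RAM

/-! ### The graph -/

/-- A constraint satisfaction problem with variables `0, ..., N - 1`, values `0, ..., 4` and
constraints `0, ..., J - 1`. The constraint `j` asks for a choice `κ < K₁` that is not bad for `j`,
where, for each `c < K₂` that clashes with `κ`, the variable `row j c` must not have the value
`c % 5`. -/
structure SelCSP where
  N : ℕ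
  J : ℕ
  K₁ : ℕ
  K₂ : ℕ
  row : ℕ → ℕ → ℕ
  bad : ℕ → ℕ → Prop
  clash : ℕ → ℕ → Prop
  N_pos : 0 < N
  J_pos : 0 < J

/-- A vertex of the graph: `a` tells its kind, `t` its place, `i` distinguishes the vertices of this
kind at this place, and `f` counts copies.

The kinds are: `0` root, `1` link (two copies), `2` selector (`i = 5 * w + s` is the selector number
`w < 4` for the state `s`), `3` selector clamp, `4` item,
`5` item clamp (`i = 8 * w + x` is the clamp of the item `x` and the selectors with number `w`),
`6` choice clamp, `7` bad clamp, `8` clash clamp, `9` choice. -/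
@[ext]
structure Vx where
  a : ℕ
  t : ℕ
  i : ℕ
  f : ℕ

/-- The items that may be present at a cell in state `s`. The items `0, ..., 3` belong to the link
on the right of the cell, the items `4, ..., 7` to the link on its left. -/
def ItemOk (x s : ℕ) : Prop :=
  (x = 0 ∧ (s = 0 ∨ s = 3 ∨ s = 4)) ∨ (x = 1 ∧ (s = 1 ∨ s = 4)) ∨ (x = 2 ∧ (s = 1 ∨ s = 3)) ∨
  (x = 3 ∧ (s = 0 ∨ s = 2)) ∨ (x = 4 ∧ (s = 1 ∨ s = 2 ∨ s = 4)) ∨ (x = 5 ∧ s = 4) ∨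
  (x = 6 ∧ (s = 1 ∨ s = 3)) ∨ (x = 7 ∧ (s = 0 ∨ s = 2 ∨ s = 3 ∨ s = 4))

namespace SelCSP

variable (D : SelCSP)

/-- Under the assignment `σ`, the constraint `j` is satisfied. -/
def Holds (σ : ℕ → ℕ) (j : ℕ) : Prop :=
  ∃ κ < D.K₁, ¬ D.bad j κ ∧ ∀ c < D.K₂, D.clash c κ → σ (D.row j c) ≠ c % 5

/-- The number of cells. The cell `j * N + i` stands for the variable `i` at the constraint `j`. -/
def T : ℕ := D.N * D.J

/-- A bound for the index `i` of a vertex. -/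
def M : ℕ := D.K₁ + D.K₂ + 32

/-- For each cell all but four of the twenty selectors, for each link five of the ten vertices of the
link and its items, and for each constraint all choices but one. -/
def budget : ℕ := 16 * D.T + 5 * (D.T - D.N) + D.J * (D.K₁ - 1)

/-- The number of copies of a clamp: after the deletion of `budget` vertices two are left. -/
def F : ℕ := D.budget + 2

/-- The number of vertices. -/
def n : ℕ := D.T * 10 * D.M * D.F

theorem T_pos : 0 < D.T := Nat.mul_pos D.N_pos D.J_pos
theorem M_pos : 0 < D.M := by simp only [M]; omega
theorem F_pos : 0 < D.F := by simp only [F]; omega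

theorem J_le_T : D.J ≤ D.T := Nat.le_mul_of_pos_left _ D.N_pos

/-- The vertex with the number `u`. -/
def dec (u : ℕ) : Vx := ⟨u / D.F / D.M % 10, u / D.F / D.M / 10, u / D.F % D.M, u % D.F⟩

/-- The number of a vertex. -/
def enc (x : Vx) : ℕ := ((x.t * 10 + x.a) * D.M + x.i) * D.F + x.f

/-- The vertices that have a number. -/
def InR (x : Vx) : Prop := x.a < 10 ∧ x.t < D.T ∧ x.i < D.M ∧ x.f < D.F

variable {D}

theorem dec_enc {x : Vx} (h : D.InR x) : D.dec (D.enc x) = x := by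
  obtain ⟨h1, h2, h3, h4⟩ := h
  have e1 : D.enc x / D.F = (x.t * 10 + x.a) * D.M + x.i := by
    rw [enc, mul_comm _ D.F, Nat.mul_add_div D.F_pos, Nat.div_eq_of_lt h4, add_zero]
  have e2 : D.enc x / D.F / D.M = x.t * 10 + x.a := by
    rw [e1, mul_comm _ D.M, Nat.mul_add_div D.M_pos, Nat.div_eq_of_lt h3, add_zero]
  ext
  · simp only [dec, e2]; omega
  · simp only [dec, e2]; omega
  · simp only [dec, e1]
    rw [Nat.mul_add_mod_of_lt h3]
  · simp only [dec, enc]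
    rw [Nat.mul_add_mod_of_lt h4]

theorem enc_lt {x : Vx} (h : D.InR x) : D.enc x < D.n := by
  obtain ⟨h1, h2, h3, h4⟩ := h
  have e1 : x.t * 10 + x.a + 1 ≤ D.T * 10 := by omega
  have e2 : (x.t * 10 + x.a) * D.M + x.i + 1 ≤ D.T * 10 * D.M := by
    calc _ ≤ (x.t * 10 + x.a + 1) * D.M := by rw [add_mul _ 1, one_mul]; omega
      _ ≤ _ := Nat.mul_le_mul_right _ e1
  calc D.enc x < ((x.t * 10 + x.a) * D.M + x.i + 1) * D.F := by
        rw [enc, add_mul _ 1, one_mul]; omega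
    _ ≤ _ := Nat.mul_le_mul_right _ e2

theorem inR_dec {u : ℕ} (h : u < D.n) : D.InR (D.dec u) := by
  refine ⟨Nat.mod_lt _ (by omega), ?_, Nat.mod_lt _ D.M_pos, Nat.mod_lt _ D.F_pos⟩
  simp only [dec]
  rw [Nat.div_lt_iff_lt_mul (by omega), Nat.div_lt_iff_lt_mul D.M_pos,
    Nat.div_lt_iff_lt_mul D.F_pos]
  exact h

theorem enc_dec (u : ℕ) : D.enc (D.dec u) = u := by
  simp only [enc, dec]
  rw [mul_comm _ 10, Nat.div_add_mod, mul_comm _ D.M, Nat.div_add_mod, mul_comm _ D.F,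
    Nat.div_add_mod]

theorem dec_injective : Function.Injective D.dec := fun u v h => by
  rw [← enc_dec u, ← enc_dec v, h]

variable (D)

/-- The item `x` is present at the cell `t` if the link that it belongs to is. -/
def Act (t x : ℕ) : Prop := (x < 4 ∧ t + D.N < D.T) ∨ (4 ≤ x ∧ D.N ≤ t)

/-- The vertex `x` belongs to the group of the clamp `y`. At most one vertex of each group can be
retained. The groups are: the selectors of a cell with the same number; an item and the selectors,
with the same number, for the states that do not allow it; the choices of a constraint; the root and
the bad choices of a constraint; and the choices that clash with `c`, together with a selector for the
value that they exclude. -/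
def Clamp (x y : Vx) : Prop :=
  x.f = 0 ∧
  ((x.a = 2 ∧ x.i < 20 ∧ y.a = 3 ∧ y.i = x.i / 5 ∧ y.t = x.t) ∨
  (x.a = 2 ∧ x.i < 20 ∧ y.a = 5 ∧ y.i < 32 ∧ y.i / 8 = x.i / 5 ∧ y.t = x.t ∧
    D.Act y.t (y.i % 8) ∧ ¬ ItemOk (y.i % 8) (x.i % 5)) ∨
  (x.a = 4 ∧ x.i = y.i % 8 ∧ y.a = 5 ∧ y.i < 32 ∧ y.t = x.t ∧ D.Act y.t (y.i % 8)) ∨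
  (x.a = 0 ∧ x.t = 0 ∧ x.i = 0 ∧ y.a = 7 ∧ y.i = 0 ∧ y.t < D.J) ∨
  (x.a = 9 ∧ x.i < D.K₁ ∧ x.t < D.J ∧ y.a = 6 ∧ y.i = 0 ∧ y.t = x.t) ∨
  (x.a = 9 ∧ x.i < D.K₁ ∧ x.t < D.J ∧ y.a = 7 ∧ y.i = 0 ∧ y.t = x.t ∧ D.bad x.t x.i) ∨
  (x.a = 9 ∧ x.i < D.K₁ ∧ x.t < D.J ∧ y.a = 8 ∧ y.i < D.K₂ ∧ y.t = x.t ∧ D.clash y.i x.i) ∨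
  (x.a = 2 ∧ x.i = y.i % 5 ∧ y.a = 8 ∧ y.i < D.K₂ ∧ y.t < D.J ∧
    x.t = y.t * D.N + D.row y.t y.i))

/-- The other edges: those between the root and the items `0` and `4`, between the items `0`, `1`
and the items `4`, `5` of a cell, and between a link and the items `0, 1, 2` on its left and
`4, 5, 6` on its right. -/
def Thin (x y : Vx) : Prop :=
  (x.a = 0 ∧ x.t = 0 ∧ x.i = 0 ∧ x.f = 0 ∧ y.a = 4 ∧ (y.i = 0 ∨ y.i = 4) ∧ y.f = 0 ∧
    D.Act y.t y.i) ∨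
  (x.a = 4 ∧ y.a = 4 ∧ x.t = y.t ∧ x.f = 0 ∧ y.f = 0 ∧
    ((x.i = 0 ∧ y.i = 1) ∨ (x.i = 4 ∧ y.i = 5)) ∧ D.Act x.t x.i) ∨
  (x.a = 4 ∧ x.f = 0 ∧ y.a = 1 ∧ y.i = 0 ∧ y.f < 2 ∧
    ((x.i = 0 ∧ x.t = y.t) ∨ (x.i = 4 ∧ x.t = y.t + D.N)) ∧ y.t + D.N < D.T) ∨
  (x.a = 1 ∧ x.i = 0 ∧ x.f < 2 ∧ y.a = 4 ∧ y.f = 0 ∧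
    (((y.i = 1 ∨ y.i = 2) ∧ y.t = x.t) ∨ ((y.i = 5 ∨ y.i = 6) ∧ y.t = x.t + D.N)) ∧
    x.t + D.N < D.T)

/-- The edges, directed from lower to higher rank. Vertices without edges are not part of the
construction proper; they are isolated and thus twins. -/
def E (x y : Vx) : Prop := D.Clamp x y ∨ D.Thin x y

/-- Adjacency of vertices. -/
def Adj (x y : Vx) : Prop := D.E x y ∨ D.E y x

/-- The rank of a vertex. If no vertex has two retained neighbours that are not of higher rank, then
the retained graph is acyclic. -/
def _root_.Vx.rank (x : Vx) : ℕ :=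
  if x.a = 0 then 0 else if x.a = 1 then 2
  else if x.a = 4 then (if x.i = 0 ∨ x.i = 4 then 1 else 3)
  else if x.a = 2 ∨ x.a = 9 then 1 else 4

variable {D}

theorem E.rank_lt {x y : Vx} (h : D.E x y) : x.rank < y.rank := by
  simp only [Vx.rank]
  rcases h with ⟨-, h⟩ | h
  · rcases h with h | h | h | h | h | h | h | h <;>
      (simp [h.1, h.2]; try (split_ifs <;> omega))
  · rcases h with h | h | h | h
    · obtain ⟨h1, -, -, -, h2, h3, -⟩ := h
      simp [h1, h2, h3]
    · obtain ⟨h1, h2, -, -, -, h3, -⟩ := h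
      rcases h3 with h3 | h3 <;> simp [h1, h2, h3]
    · obtain ⟨h1, -, h2, -, -, h3, -⟩ := h
      rcases h3 with h3 | h3 <;> simp [h1, h2, h3]
    · obtain ⟨h1, -, -, h2, -, h3, -⟩ := h
      rcases h3 with ⟨h3 | h3, -⟩ | ⟨h3 | h3, -⟩ <;> simp [h1, h2, h3]

theorem E.ne {x y : Vx} (h : D.E x y) : x ≠ y := fun e => by
  subst e; exact lt_irrefl _ h.rank_lt

theorem Adj.symm {x y : Vx} (h : D.Adj x y) : D.Adj y x := Or.symm h

theorem Adj.ne {x y : Vx} (h : D.Adj x y) : x ≠ y := h.elim E.ne fun h => h.ne.symm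

/-- The vertex of the graph with the data `x`. -/
def vtx (x : Vx) (h : D.InR x) : Fin D.n := ⟨D.enc x, enc_lt h⟩

@[simp] theorem dec_vtx {x : Vx} (h : D.InR x) : D.dec (vtx x h) = x := dec_enc h

theorem inR_zero {a f : ℕ} (ha : a < 10) (hf : f < 2) : D.InR ⟨a, 0, 0, f⟩ :=
  ⟨ha, D.T_pos, D.M_pos, by simp only [F]; omega⟩

variable (D)

theorem E_dummy : D.E ⟨0, 0, 0, 0⟩ ⟨7, 0, 0, 0⟩ :=
  Or.inl ⟨rfl, Or.inr (Or.inr (Or.inr (Or.inl ⟨rfl, rfl, rfl, rfl, rfl, D.J_pos⟩)))⟩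

/-- The vertices in the bag `t₀`, one for each class of twins. The vertex `(0, 0, 0, 1)` stands for
the class of the isolated vertices. -/
def InBag (t₀ : ℕ) (x : Vx) : Prop :=
  (x.a = 0 ∧ x.t = 0 ∧ x.i = 0 ∧ x.f < 2) ∨
  (x.f = 0 ∧ ((x.a = 1 ∧ x.i = 0 ∧ x.t ≤ t₀ ∧ t₀ ≤ x.t + D.N) ∨
    (2 ≤ x.a ∧ x.a < 6 ∧ x.t = t₀) ∨ (6 ≤ x.a ∧ x.t = t₀ / D.N)))

open Classical in
/-- The instance of Feedback Vertex Set with unit costs. The list of edges runs through all pairs of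
vertices, with a fixed edge in place of the pairs that are none; likewise each bag runs through all
vertices, with the root in place of those that are not in the bag. -/
noncomputable def inst : FVSInstance where
  n := D.n
  edges := (List.finRange D.n).flatMap fun u : Fin D.n => (List.finRange D.n).map fun v : Fin D.n =>
    if D.E (D.dec u) (D.dec v) then (u, v)
    else (vtx _ (D.inR_zero (a := 0) (f := 0) (by omega) (by omega)),
      vtx _ (D.inR_zero (a := 7) (f := 0) (by omega) (by omega)))
  edges_ne := by
    intro e he
    obtain ⟨u, -, he⟩ := List.mem_flatMap.1 he
    obtain ⟨v, -, rfl⟩ := List.mem_map.1 he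
    split_ifs with h
    · exact fun e => h.ne (by rw [show u = v from e])
    · exact fun e => by simpa using congrArg (fun u : Fin D.n => (D.dec u).a) e
  cost := fun _ => 1
  cost_pos := fun _ => one_pos
  budget := D.budget
  bags := (List.range D.T).map fun t => (List.finRange D.n).map fun v : Fin D.n =>
    if D.InBag t (D.dec v) then v
    else vtx _ (D.inR_zero (a := 0) (f := 0) (by omega) (by omega))

theorem adj_iff (u v : Fin D.n) : D.inst.graph.Adj u v ↔ D.Adj (D.dec u) (D.dec v) := by
  have key : ∀ u v : Fin D.n, D.E (D.dec u) (D.dec v) → (u, v) ∈ D.inst.edges := fun u v h =>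
    List.mem_flatMap.2 ⟨u, List.mem_finRange _, List.mem_map.2 ⟨v, List.mem_finRange _, if_pos h⟩⟩
  have key' : ∀ u v : Fin D.n, (u, v) ∈ D.inst.edges → D.E (D.dec u) (D.dec v) := fun u v h => by
    obtain ⟨u', -, he⟩ := List.mem_flatMap.1 h
    obtain ⟨v', -, he⟩ := List.mem_map.1 he
    split_ifs at he with h'
    · obtain ⟨rfl, rfl⟩ := Prod.mk.inj he
      exact h'
    · obtain ⟨rfl, rfl⟩ := Prod.mk.inj he
      rw [dec_vtx, dec_vtx]
      exact D.E_dummy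
  constructor
  · rintro ⟨-, h | h⟩
    exacts [Or.inl (key' _ _ h), Or.inr (key' _ _ h)]
  · intro h
    exact ⟨fun e => h.ne (by rw [e]), h.imp (key _ _) (key _ _)⟩

end SelCSP

/-! ### A small feedback vertex set yields a solution -/

theorem SimpleGraph.IsAcyclic.not_four_cycle {V : Type*} {G : SimpleGraph V} (hG : G.IsAcyclic)
    {p q r s : V} (h1 : G.Adj p q) (h2 : G.Adj q r) (h3 : G.Adj r s) (h4 : G.Adj s p)
    (hpr : p ≠ r) (hqs : q ≠ s) : False := by
  refine hG (.cons h1 (.cons h2 (.cons h3 (.cons h4 .nil)))) ?_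
  simp [SimpleGraph.Walk.cons_isCycle_iff, h1.ne, h2.ne, h3.ne, h4.ne, h1.ne', h4.ne', hpr, hpr.symm,
    hqs]

theorem SimpleGraph.IsAcyclic.not_triangle {V : Type*} {G : SimpleGraph V} (hG : G.IsAcyclic)
    {p q r : V} (h1 : G.Adj p q) (h2 : G.Adj q r) (h3 : G.Adj r p) : False := by
  refine hG (.cons h1 (.cons h2 (.cons h3 .nil))) ?_
  simp [SimpleGraph.Walk.cons_isCycle_iff, h1.ne, h2.ne, h3.ne, h1.ne', h3.ne']

/-- At most five vertices of a block, made up of the two vertices of a link and the eight items that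
belong to it, are retained. The cells on the left and on the right of the block are in the states
`s` and `s'`; a cell without a state does not restrict its items, which is worth at most two more
vertices on the left and one more on the right. -/
theorem block_le {a b k k' : ℕ} {r : ℕ → ℕ} (ha : a ≤ 1) (hb : b ≤ 1) (hr : ∀ x < 8, r x ≤ 1)
    (h2 : a = 1 → b = 1 → r 0 + r 1 + r 2 + r 4 + r 5 + r 6 ≤ 1)
    (h1 : 1 ≤ a + b → r 0 + r 1 ≤ 1 ∧ r 4 + r 5 ≤ 1)
    (hk : k = 1 ∨ ∃ s < 5, ∀ x < 4, ¬ ItemOk x s → r x = 0)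
    (hk' : k' = 1 ∨ ∃ s < 5, ∀ x < 4, ¬ ItemOk (x + 4) s → r (x + 4) = 0) :
    a + b + (r 0 + r 1 + r 2 + r 3 + r 4 + r 5 + r 6 + r 7) ≤ 5 + 2 * k + k' := by
  have r0 := hr 0 (by omega)
  have r1 := hr 1 (by omega)
  have r2 := hr 2 (by omega)
  have r3 := hr 3 (by omega)
  have r4 := hr 4 (by omega)
  have r5 := hr 5 (by omega)
  have r6 := hr 6 (by omega)
  have r7 := hr 7 (by omega)
  have hL : k = 1 ∨ r 2 + r 3 ≤ 1 ∧ r 0 + r 1 + r 2 + r 3 ≤ 2 ∧ r 1 + r 3 ≤ 1 := by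
    refine hk.imp_right fun ⟨s, hs, h⟩ => ?_
    have q0 := h 0 (by omega)
    have q1 := h 1 (by omega)
    have q2 := h 2 (by omega)
    have q3 := h 3 (by omega)
    clear h hk hk' h1 h2
    interval_cases s <;> simp [ItemOk] at q0 q1 q2 q3 <;> omega
  have hR : k' = 1 ∨ r 5 + r 6 ≤ 1 ∧ r 4 + r 6 + r 7 ≤ 2 := by
    refine hk'.imp_right fun ⟨s, hs, h⟩ => ?_
    have q0 := h 0 (by omega)
    have q1 := h 1 (by omega)
    have q2 := h 2 (by omega)
    have q3 := h 3 (by omega)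
    clear h hk hk' h1 h2 hL
    interval_cases s <;> simp [ItemOk] at q0 q1 q2 q3 <;> omega
  clear hk hk' hr
  rcases Nat.lt_or_ge (a + b) 1 with h | h
  · omega
  · obtain ⟨h3, h4⟩ := h1 h
    rcases Nat.lt_or_ge (a + b) 2 with h' | h'
    · omega
    · have := h2 (by omega) (by omega)
      omega

/-- If exactly five vertices of a block are retained, then the state does not decrease, provided
that the root is retained. -/
theorem state_le_of_block {a b s s' : ℕ} {r : ℕ → ℕ} (ha : a ≤ 1) (hb : b ≤ 1)
    (hr : ∀ x < 8, r x ≤ 1)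
    (h2 : a = 1 → b = 1 → r 0 + r 1 + r 2 + r 4 + r 5 + r 6 ≤ 1)
    (h1 : 1 ≤ a + b → r 0 + r 1 ≤ 1 ∧ r 4 + r 5 ≤ 1)
    (h0 : 1 ≤ a + b → r 0 + r 4 ≤ 1)
    (hs : s < 5) (hs' : s' < 5) (hk : ∀ x < 4, ¬ ItemOk x s → r x = 0)
    (hk' : ∀ x < 4, ¬ ItemOk (x + 4) s' → r (x + 4) = 0)
    (h5 : a + b + (r 0 + r 1 + r 2 + r 3 + r 4 + r 5 + r 6 + r 7) = 5) : s ≤ s' := by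
  have r0 := hr 0 (by omega)
  have r1 := hr 1 (by omega)
  have r2 := hr 2 (by omega)
  have r3 := hr 3 (by omega)
  have r4 := hr 4 (by omega)
  have r5 := hr 5 (by omega)
  have r6 := hr 6 (by omega)
  have r7 := hr 7 (by omega)
  have q0 := hk 0 (by omega)
  have q1 := hk 1 (by omega)
  have q2 := hk 2 (by omega)
  have q3 := hk 3 (by omega)
  have q4 := hk' 0 (by omega)
  have q5 := hk' 1 (by omega)
  have q6 := hk' 2 (by omega)
  have q7 := hk' 3 (by omega)
  clear hk hk' hr
  rcases Nat.lt_or_ge (a + b) 1 with h | h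
  · interval_cases s <;> interval_cases s' <;> simp [ItemOk] at * <;> omega
  · obtain ⟨h3, h4⟩ := h1 h
    have h0 := h0 h
    rcases Nat.lt_or_ge (a + b) 2 with h' | h'
    · interval_cases s <;> interval_cases s' <;> simp [ItemOk] at q0 q1 q2 q3 q4 q5 q6 q7 ⊢ <;> omega
    · have := h2 (by omega) (by omega)
      clear h1 h2
      interval_cases s <;> interval_cases s' <;> simp [ItemOk] at q0 q1 q2 q3 q4 q5 q6 q7 ⊢ <;> omega

theorem sum_ite_le_one {ι : Type*} (s : Finset ι) (p : ι → Prop) [DecidablePred p]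
    (h : ∀ i ∈ s, ∀ j ∈ s, p i → p j → i = j) : ∑ i ∈ s, (if p i then 1 else 0) ≤ 1 := by
  rw [← Finset.card_filter, Finset.card_le_one]
  intro i hi j hj
  rw [Finset.mem_filter] at hi hj
  exact h i hi.1 j hj.1 hi.2 hj.2

namespace SelCSP

variable {D : SelCSP}

/-- The vertices of the block of the link `t`: the two vertices of the link and its eight items. -/
def blk (D : SelCSP) (t x : ℕ) : Vx :=
  if x < 2 then ⟨1, t, 0, x⟩ else if x < 6 then ⟨4, t, x - 2, 0⟩ else ⟨4, t + D.N, x - 2, 0⟩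

/-- The vertices that the budget accounts for: selectors, blocks, choices, and the root. The
budget leaves no room for the deletion of the root. -/
abbrev Acc (D : SelCSP) : Type :=
  (Fin D.T × Fin 20) ⊕ (Fin (D.T - D.N) × Fin 10) ⊕ (Fin D.J × Fin D.K₁) ⊕ Unit

/-- The vertex belonging to an index. -/
def accVx (D : SelCSP) : D.Acc → Vx
  | .inl (t, i) => ⟨2, t, i, 0⟩
  | .inr (.inl (t, x)) => D.blk t x
  | .inr (.inr (.inl (j, κ))) => ⟨9, j, κ, 0⟩
  | .inr (.inr (.inr _)) => ⟨0, 0, 0, 0⟩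

theorem blk_a (t x : ℕ) : (D.blk t x).a = 1 ∨ (D.blk t x).a = 4 := by
  simp only [blk]; split_ifs <;> simp

theorem blk_inj {t t' x x' : ℕ} (h : D.blk t x = D.blk t' x') :
    t = t' ∧ x = x' := by
  simp only [blk] at h
  split_ifs at h <;> simp only [Vx.mk.injEq] at h <;> omega

theorem accVx_injective : Function.Injective D.accVx := by
  rintro (⟨t, i⟩ | ⟨t, x⟩ | ⟨j, κ⟩ | _) (⟨t', i'⟩ | ⟨t', x'⟩ | ⟨j', κ'⟩ | _) h
  all_goals try rfl
  · simp only [accVx, Vx.mk.injEq] at h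
    rw [Fin.ext h.2.1, Fin.ext h.2.2.1]
  · have h1 := congrArg Vx.a h; have := D.blk_a t' x'; simp only [accVx] at h1; omega
  · simp [accVx] at h
  · simp [accVx] at h
  · have h1 := congrArg Vx.a h; have := D.blk_a t x; simp only [accVx] at h1; omega
  · obtain ⟨h1, h2⟩ := blk_inj h
    rw [Fin.ext h1, Fin.ext h2]
  · have h1 := congrArg Vx.a h; have := D.blk_a t x; simp only [accVx] at h1; omega
  · have h1 := congrArg Vx.a h; have := D.blk_a t x; simp only [accVx] at h1; omega
  · simp [accVx] at h
  · have h1 := congrArg Vx.a h; have := D.blk_a t' x'; simp only [accVx] at h1; omega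
  · simp only [accVx, Vx.mk.injEq] at h
    rw [Fin.ext h.2.1, Fin.ext h.2.2.1]
  · simp [accVx] at h
  · simp [accVx] at h
  · have h1 := congrArg Vx.a h; have := D.blk_a t' x'; simp only [accVx] at h1; omega
  · simp [accVx] at h

theorem inR_of {a t i f : ℕ} (ha : a < 10) (ht : t < D.T) (hi : i < 32 ∨ i < D.K₁ ∨ i < D.K₂)
    (hf : f < 2) : D.InR ⟨a, t, i, f⟩ :=
  ⟨ha, ht, by simp only [M]; omega, by simp only [F]; omega⟩

theorem inR_accVx (d : D.Acc) : D.InR (D.accVx d) := by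
  rcases d with ⟨t, i⟩ | ⟨t, x⟩ | ⟨j, κ⟩ | _
  · exact inR_of (by omega) t.2 (by omega) (by omega)
  · have := t.2
    have := x.2
    simp only [accVx, blk]
    split_ifs <;> exact inR_of (by omega) (by omega) (by omega) (by omega)
  · exact inR_of (by omega) (j.2.trans_le D.J_le_T) (by omega) (by omega)
  · exact inR_of (by omega) D.T_pos (by omega) (by omega)

theorem sum_acc (g : Vx → ℕ) : ∑ d, g (D.accVx d) =
    ∑ t ∈ Finset.range D.T, ∑ i ∈ Finset.range 20, g ⟨2, t, i, 0⟩ +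
    (∑ t ∈ Finset.range (D.T - D.N), ∑ x ∈ Finset.range 10, g (D.blk t x) +
    (∑ j ∈ Finset.range D.J, ∑ κ ∈ Finset.range D.K₁, g ⟨9, j, κ, 0⟩ + g ⟨0, 0, 0, 0⟩)) := by
  rw [Fintype.sum_sum_type, Fintype.sum_sum_type, Fintype.sum_sum_type, Fintype.sum_prod_type,
    Fintype.sum_prod_type, Fintype.sum_prod_type]
  simp only [Finset.sum_range, accVx, Finset.univ_unique, Finset.sum_singleton]

/-- The vertex `x` is not deleted. -/
def Ret (X : Finset (Fin D.n)) (x : Vx) : Prop := ∃ h : D.InR x, vtx x h ∉ X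

section

variable {X : Finset (Fin D.n)}

open Classical in
theorem sum_not_ret_le : ∑ d, (if Ret X (D.accVx d) then 0 else 1) ≤ X.card := by
  have : ∀ d, (if Ret X (D.accVx d) then 0 else 1) = if ¬ Ret X (D.accVx d) then 1 else 0 :=
    fun d => by split_ifs <;> rfl
  simp only [this]
  rw [← Finset.card_filter]
  refine Finset.card_le_card_of_injOn (fun d => vtx _ (inR_accVx d)) (fun d hd => ?_)
    fun d _ d' _ h => ?_
  · by_contra h
    exact (Finset.mem_filter.1 hd).2 ⟨_, h⟩
  · have := congrArg (fun u : Fin D.n => D.dec u) h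
    simp only [dec_vtx] at this
    exact accVx_injective this

open Classical in
/-- Two copies of each clamp are retained. -/
theorem exists_two_copies (hX : X.card ≤ D.budget) {y : Vx} (hy : D.InR y) :
    ∃ f f', f ≠ f' ∧ Ret X { y with f := f } ∧ Ret X { y with f := f' } := by
  obtain ⟨h1, h2, h3, -⟩ := hy
  have hR : ∀ f : Fin D.F, D.InR { y with f := f } := fun f => ⟨h1, h2, h3, f.2⟩
  have hcard : (Finset.univ.filter fun f : Fin D.F => vtx _ (hR f) ∈ X).card ≤ X.card := by
    refine Finset.card_le_card_of_injOn (fun f => vtx _ (hR f)) (fun f hf =>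
      (Finset.mem_filter.1 hf).2) fun f _ f' _ h => ?_
    have := congrArg (fun u : Fin D.n => (D.dec u).f) h
    simp only [dec_vtx] at this
    exact Fin.ext this
  have hsum := Finset.card_filter_add_card_filter_not (s := (Finset.univ : Finset (Fin D.F)))
    fun f => vtx _ (hR f) ∈ X
  rw [Finset.card_fin] at hsum
  have hF : D.F = D.budget + 2 := rfl
  obtain ⟨f, hf, f', hf', hne⟩ := Finset.one_lt_card.1 (show
    1 < (Finset.univ.filter fun f : Fin D.F => vtx _ (hR f) ∉ X).card by omega)
  exact ⟨f, f', fun h => hne (Fin.ext h), ⟨hR f, (Finset.mem_filter.1 hf).2⟩,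
    ⟨hR f', (Finset.mem_filter.1 hf').2⟩⟩

variable (hac : (D.inst.graph.induce {v | v ∉ X}).IsAcyclic)
include hac

theorem Ret.not_four_cycle {p q r s : Vx} (hp : Ret X p) (hq : Ret X q) (hr : Ret X r)
    (hs : Ret X s) (h1 : D.Adj p q) (h2 : D.Adj q r) (h3 : D.Adj r s) (h4 : D.Adj s p)
    (hpr : p ≠ r) (hqs : q ≠ s) : False := by
  obtain ⟨ip, hp⟩ := hp
  obtain ⟨iq, hq⟩ := hq
  obtain ⟨ir, hr⟩ := hr
  obtain ⟨is, hs⟩ := hs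
  refine hac.not_four_cycle (p := ⟨vtx p ip, hp⟩) (q := ⟨vtx q iq, hq⟩) (r := ⟨vtx r ir, hr⟩)
    (s := ⟨vtx s is, hs⟩) ?_ ?_ ?_ ?_ (fun h => hpr ?_) (fun h => hqs ?_)
  · exact (D.adj_iff _ _).2 (by simpa using h1)
  · exact (D.adj_iff _ _).2 (by simpa using h2)
  · exact (D.adj_iff _ _).2 (by simpa using h3)
  · exact (D.adj_iff _ _).2 (by simpa using h4)
  · have := congrArg (fun u : Fin D.n => D.dec u) (congrArg Subtype.val h)
    simpa using this
  · have := congrArg (fun u : Fin D.n => D.dec u) (congrArg Subtype.val h)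
    simpa using this

theorem Ret.not_triangle {p q r : Vx} (hp : Ret X p) (hq : Ret X q) (hr : Ret X r)
    (h1 : D.Adj p q) (h2 : D.Adj q r) (h3 : D.Adj r p) : False := by
  obtain ⟨ip, hp⟩ := hp
  obtain ⟨iq, hq⟩ := hq
  obtain ⟨ir, hr⟩ := hr
  refine hac.not_triangle (p := ⟨vtx p ip, hp⟩) (q := ⟨vtx q iq, hq⟩) (r := ⟨vtx r ir, hr⟩) ?_ ?_ ?_
  · exact (D.adj_iff _ _).2 (by simpa using h1)
  · exact (D.adj_iff _ _).2 (by simpa using h2)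
  · exact (D.adj_iff _ _).2 (by simpa using h3)

/-- At most one vertex of the group of a clamp is retained, as two of them would lie on a cycle with
two copies of the clamp. -/
theorem Ret.clamp_unique (hX : X.card ≤ D.budget) {x x' y : Vx} (hy : D.InR y)
    (hx : Ret X x) (hx' : Ret X x') (h : D.Clamp x y) (h' : D.Clamp x' y) : x = x' := by
  by_contra hne
  obtain ⟨f, f', hff, hf, hf'⟩ := exists_two_copies hX hy
  exact Ret.not_four_cycle hac hx hf hx' hf' (Or.inl (Or.inl h)) (Or.inr (Or.inl h'))
    (Or.inl (Or.inl h')) (Or.inr (Or.inl h)) hne fun e => hff (congrArg Vx.f e)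

end

end SelCSP

namespace SelCSP

variable {D : SelCSP} {X : Finset (Fin D.n)}

theorem adj_item_link {t x f : ℕ} (ht : t + D.N < D.T) (hf : f < 2)
    (hx : x = 0 ∨ x = 1 ∨ x = 2 ∨ x = 4 ∨ x = 5 ∨ x = 6) :
    D.Adj ⟨4, if x < 4 then t else t + D.N, x, 0⟩ ⟨1, t, 0, f⟩ := by
  rcases hx with rfl | rfl | rfl | rfl | rfl | rfl <;> simp [Adj, E, Clamp, Thin, ht, hf]

theorem adj_items {t x : ℕ} (ht : t + D.N < D.T) (hx : x = 0 ∨ x = 4) :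
    D.Adj ⟨4, if x < 4 then t else t + D.N, x, 0⟩
      ⟨4, if x + 1 < 4 then t else t + D.N, x + 1, 0⟩ := by
  rcases hx with rfl | rfl <;> simp [Adj, E, Thin, Act, ht]

theorem adj_root_item {t x : ℕ} (ht : t + D.N < D.T) (hx : x = 0 ∨ x = 4) :
    D.Adj ⟨0, 0, 0, 0⟩ ⟨4, if x < 4 then t else t + D.N, x, 0⟩ := by
  rcases hx with rfl | rfl <;> simp [Adj, E, Thin, Act, ht]

open Classical in
/-- The number of retained vertices with the data `x`. -/
noncomputable def ret (X : Finset (Fin D.n)) (x : Vx) : ℕ := if Ret X x then 1 else 0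

theorem ret_le_one (x : Vx) : ret X x ≤ 1 := by simp only [ret]; split_ifs <;> omega

theorem ret_eq_one {x : Vx} : ret X x = 1 ↔ Ret X x := by simp [ret]

theorem ret_eq_zero {x : Vx} : ret X x = 0 ↔ ¬ Ret X x := by simp [ret]

/-- The number of retained items `x` in the block of the link `t`. -/
noncomputable def retItem (X : Finset (Fin D.n)) (t x : ℕ) : ℕ :=
  ret X ⟨4, if x < 4 then t else t + D.N, x, 0⟩

section

variable (hac : (D.inst.graph.induce {v | v ∉ X}).IsAcyclic)
include hac

/-- If both vertices of a link are retained, two of the items adjacent to them would lie on a cycle. -/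
theorem link_both {t : ℕ} (ht : t + D.N < D.T) (ha : ret X ⟨1, t, 0, 0⟩ = 1)
    (hb : ret X ⟨1, t, 0, 1⟩ = 1) :
    retItem X t 0 + retItem X t 1 + retItem X t 2 + retItem X t 4 + retItem X t 5 +
      retItem X t 6 ≤ 1 := by
  classical
  rw [ret_eq_one] at ha hb
  have := sum_ite_le_one ({0, 1, 2, 4, 5, 6} : Finset ℕ)
    (fun x => Ret X ⟨4, if x < 4 then t else t + D.N, x, 0⟩) fun x hx y hy h h' => by
      by_contra hne
      have hx' : x = 0 ∨ x = 1 ∨ x = 2 ∨ x = 4 ∨ x = 5 ∨ x = 6 := by simpa using hx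
      have hy' : y = 0 ∨ y = 1 ∨ y = 2 ∨ y = 4 ∨ y = 5 ∨ y = 6 := by simpa using hy
      exact Ret.not_four_cycle hac h ha h' hb (adj_item_link ht (by omega) hx')
        (adj_item_link ht (by omega) hy').symm (adj_item_link ht (by omega) hy')
        (adj_item_link ht (by omega) hx').symm (by simp [hne]) (by simp)
  simpa [retItem, ret, add_assoc, -Finset.sum_boole] using this

theorem link_one {t : ℕ} (ht : t + D.N < D.T) {f : ℕ} (hf : f < 2) (ha : Ret X ⟨1, t, 0, f⟩) {x : ℕ}
    (hx : x = 0 ∨ x = 4) : retItem X t x + retItem X t (x + 1) ≤ 1 := by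
  by_contra h
  have h1 := ret_le_one (X := X) ⟨4, if x < 4 then t else t + D.N, x, 0⟩
  have h2 := ret_le_one (X := X) ⟨4, if x + 1 < 4 then t else t + D.N, x + 1, 0⟩
  simp only [retItem] at h
  have r1 := ret_eq_one.1 (show ret X ⟨4, if x < 4 then t else t + D.N, x, 0⟩ = 1 by omega)
  have r2 := ret_eq_one.1 (show ret X ⟨4, if x + 1 < 4 then t else t + D.N, x + 1, 0⟩ = 1 by omega)
  exact Ret.not_triangle hac r1 r2 ha (adj_items ht hx) (adj_item_link ht hf (by omega))
    (adj_item_link ht hf (by omega)).symm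

/-- With the root, a vertex of a link and the items `0` and `4` would form a cycle. -/
theorem link_root {t : ℕ} (ht : t + D.N < D.T) {f : ℕ} (hf : f < 2) (ha : Ret X ⟨1, t, 0, f⟩)
    (h0 : Ret X ⟨0, 0, 0, 0⟩) : retItem X t 0 + retItem X t 4 ≤ 1 := by
  by_contra h
  have h1 := ret_le_one (X := X) ⟨4, if 0 < 4 then t else t + D.N, 0, 0⟩
  have h2 := ret_le_one (X := X) ⟨4, if 4 < 4 then t else t + D.N, 4, 0⟩
  simp only [retItem] at h
  have r1 := ret_eq_one.1 (show ret X ⟨4, if 0 < 4 then t else t + D.N, 0, 0⟩ = 1 by omega)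
  have r2 := ret_eq_one.1 (show ret X ⟨4, if 4 < 4 then t else t + D.N, 4, 0⟩ = 1 by omega)
  exact Ret.not_four_cycle hac h0 r1 ha r2 (adj_root_item ht (by omega))
    (adj_item_link ht hf (by omega)) (adj_item_link ht hf (by omega)).symm
    (adj_root_item ht (by omega)).symm (by simp) (by simp)

variable (hX : X.card ≤ D.budget)
include hX

/-- A retained selector excludes the items that its state does not allow. -/
theorem item_of_sel {t i x : ℕ} (ht : t < D.T) (hi : i < 20) (hx : x < 8) (hact : D.Act t x)
    (h : Ret X ⟨2, t, i, 0⟩) (hok : ¬ ItemOk x (i % 5)) : ret X ⟨4, t, x, 0⟩ = 0 := by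
  rw [ret_eq_zero]
  intro h'
  have e1 : (i / 5 * 8 + x) % 8 = x := by omega
  have e2 : (i / 5 * 8 + x) / 8 = i / 5 := by omega
  have := Ret.clamp_unique hac hX (y := ⟨5, t, i / 5 * 8 + x, 0⟩)
    (inR_of (by omega) ht (by omega) (by omega)) h h'
    ⟨rfl, Or.inr (Or.inl ⟨rfl, hi, rfl, show i / 5 * 8 + x < 32 by omega, e2, rfl,
      by simpa only [e1] using hact, by simpa only [e1] using hok⟩)⟩
    ⟨rfl, Or.inr (Or.inr (Or.inl ⟨rfl, e1.symm, rfl, show i / 5 * 8 + x < 32 by omega, rfl,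
      by simpa only [e1] using hact⟩))⟩
  simp at this

theorem sum_sel_le {t w : ℕ} (ht : t < D.T) (hw : w < 4) :
    ∑ s ∈ Finset.range 5, ret X ⟨2, t, w * 5 + s, 0⟩ ≤ 1 := by
  classical
  refine sum_ite_le_one _ _ fun s hs s' hs' h h' => ?_
  rw [Finset.mem_range] at hs hs'
  have := Ret.clamp_unique hac hX (y := ⟨3, t, w, 0⟩) (inR_of (by omega) ht (by omega) (by omega))
    h h' ⟨rfl, Or.inl ⟨rfl, by dsimp only; omega, rfl, by dsimp only; omega, rfl⟩⟩
    ⟨rfl, Or.inl ⟨rfl, by dsimp only; omega, rfl, by dsimp only; omega, rfl⟩⟩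
  simp only [Vx.mk.injEq] at this
  omega

theorem sum_choice_le {j : ℕ} (hj : j < D.J) :
    ∑ κ ∈ Finset.range D.K₁, ret X ⟨9, j, κ, 0⟩ ≤ 1 := by
  classical
  refine sum_ite_le_one _ _ fun s hs s' hs' h h' => ?_
  rw [Finset.mem_range] at hs hs'
  have := Ret.clamp_unique hac hX (y := ⟨6, j, 0, 0⟩)
    (inR_of (by omega) (hj.trans_le D.J_le_T) (by omega) (by omega)) h h'
    ⟨rfl, by simp [hs, hj]⟩ ⟨rfl, by simp [hs', hj]⟩
  simpa using this

/-- A cell without a state (`k` or `k'` is one) is worth at most two additional vertices to the block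
on its right and one to the block on its left. -/
theorem block_ret_le {t k k' : ℕ} (ht : t + D.N < D.T)
    (hk : k = 1 ∨ ∃ i < 20, Ret X ⟨2, t, i, 0⟩)
    (hk' : k' = 1 ∨ ∃ i < 20, Ret X ⟨2, t + D.N, i, 0⟩) :
    ∑ x ∈ Finset.range 10, ret X (D.blk t x) ≤ 5 + 2 * k + k' := by
  have key := block_le (a := ret X ⟨1, t, 0, 0⟩) (b := ret X ⟨1, t, 0, 1⟩) (r := retItem X t)
    (ret_le_one _) (ret_le_one _) (fun _ _ => ret_le_one _) (link_both hac ht) (fun h => by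
      have : Ret X ⟨1, t, 0, 0⟩ ∨ Ret X ⟨1, t, 0, 1⟩ := by
        rw [← ret_eq_one, ← ret_eq_one]
        have := ret_le_one (X := X) ⟨1, t, 0, 0⟩
        have := ret_le_one (X := X) ⟨1, t, 0, 1⟩
        omega
      rcases this with h | h
      · exact ⟨link_one hac ht (by omega) h (by omega), link_one hac ht (by omega) h (by omega)⟩
      · exact ⟨link_one hac ht (by omega) h (by omega), link_one hac ht (by omega) h (by omega)⟩)
    (hk.imp_right fun ⟨i, hi, h⟩ => ⟨i % 5, Nat.mod_lt _ (by omega), fun x hx hok => by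
      simp only [retItem, if_pos hx]
      exact item_of_sel hac hX (by omega) hi (by omega) (Or.inl ⟨hx, ht⟩) h hok⟩)
    (hk'.imp_right fun ⟨i, hi, h⟩ => ⟨i % 5, Nat.mod_lt _ (by omega), fun x hx hok => by
      simp only [retItem, if_neg (show ¬ x + 4 < 4 by omega)]
      exact item_of_sel hac hX ht hi (by omega) (Or.inr ⟨by omega, by omega⟩) h hok⟩)
  simpa [Finset.sum_range_succ, blk, retItem, add_assoc] using key

/-- The state does not decrease across a block with five retained vertices. -/
theorem state_le {t s s' : ℕ} (ht : t + D.N < D.T) (hs : s < 5) (hs' : s' < 5)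
    (h : Ret X ⟨2, t, s, 0⟩) (h' : Ret X ⟨2, t + D.N, s', 0⟩) (h0 : Ret X ⟨0, 0, 0, 0⟩)
    (h5 : ∑ x ∈ Finset.range 10, ret X (D.blk t x) = 5) : s ≤ s' := by
  have hl : 1 ≤ ret X ⟨1, t, 0, 0⟩ + ret X ⟨1, t, 0, 1⟩ →
      Ret X ⟨1, t, 0, 0⟩ ∨ Ret X ⟨1, t, 0, 1⟩ := fun _ => by
    rw [← ret_eq_one, ← ret_eq_one]
    have := ret_le_one (X := X) ⟨1, t, 0, 0⟩
    have := ret_le_one (X := X) ⟨1, t, 0, 1⟩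
    omega
  refine state_le_of_block (a := ret X ⟨1, t, 0, 0⟩) (b := ret X ⟨1, t, 0, 1⟩) (r := retItem X t)
    (ret_le_one _) (ret_le_one _) (fun _ _ => ret_le_one _) (link_both hac ht) (fun h => ?_)
    (fun h => ?_) hs hs' (fun x hx hok => ?_) (fun x hx hok => ?_) ?_
  · rcases hl h with h | h
    · exact ⟨link_one hac ht (by omega) h (by omega), link_one hac ht (by omega) h (by omega)⟩
    · exact ⟨link_one hac ht (by omega) h (by omega), link_one hac ht (by omega) h (by omega)⟩
  · rcases hl h with h | h
    · exact link_root hac ht (by omega) h h0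
    · exact link_root hac ht (by omega) h h0
  · simp only [retItem, if_pos hx]
    exact item_of_sel hac hX (by omega) (by omega) (by omega) (Or.inl ⟨hx, ht⟩) h
      (by rwa [Nat.mod_eq_of_lt hs])
  · simp only [retItem, if_neg (show ¬ x + 4 < 4 by omega)]
    exact item_of_sel hac hX ht (by omega) (by omega) (Or.inr ⟨by omega, by omega⟩) h'
      (by rwa [Nat.mod_eq_of_lt hs'])
  · simpa [Finset.sum_range_succ, blk, retItem, add_assoc] using h5

end

theorem sum_not_ret (s : Finset ℕ) (g : ℕ → Vx) :
    ∑ x ∈ s, (1 - ret X (g x)) + ∑ x ∈ s, ret X (g x) = s.card := by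
  rw [← Finset.sum_add_distrib, Finset.card_eq_sum_ones]
  refine Finset.sum_congr rfl fun x _ => ?_
  have := ret_le_one (X := X) (g x)
  omega

/-- A feedback vertex set within the budget determines a state of each cell. The states do not
decrease from one constraint to the next, and each constraint is satisfied by the states of its
cells. -/
theorem exists_states (hX : X.card ≤ D.budget)
    (hac : (D.inst.graph.induce {v | v ∉ X}).IsAcyclic)
    (hrow : ∀ j < D.J, ∀ c < D.K₂, D.row j c < D.N) (hK : 0 < D.K₁) :
    ∃ st : ℕ → ℕ, (∀ t < D.T, st t < 5) ∧ (∀ t, t + D.N < D.T → st t ≤ st (t + D.N)) ∧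
      ∀ j < D.J, D.Holds (fun i => st (j * D.N + i)) j := by
  classical
  have htot : ∑ d, (1 - ret X (D.accVx d)) ≤ D.budget := by
    refine le_trans (le_of_eq ?_) (sum_not_ret_le.trans hX)
    refine Finset.sum_congr rfl fun d _ => ?_
    simp only [ret]; split_ifs <;> rfl
  rw [sum_acc fun x => 1 - ret X x] at htot
  set S : ℕ → ℕ := fun t => ∑ i ∈ Finset.range 20, (1 - ret X ⟨2, t, i, 0⟩) with hS
  set B : ℕ → ℕ := fun t => ∑ x ∈ Finset.range 10, (1 - ret X (D.blk t x)) with hB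
  set K : ℕ → ℕ := fun j => ∑ κ ∈ Finset.range D.K₁, (1 - ret X ⟨9, j, κ, 0⟩) with hK'
  replace htot : ∑ t ∈ Finset.range D.T, S t + (∑ t ∈ Finset.range (D.T - D.N), B t +
    (∑ j ∈ Finset.range D.J, K j + (1 - ret X ⟨0, 0, 0, 0⟩))) ≤ D.budget := htot
  -- `k t` is one if the cell `t` has no state
  set k : ℕ → ℕ := fun t => if ∃ i < 20, Ret X ⟨2, t, i, 0⟩ then 0 else 1 with hk
  have hk0 : ∀ t, k t = 1 ∨ ∃ i < 20, Ret X ⟨2, t, i, 0⟩ := fun t => by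
    simp only [k]; split_ifs with h
    exacts [Or.inr h, Or.inl rfl]
  have hgroups : ∀ t, ∑ i ∈ Finset.range 20, ret X ⟨2, t, i, 0⟩ =
      ∑ w ∈ Finset.range 4, ∑ s ∈ Finset.range 5, ret X ⟨2, t, w * 5 + s, 0⟩ := fun t => by
    simp [Finset.sum_range_succ, add_assoc]
  have hSret : ∀ t, S t + ∑ i ∈ Finset.range 20, ret X ⟨2, t, i, 0⟩ = 20 := fun t =>
    (sum_not_ret (Finset.range 20) fun i => ⟨2, t, i, 0⟩).trans (Finset.card_range _)
  have hBret : ∀ t, B t + ∑ x ∈ Finset.range 10, ret X (D.blk t x) = 10 := fun t =>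
    (sum_not_ret (Finset.range 10) fun x => D.blk t x).trans (Finset.card_range _)
  have hKret : ∀ j, K j + ∑ κ ∈ Finset.range D.K₁, ret X ⟨9, j, κ, 0⟩ = D.K₁ := fun j =>
    (sum_not_ret (Finset.range D.K₁) fun κ => ⟨9, j, κ, 0⟩).trans (Finset.card_range _)
  -- a cell without a state costs four selectors, more than the three items that it may gain
  have hS1 : ∀ t ∈ Finset.range D.T, 16 + 4 * k t ≤ S t := fun t ht => by
    rw [Finset.mem_range] at ht
    have h1 := hSret t
    by_cases h : ∃ i < 20, Ret X ⟨2, t, i, 0⟩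
    · have h2 : ∑ w ∈ Finset.range 4, ∑ s ∈ Finset.range 5, ret X ⟨2, t, w * 5 + s, 0⟩ ≤
          ∑ w ∈ Finset.range 4, 1 :=
        Finset.sum_le_sum fun w hw => sum_sel_le hac hX ht (Finset.mem_range.1 hw)
      rw [← hgroups] at h2
      simp only [Finset.sum_const, Finset.card_range, smul_eq_mul] at h2
      have : k t = 0 := if_pos h
      omega
    · have : ∑ i ∈ Finset.range 20, ret X ⟨2, t, i, 0⟩ = 0 := Finset.sum_eq_zero fun i hi =>
        ret_eq_zero.2 fun h' => h ⟨i, Finset.mem_range.1 hi, h'⟩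
      have : k t = 1 := if_neg h
      omega
  have hB1 : ∀ t ∈ Finset.range (D.T - D.N), 5 ≤ B t + (2 * k t + k (t + D.N)) := fun t ht => by
    rw [Finset.mem_range] at ht
    have h1 := hBret t
    have h2 := block_ret_le hac hX (show t + D.N < D.T by omega) (hk0 t) (hk0 _)
    omega
  have hK1 : ∀ j ∈ Finset.range D.J, D.K₁ - 1 ≤ K j := fun j hj => by
    have h1 := hKret j
    have h2 := sum_choice_le hac hX (Finset.mem_range.1 hj)
    omega
  have hS2 := Finset.sum_le_sum hS1
  have hB2 := Finset.sum_le_sum hB1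
  have hK2 := Finset.sum_le_sum hK1
  simp only [Finset.sum_add_distrib, ← Finset.mul_sum, Finset.sum_const, Finset.card_range,
    smul_eq_mul] at hS2 hB2 hK2
  have hk1 : ∑ t ∈ Finset.range (D.T - D.N), k t ≤ ∑ t ∈ Finset.range D.T, k t :=
    Finset.sum_le_sum_of_subset (Finset.range_mono (Nat.sub_le _ _))
  have hk2 : ∑ t ∈ Finset.range (D.T - D.N), k (t + D.N) ≤ ∑ t ∈ Finset.range D.T, k t := by
    have h1 := Finset.sum_Ico_eq_sum_range k D.N D.T
    simp only [add_comm D.N] at h1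
    rw [← h1, Finset.range_eq_Ico]
    exact Finset.sum_le_sum_of_subset (Finset.Ico_subset_Ico_left (Nat.zero_le _))
  have hb : D.budget = 16 * D.T + 5 * (D.T - D.N) + D.J * (D.K₁ - 1) := rfl
  -- the budget is just sufficient, so all the inequalities above are equalities
  have hksum : ∑ t ∈ Finset.range D.T, k t = 0 := by omega
  have hkt : ∀ t < D.T, k t = 0 := fun t ht =>
    Finset.sum_eq_zero_iff.1 hksum t (Finset.mem_range.2 ht)
  have hroot : Ret X ⟨0, 0, 0, 0⟩ := ret_eq_one.1 (by
    have := ret_le_one (X := X) ⟨0, 0, 0, 0⟩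
    omega)
  have hSt : ∀ t < D.T, S t = 16 := fun t ht =>
    ((Finset.sum_eq_sum_iff_of_le (f := fun _ => 16) fun t ht =>
      (Nat.le_add_right _ _).trans (hS1 t ht)).1 (by simp; omega) t (Finset.mem_range.2 ht)).symm
  have hBt : ∀ t < D.T - D.N, B t = 5 := fun t ht =>
    ((Finset.sum_eq_sum_iff_of_le (f := fun _ => 5) fun t ht => by
      have := hB1 t ht
      have h1 := Finset.mem_range.1 ht
      rwa [hkt t (by omega), hkt (t + D.N) (by omega)] at this).1 (by simp; omega) t
      (Finset.mem_range.2 ht)).symm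
  have hKj : ∀ j < D.J, K j = D.K₁ - 1 := fun j hj =>
    ((Finset.sum_eq_sum_iff_of_le (f := fun _ => D.K₁ - 1) hK1).1 (by simp; omega) j
      (Finset.mem_range.2 hj)).symm
  have hst : ∀ t, ∃ s, t < D.T → s < 5 ∧ Ret X ⟨2, t, s, 0⟩ := fun t => by
    by_cases ht : t < D.T
    swap
    · exact ⟨0, fun h => absurd h ht⟩
    have h1 := hSret t
    rw [hSt t ht, hgroups] at h1
    have g : ∀ w < 4, ∑ s ∈ Finset.range 5, ret X ⟨2, t, w * 5 + s, 0⟩ ≤ 1 :=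
      fun w hw => sum_sel_le hac hX ht hw
    have g1 := g 1 (by omega)
    have g2 := g 2 (by omega)
    have g3 := g 3 (by omega)
    rw [Finset.sum_range_succ, Finset.sum_range_succ, Finset.sum_range_succ,
      Finset.sum_range_one] at h1
    have h0 : ∑ s ∈ Finset.range 5, ret X ⟨2, t, 0 * 5 + s, 0⟩ ≠ 0 := by omega
    obtain ⟨s, hs, h⟩ := Finset.exists_ne_zero_of_sum_ne_zero h0
    rw [zero_mul, zero_add, Ne, ret_eq_zero, not_not] at h
    exact ⟨s, fun _ => ⟨Finset.mem_range.1 hs, h⟩⟩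
  choose st hst using hst
  refine ⟨st, fun t ht => (hst t ht).1, fun t ht => ?_, fun j hj => ?_⟩
  · obtain ⟨h1, h2⟩ := hst t (by omega)
    obtain ⟨h3, h4⟩ := hst _ ht
    refine state_le hac hX ht h1 h3 h2 h4 hroot ?_
    have := hBret t
    have := hBt t (by omega)
    omega
  · have h1 := hKret j
    rw [hKj j hj] at h1
    have h0 : ∑ κ ∈ Finset.range D.K₁, ret X ⟨9, j, κ, 0⟩ ≠ 0 := by omega
    obtain ⟨κ, hκ, h⟩ := Finset.exists_ne_zero_of_sum_ne_zero h0
    rw [Ne, ret_eq_zero, not_not] at h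
    rw [Finset.mem_range] at hκ
    have hjT := hj.trans_le D.J_le_T
    refine ⟨κ, hκ, fun hbad => ?_, fun c hc hcl heq => ?_⟩
    · have := Ret.clamp_unique hac hX (y := ⟨7, j, 0, 0⟩)
        (inR_of (by omega) hjT (by omega) (by omega)) hroot h
        ⟨rfl, by simp [hj]⟩ ⟨rfl, by simp [hj, hκ, hbad]⟩
      simp at this
    · have hcell : j * D.N + D.row j c < D.T := by
        have := hrow j hj c hc
        calc _ < (j + 1) * D.N := by rw [add_mul, one_mul]; omega
          _ ≤ D.J * D.N := Nat.mul_le_mul_right _ hj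
          _ = _ := mul_comm _ _
      have := Ret.clamp_unique hac hX (y := ⟨8, j, c, 0⟩)
        (inR_of (by omega) hjT (by omega) (by omega)) (hst _ hcell).2 h
        ⟨rfl, by simp [hj, hc, heq]⟩ ⟨rfl, by simp [hj, hκ, hc, hcl]⟩
      simp at this

end SelCSP

/-! ### A solution yields a small feedback vertex set -/

/-- A graph is acyclic if its vertices can be ranked so that each vertex has at most one neighbour
whose rank is not higher than its own. -/
theorem SimpleGraph.isAcyclic_of_rank {V : Type*} {G : SimpleGraph V} (r : V → ℕ)
    (h : ∀ v u u', G.Adj u v → G.Adj u' v → r u ≤ r v → r u' ≤ r v → u = u') : G.IsAcyclic := by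
  classical
  intro v c hc
  -- a vertex of highest rank on a cycle has two such neighbours
  obtain ⟨u, hu, hmax⟩ := c.support.toFinset.exists_max_image r ⟨v, by simp⟩
  rw [List.mem_toFinset] at hu
  have hc' := hc.rotate hu
  refine hc'.snd_ne_penultimate ?_
  have hle : ∀ x ∈ (c.rotate u hu).support, r x ≤ r u := fun x hx => by
    refine hmax x ?_
    rw [List.mem_toFinset]
    exact (SimpleGraph.Walk.mem_support_rotate_iff ..).1 hx
  exact h u _ _ ((c.rotate u hu).adj_snd hc'.not_nil).symm
    ((c.rotate u hu).adj_penultimate hc'.not_nil)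
    (hle _ (SimpleGraph.Walk.getVert_mem_support _ _))
    (hle _ (SimpleGraph.Walk.getVert_mem_support _ _))

/-- The number of vertices of a link that are retained at the state `s`. -/
def linkSize (s : ℕ) : ℕ := if s = 0 ∨ s = 2 then 2 else if s = 4 then 0 else 1

namespace SelCSP

variable {D : SelCSP}

/-- The vertices that are retained for the assignment `σ` and the choices `κ`. -/
def Keep (D : SelCSP) (σ κ : ℕ → ℕ) (x : Vx) : Prop :=
  (x.a = 1 → x.f < linkSize (σ (x.t % D.N))) ∧ (x.a = 2 → x.i % 5 = σ (x.t % D.N)) ∧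
  (x.a = 4 → ItemOk x.i (σ (x.t % D.N))) ∧ (x.a = 9 → x.i = κ x.t)

variable {σ κ : ℕ → ℕ}

open Classical in
theorem sum_not_keep (hσ : ∀ i < D.N, σ i < 5) (hκ : ∀ j < D.J, κ j < D.K₁) :
    ∑ d, (if D.Keep σ κ (D.accVx d) then 0 else 1) = D.budget := by
  rw [sum_acc fun x => if D.Keep σ κ x then 0 else 1]
  have h1 : ∀ t ∈ Finset.range D.T, ∑ i ∈ Finset.range 20,
      (if D.Keep σ κ ⟨2, t, i, 0⟩ then 0 else 1) = 16 := fun t _ => by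
    have hs := hσ _ (Nat.mod_lt t D.N_pos)
    generalize hst : σ (t % D.N) = s at hs
    simp only [Keep, hst]
    interval_cases s <;> simp [Finset.sum_range_succ]
  have h2 : ∀ t ∈ Finset.range (D.T - D.N), ∑ x ∈ Finset.range 10,
      (if D.Keep σ κ (D.blk t x) then 0 else 1) = 5 := fun t _ => by
    have hs := hσ _ (Nat.mod_lt t D.N_pos)
    generalize hst : σ (t % D.N) = s at hs
    simp only [Finset.sum_range_succ, Finset.sum_range_zero, blk, Keep]
    simp only [Nat.reduceLT, reduceIte, Nat.reduceSub, Nat.add_mod_right, hst]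
    interval_cases s <;> simp [ItemOk, linkSize]
  have h3 : ∀ j ∈ Finset.range D.J, ∑ k ∈ Finset.range D.K₁,
      (if D.Keep σ κ ⟨9, j, k, 0⟩ then 0 else 1) = D.K₁ - 1 := fun j hj => by
    have := hκ j (Finset.mem_range.1 hj)
    have e : ∀ k, (if D.Keep σ κ ⟨9, j, k, 0⟩ then 0 else 1) = if k ≠ κ j then 1 else 0 := fun k => by
      simp [Keep]
    simp only [e]
    rw [← Finset.card_filter, Finset.filter_ne', Finset.card_erase_of_mem (by simpa using this),
      Finset.card_range]
  rw [Finset.sum_congr rfl h1, Finset.sum_congr rfl h2, Finset.sum_congr rfl h3]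
  simp [Keep, budget, mul_comm, add_assoc]

/-- The vertices outside the deletion set. -/
def Kept (D : SelCSP) (σ κ : ℕ → ℕ) (x : Vx) : Prop :=
  D.InR x ∧ ∀ d, D.accVx d = x → D.Keep σ κ x

theorem Kept.sel {t i : ℕ} (h : D.Kept σ κ ⟨2, t, i, 0⟩) (hi : i < 20) : i % 5 = σ (t % D.N) :=
  (h.2 (.inl (⟨t, h.1.2.1⟩, ⟨i, hi⟩)) rfl).2.1 rfl

theorem Kept.choice {j k : ℕ} (h : D.Kept σ κ ⟨9, j, k, 0⟩) (hj : j < D.J) (hk : k < D.K₁) :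
    k = κ j :=
  (h.2 (.inr (.inr (.inl (⟨j, hj⟩, ⟨k, hk⟩)))) rfl).2.2.2 rfl

theorem Kept.link {t f : ℕ} (h : D.Kept σ κ ⟨1, t, 0, f⟩) (ht : t + D.N < D.T) (hf : f < 2) :
    f < linkSize (σ (t % D.N)) :=
  (h.2 (.inr (.inl (⟨t, by omega⟩, ⟨f, by omega⟩))) (by simp [accVx, blk, hf])).1 rfl

theorem Kept.item {t x : ℕ} (h : D.Kept σ κ ⟨4, t, x, 0⟩) (hx : x < 8) (ha : D.Act t x) :
    ItemOk x (σ (t % D.N)) := by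
  have ht : t < D.T := h.1.2.1
  rcases ha with ⟨h1, h2⟩ | ⟨h1, h2⟩
  · refine (h.2 (.inr (.inl (⟨t, by omega⟩, ⟨x + 2, by omega⟩))) ?_).2.2.1 rfl
    simp [accVx, blk, h1]
  · refine (h.2 (.inr (.inl (⟨t - D.N, by omega⟩, ⟨x + 2, by omega⟩))) ?_).2.2.1 rfl
    simp [accVx, blk, h2, show ¬ x + 2 < 6 by omega]

/-- The group of a clamp has at most one vertex outside the deletion set. Thus a clamp has at most one
retained neighbour. -/
theorem Clamp.unique (hrow : ∀ j < D.J, ∀ c < D.K₂, D.row j c < D.N)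
    (hκ : ∀ j < D.J, ¬ D.bad j (κ j) ∧ ∀ c < D.K₂, D.clash c (κ j) → σ (D.row j c) ≠ c % 5)
    {x x' y : Vx} (h : D.Clamp x y) (h' : D.Clamp x' y) (hx : D.Kept σ κ x) (hx' : D.Kept σ κ x') :
    x = x' := by
  obtain ⟨a, t, i, f⟩ := x
  obtain ⟨a', t', i', f'⟩ := x'
  obtain ⟨b, u, k, g⟩ := y
  simp only [Clamp] at h h'
  obtain ⟨rfl, h⟩ := h
  obtain ⟨rfl, h'⟩ := h'
  have hclash : ∀ {j c k i t}, i = c % 5 → c < D.K₂ → j < D.J → t = j * D.N + D.row j c →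
      k < D.K₁ → D.clash c k → D.Kept σ κ ⟨2, t, i, 0⟩ → D.Kept σ κ ⟨9, j, k, 0⟩ → False := by
    rintro j c k _ _ rfl hc hj rfl hk hcl hs hch
    have h1 := hs.sel (by omega)
    rw [Nat.mul_add_mod_of_lt (hrow j hj c hc), Nat.mod_mod] at h1
    rw [hch.choice hj hk] at hcl
    exact (hκ j hj).2 c hc hcl h1.symm
  rcases h with ⟨rfl, h1, rfl, h2, h3⟩ | ⟨rfl, h1, rfl, h2, h3, h4, h5, h6⟩ |
    ⟨rfl, h1, rfl, h2, h3, h4⟩ | ⟨rfl, h1, h2, rfl, h3, h4⟩ | ⟨rfl, h1, h2, rfl, h3, h4⟩ |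
    ⟨rfl, h1, h2, rfl, h3, h4, h5⟩ | ⟨rfl, h1, h2, rfl, h3, h4, h5⟩ | ⟨rfl, h1, rfl, h2, h3, h4⟩
  · simp only [Nat.reduceEqDiff, false_and, and_false, or_false, true_and] at h'
    obtain ⟨rfl, h1', h2', h3'⟩ := h'
    have e1 := hx.sel h1
    have e2 := hx'.sel h1'
    obtain rfl : t = t' := by omega
    rw [show i = i' by omega]
  · simp only [Nat.reduceEqDiff, false_and, and_false, or_false, true_and, false_or] at h'
    rcases h' with ⟨rfl, h1', h2', h3', h4', h5', h6'⟩ | ⟨rfl, h1', h2', h3', h4'⟩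
    · have e1 := hx.sel h1
      have e2 := hx'.sel h1'
      obtain rfl : t = t' := by omega
      rw [show i = i' by omega]
    · subst h1' h4
      obtain rfl : u = t' := h3'
      exact absurd (by rw [hx.sel h1]; exact hx'.item (Nat.mod_lt _ (by omega)) h5) h6
  · simp only [Nat.reduceEqDiff, false_and, and_false, or_false, true_and, false_or] at h'
    rcases h' with ⟨rfl, h1', h2', h3', h4', h5', h6'⟩ | ⟨rfl, h1', h2', h3', h4'⟩
    · subst h1 h4'
      obtain rfl : u = t := h3
      exact absurd (by rw [hx'.sel h1']; exact hx.item (Nat.mod_lt _ (by omega)) h5') h6'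
    · subst h1 h1'
      rw [show t = t' by omega]
  · simp only [Nat.reduceEqDiff, false_and, and_false, or_false, true_and, false_or] at h'
    rcases h' with ⟨rfl, h1', h2', h3', h4'⟩ | ⟨rfl, h1', h2', h3', h4', h5'⟩
    · rw [h1, h2, h1', h2']
    · rw [hx'.choice h2' h1'] at h5'
      exact absurd h5' (hκ _ h2').1
  · simp only [Nat.reduceEqDiff, false_and, and_false, or_false, true_and, false_or] at h'
    obtain ⟨rfl, h1', h2', h3', h4'⟩ := h'
    obtain rfl : t = t' := by omega
    rw [hx.choice h2 h1, hx'.choice h2 h1']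
  · rw [hx.choice h2 h1] at h5
    exact absurd h5 (hκ _ h2).1
  · simp only [Nat.reduceEqDiff, false_and, and_false, true_and, false_or] at h'
    rcases h' with ⟨rfl, h1', h2', h3', h4', h5'⟩ | ⟨rfl, h1', h2', h3', h4'⟩
    · obtain rfl : t = t' := by omega
      rw [hx.choice h2 h1, hx'.choice h2 h1']
    · subst h4
      exact (hclash h1' h2' h3' h4' h1 h5 hx' hx).elim
  · simp only [Nat.reduceEqDiff, false_and, and_false, true_and, false_or] at h'
    rcases h' with ⟨rfl, h1', h2', h3', h4', h5'⟩ | ⟨rfl, h1', h2', h3', h4'⟩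
    · subst h4'
      exact (hclash h1 h2 h3 h4 h1' h5' hx hx').elim
    · rw [h1, h1', h4, h4']

/-- A retained link or item has at most one retained neighbour of lower rank. -/
theorem Thin.unique {x x' y : Vx} (h : D.Thin x y) (h' : D.Thin x' y) (hx : D.Kept σ κ x)
    (hx' : D.Kept σ κ x') (hy : D.Kept σ κ y) : x = x' := by
  obtain ⟨a, t, i, f⟩ := x
  obtain ⟨a', t', i', f'⟩ := x'
  obtain ⟨b, u, k, g⟩ := y
  -- the items `1, 2, 5, 6` of a block meet at most one vertex of a link, and not another item
  have key1 : ∀ {u k t}, (((k = 1 ∨ k = 2) ∧ u = t) ∨ ((k = 5 ∨ k = 6) ∧ u = t + D.N)) →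
      t + D.N < D.T → D.Kept σ κ ⟨4, u, k, 0⟩ →
      linkSize (σ (t % D.N)) ≤ 1 := by
    intro u k t hk ht hy
    have h1 := hy.item (by omega) (by simp only [Act]; omega)
    have e : u % D.N = t % D.N := by rcases hk with ⟨-, rfl⟩ | ⟨-, rfl⟩ <;> simp
    rw [e] at h1
    rcases hk with ⟨rfl | rfl, -⟩ | ⟨rfl | rfl, -⟩ <;> simp [ItemOk] at h1 <;>
      simp only [linkSize] <;> split_ifs <;> omega
  have key2 : ∀ {u t j f}, (j = 0 ∧ u = t ∨ j = 4 ∧ u = t + D.N) → t + D.N < D.T → f < 2 →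
      D.Act u j → D.Kept σ κ ⟨4, u, j, 0⟩ → D.Kept σ κ ⟨4, u, j + 1, 0⟩ →
      D.Kept σ κ ⟨1, t, 0, f⟩ → False := by
    intro u t j f hj ht hf ha h0 h1 hl
    have e : u % D.N = t % D.N := by rcases hj with ⟨-, rfl⟩ | ⟨-, rfl⟩ <;> simp
    have h2 := h0.item (by omega) ha
    have h3 := h1.item (by omega) (by simp only [Act] at *; omega)
    have h4 := hl.link ht hf
    rw [e] at h2 h3
    rcases hj with ⟨rfl, -⟩ | ⟨rfl, -⟩ <;> simp [ItemOk] at h2 h3 <;>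
      simp only [linkSize] at h4 <;> split_ifs at h4 <;> omega
  have key3 : ∀ {t f}, t + D.N < D.T → f < 2 → D.Kept σ κ ⟨4, t, 0, 0⟩ →
      D.Kept σ κ ⟨4, t + D.N, 4, 0⟩ → D.Kept σ κ ⟨1, t, 0, f⟩ → False := by
    intro t f ht hf h0 h1 hl
    have h2 := h0.item (by omega) (Or.inl ⟨by omega, ht⟩)
    have h3 := h1.item (by omega) (Or.inr ⟨by omega, by omega⟩)
    have h4 := hl.link ht hf
    rw [Nat.add_mod_right] at h3
    simp [ItemOk] at h2 h3
    simp only [linkSize] at h4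
    split_ifs at h4 <;> omega
  simp only [Thin] at h h'
  rcases h with ⟨rfl, rfl, rfl, rfl, rfl, h1, rfl, h2⟩ | ⟨rfl, rfl, rfl, rfl, rfl, h1, h2⟩ |
    ⟨rfl, rfl, rfl, rfl, h1, h2, h3⟩ | ⟨rfl, rfl, h1, rfl, rfl, h2, h3⟩
  · rcases h' with ⟨rfl, rfl, rfl, rfl, -⟩ | ⟨rfl, -, rfl, rfl, -, h1', h2'⟩ |
      ⟨-, -, h, -⟩ | ⟨rfl, rfl, h1', -, -, h2', h3'⟩
    · rfl
    · omega
    · omega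
    · omega
  · rcases h' with ⟨rfl, rfl, rfl, rfl, -, h1', -⟩ | ⟨rfl, -, rfl, rfl, -, h1', h2'⟩ |
      ⟨-, -, h, -⟩ | ⟨rfl, rfl, h1', -, -, h2', h3'⟩
    · omega
    · rw [show i = i' by omega]
    · omega
    · have e : k = i + 1 := by omega
      subst e
      exact (key2 (by omega) h3' h1' h2 hx hy hx').elim
  · rcases h' with ⟨rfl, rfl, rfl, rfl, h, -⟩ | ⟨rfl, h, -⟩ |
      ⟨rfl, rfl, -, -, h1', h2', h3'⟩ | ⟨rfl, rfl, h1', h, -⟩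
    · omega
    · omega
    · rcases h2 with ⟨rfl, rfl⟩ | ⟨rfl, rfl⟩ <;> rcases h2' with ⟨rfl, rfl⟩ | ⟨rfl, rfl⟩
      · rfl
      · exact (key3 h3 h1 hx hx' hy).elim
      · exact (key3 h3 h1 hx' hx hy).elim
      · rfl
    · omega
  · rcases h' with ⟨rfl, rfl, rfl, rfl, -, h1', -⟩ | ⟨rfl, -, rfl, rfl, -, h1', h2'⟩ |
      ⟨-, -, h, -⟩ | ⟨rfl, rfl, h1', -, -, h2', h3'⟩
    · omega
    · have e : k = i' + 1 := by omega
      subst e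
      exact (key2 (by omega) h3 h1 h2' hx' hy hx).elim
    · omega
    · obtain rfl : t = t' := by omega
      have := key1 h2 h3 hy
      have h4 := hx.link h3 h1
      have h5 := hx'.link h3 h1'
      rw [show f = f' by omega]

/-- An assignment that satisfies all constraints yields a feedback vertex set within the budget. -/
theorem hasSolution_of_holds (hrow : ∀ j < D.J, ∀ c < D.K₂, D.row j c < D.N)
    (hσ : ∀ i < D.N, σ i < 5) (h : ∀ j < D.J, D.Holds σ j) : D.inst.HasSolution := by
  classical
  have : ∀ j, ∃ κ, j < D.J → κ < D.K₁ ∧ ¬ D.bad j κ ∧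
      ∀ c < D.K₂, D.clash c κ → σ (D.row j c) ≠ c % 5 := fun j => by
    by_cases hj : j < D.J
    · obtain ⟨κ, h⟩ := h j hj
      exact ⟨κ, fun _ => h⟩
    · exact ⟨0, fun h => absurd h hj⟩
  choose κ hκ using this
  let X : Finset (Fin D.n) :=
    (Finset.univ.filter fun d => ¬ D.Keep σ κ (D.accVx d)).image fun d => vtx _ (inR_accVx d)
  have hkept : ∀ u : Fin D.n, u ∉ X → D.Kept σ κ (D.dec u) := fun u hu => by
    refine ⟨inR_dec u.2, fun d hd => ?_⟩
    by_contra hK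
    refine hu (Finset.mem_image.2 ⟨d, Finset.mem_filter.2 ⟨Finset.mem_univ _, hd ▸ hK⟩, ?_⟩)
    refine Fin.ext (dec_injective (D := D) ?_)
    rw [dec_vtx, hd]
  refine ⟨X, ?_, ?_⟩
  · have h1 : X.card ≤ D.budget := by
      refine Finset.card_image_le.trans (le_of_eq ?_)
      rw [← sum_not_keep hσ fun j hj => (hκ j hj).1, Finset.card_filter]
      exact Finset.sum_congr rfl fun d _ => by split_ifs <;> rfl
    have h2 : ∑ v ∈ X, D.inst.cost v = X.card := by simp [inst]
    exact h2.trans_le h1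
  · refine SimpleGraph.isAcyclic_of_rank (fun u => (D.dec u.1).rank) fun v u u' h h' hr hr' => ?_
    have toE : ∀ u : {v : Fin D.n | v ∉ X}, (D.inst.graph.induce {v | v ∉ X}).Adj u v →
        (D.dec u.1).rank ≤ (D.dec v.1).rank → D.E (D.dec u.1) (D.dec v.1) := fun u h hr => by
      rcases (D.adj_iff _ _).1 h with h | h
      · exact h
      · have h2 : (D.dec v.1).rank < (D.dec u.1).rank := h.rank_lt
        omega
    have e : D.dec u.1 = D.dec u'.1 := by
      have ku := hkept u.1 u.2
      have ku' := hkept u'.1 u'.2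
      have kv := hkept v.1 v.2
      rcases toE u h hr with h1 | h1 <;> rcases toE u' h' hr' with h2 | h2
      · exact h1.unique hrow (fun j hj => (hκ j hj).2) h2 ku ku'
      · exfalso
        obtain ⟨-, h1⟩ := h1
        simp only [Thin] at h2
        omega
      · exfalso
        obtain ⟨-, h2⟩ := h2
        simp only [Thin] at h1
        omega
      · exact h1.unique h2 ku ku' kv
    exact Subtype.ext (Fin.ext (dec_injective e))

end SelCSP

/-! ### The width of the path decomposition -/

namespace SelCSP

variable {D : SelCSP}

/-- The vertices `x` and `y` are twins. -/
def Tw (D : SelCSP) (x y : Vx) : Prop :=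
  ∀ z, D.InR z → z ≠ x → z ≠ y → (D.Adj x z ↔ D.Adj y z)

theorem Tw.symm {x y : Vx} (h : D.Tw x y) : D.Tw y x := fun z hz h1 h2 => (h z hz h2 h1).symm

theorem _root_.twins_iff_forall {V : Type*} (G : SimpleGraph V) (u v : V) :
    Twins G u v ↔ ∀ w, w ≠ u → w ≠ v → (G.Adj u w ↔ G.Adj v w) := by
  simp only [Twins, Set.ext_iff, Set.mem_sdiff, SimpleGraph.mem_neighborSet, Set.mem_singleton_iff]
  refine forall_congr' fun w => ?_
  have h1 := G.ne_of_adj (a := u) (b := w)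
  have h2 := G.ne_of_adj (a := v) (b := w)
  grind

theorem twins_iff (u v : Fin D.inst.n) : Twins D.inst.graph u v ↔ D.Tw (D.dec u) (D.dec v) := by
  rw [twins_iff_forall]
  constructor
  · intro h z hz h1 h2
    have hne : ∀ w : Fin D.n, z ≠ D.dec w → vtx z hz ≠ w := fun w h e => h (by rw [← e, dec_vtx])
    have h3 := (D.adj_iff _ _).symm.trans
      ((h (vtx z hz) (hne _ h1) (hne _ h2)).trans (D.adj_iff _ _))
    rwa [dec_vtx] at h3
  · intro h w hu hv
    have hne : ∀ v : Fin D.n, w ≠ v → D.dec w ≠ D.dec v := fun v h e =>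
      h (Fin.ext (dec_injective e))
    exact (D.adj_iff _ _).trans ((h (D.dec w) (inR_dec w.2) (hne _ hu) (hne _ hv)).trans
      (D.adj_iff _ _).symm)

/-- The vertex `x` is not isolated. -/
def Used (D : SelCSP) (x : Vx) : Prop := ∃ y, D.InR y ∧ D.Adj x y

theorem two_le_F : 2 ≤ D.F := by simp only [F]; omega

theorem lt_M {i : ℕ} (h : i < D.K₁ ∨ i < D.K₂ ∨ i < 32) : i < D.M := by
  simp only [M]; omega

/-- Each constraint has a bad choice, and each `c` clashes with some choice. -/
structure Proper (D : SelCSP) : Prop where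
  row_lt : ∀ j < D.J, ∀ c < D.K₂, D.row j c < D.N
  exists_bad : ∀ j < D.J, ∃ κ < D.K₁, D.bad j κ
  exists_clash : ∀ c < D.K₂, ∃ κ < D.K₁, D.clash c κ

/-- A vertex that is adjacent to all copies of a clamp is so, even up to itself, for its twins. -/
theorem Tw.clamp {x y : Vx} (h : D.Tw x y) {a t i : ℕ} (ha : a < 10) (ht : t < D.T) (hi : i < D.M)
    (hx : ∀ f, D.Adj x ⟨a, t, i, f⟩) : ∃ f, D.Adj y ⟨a, t, i, f⟩ := by
  have hF := D.two_le_F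
  by_cases e : y.f = 0
  · refine ⟨1, (h _ ⟨ha, ht, hi, by simp only; omega⟩ (hx _).ne.symm ?_).1 (hx _)⟩
    rintro rfl
    exact absurd e (by simp)
  · refine ⟨0, (h _ ⟨ha, ht, hi, by simp only; omega⟩ (hx _).ne.symm ?_).1 (hx _)⟩
    rintro rfl
    exact absurd rfl e

theorem Tw.selector {x y : Vx} (h : D.Tw x y) (hx : D.InR x) (hu : D.Used x) (ha : x.a = 2) :
    y.a = 2 ∧ y.t = x.t := by
  obtain ⟨a, t, i, f⟩ := x
  obtain rfl : a = 2 := ha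
  obtain ⟨z, -, hz⟩ := hu
  have hi : i < 20 ∨ i < 5 := by simp only [Adj, E, Clamp, Thin] at hz; omega
  have hf : f = 0 := by simp only [Adj, E, Clamp, Thin] at hz; omega
  obtain ⟨f', h'⟩ := h.clamp (a := 3) (t := t) (i := i / 5) (by omega) hx.2.1
    (lt_M (by omega)) fun f' => Or.inl (Or.inl ⟨hf, Or.inl ⟨rfl, by simp only; omega, rfl, rfl, rfl⟩⟩)
  simp only [Adj, E, Clamp, Thin] at h'
  simp only
  omega

theorem Tw.item {x y : Vx} (h : D.Tw x y) (hx : D.InR x) (hu : D.Used x) (ha : x.a = 4) :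
    (y.a = 2 ∨ y.a = 4) ∧ y.t = x.t := by
  obtain ⟨a, t, i, f⟩ := x
  obtain rfl : a = 4 := ha
  obtain ⟨z, -, hz⟩ := hu
  have hi : i < 8 ∧ D.Act t i ∧ f = 0 := by simp only [Adj, E, Clamp, Thin, Act] at hz ⊢; omega
  obtain ⟨hi, hA, hf⟩ := hi
  have hm := Nat.mod_eq_of_lt hi
  obtain ⟨f', h'⟩ := h.clamp (a := 5) (t := t) (i := i) (by omega) hx.2.1
    (lt_M (by omega)) fun f' => Or.inl (Or.inl ⟨hf, Or.inr (Or.inr (Or.inl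
      ⟨rfl, by simp [hm], rfl, by simp only; omega, rfl, by simpa [hm] using hA⟩))⟩)
  simp only [Adj, E, Clamp, Thin] at h'
  simp only
  omega

theorem Tw.choice {x y : Vx} (h : D.Tw x y) (hx : D.InR x) (hu : D.Used x) (ha : x.a = 9) :
    y.a = 9 ∧ y.t = x.t := by
  obtain ⟨a, t, i, f⟩ := x
  obtain rfl : a = 9 := ha
  obtain ⟨z, -, hz⟩ := hu
  have hi : i < D.K₁ ∧ t < D.J ∧ f = 0 := by simp only [Adj, E, Clamp, Thin] at hz; omega
  obtain ⟨f', h'⟩ := h.clamp (a := 6) (t := t) (i := 0) (by omega) hx.2.1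
    D.M_pos fun f' => Or.inl (Or.inl ⟨hi.2.2, Or.inr (Or.inr (Or.inr (Or.inr (Or.inl
      ⟨rfl, hi.1, hi.2.1, rfl, rfl, rfl⟩))))⟩)
  simp only [Adj, E, Clamp, Thin] at h'
  simp only
  omega

theorem Tw.used {x y : Vx} (h : D.Tw x y) (hx : D.InR x) (hu : D.Used x) : D.Used y := by
  obtain ⟨z, hz, hxz⟩ := hu
  by_cases e : z = y
  · subst e
    exact ⟨x, hx, hxz.symm⟩
  · exact ⟨z, hz, (h z hz hxz.ne.symm e).1 hxz⟩

theorem Tw.root {x y : Vx} (h : D.Tw x y) (hx : D.InR x) (hy : D.InR y) (hu : D.Used x)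
    (ha : x.a = 0) : y.a = 0 := by
  have hc := h.symm.choice hy (h.used hx hu)
  obtain ⟨a, t, i, f⟩ := x
  obtain rfl : a = 0 := ha
  obtain ⟨z, -, hz⟩ := hu
  have hi : i = 0 ∧ t = 0 ∧ f = 0 := by simp only [Adj, E, Clamp, Thin] at hz; omega
  obtain ⟨rfl, rfl, rfl⟩ := hi
  have hJ := D.J_pos
  obtain ⟨f', h'⟩ := h.clamp (a := 7) (t := 0) (i := 0) (by omega) D.T_pos
    D.M_pos fun f' => Or.inl (Or.inl ⟨rfl, Or.inr (Or.inr (Or.inr (Or.inl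
      ⟨rfl, rfl, rfl, rfl, rfl, hJ⟩)))⟩)
  simp only [Adj, E, Clamp, Thin] at h'
  simp only at hc
  omega

/-- Item clamps and selector clamps are adjacent to a selector. -/
theorem Used.exists_selector {x : Vx} (hu : D.Used x) (ha : x.a = 3 ∨ x.a = 5) :
    ∃ i < 20, D.E ⟨2, x.t, i, 0⟩ x := by
  obtain ⟨a, t, i, f⟩ := x
  simp only at ha
  obtain ⟨z, -, hz⟩ := hu
  rcases ha with rfl | rfl
  · have hi : i < 4 := by simp only [Adj, E, Clamp, Thin] at hz; omega
    exact ⟨5 * i, by omega, Or.inl ⟨rfl, Or.inl ⟨rfl, by simp only; omega, rfl,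
      by simp only; omega, rfl⟩⟩⟩
  · have hi : i < 32 ∧ D.Act t (i % 8) := by simp only [Adj, E, Clamp, Thin, Act] at hz ⊢; omega
    obtain ⟨hi, hA⟩ := hi
    obtain ⟨s, hs, hn⟩ : ∃ s < 5, ¬ ItemOk (i % 8) s := by
      by_contra! h
      have h0 := h 0 (by omega)
      have h1 := h 1 (by omega)
      have h2 := h 2 (by omega)
      simp only [ItemOk] at h0 h1 h2
      omega
    refine ⟨5 * (i / 8) + s, by omega, Or.inl ⟨rfl, Or.inr (Or.inl ⟨rfl, by simp only; omega, rfl,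
      hi, by simp only; omega, rfl, hA, ?_⟩)⟩⟩
    rwa [show (5 * (i / 8) + s) % 5 = s by omega]

/-- Choice clamps, bad clamps and clash clamps are adjacent to a choice. -/
theorem Used.exists_choice (hD : D.Proper) {x : Vx} (hu : D.Used x)
    (ha : x.a = 6 ∨ x.a = 7 ∨ x.a = 8) : x.t < D.J ∧ ∃ i < D.K₁, D.E ⟨9, x.t, i, 0⟩ x := by
  obtain ⟨a, t, i, f⟩ := x
  simp only at ha
  obtain ⟨z, -, hz⟩ := hu
  have hi : t < D.J ∧ (a = 8 ∧ i < D.K₂ ∨ a ≠ 8 ∧ i = 0) := by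
    simp only [Adj, E, Clamp, Thin] at hz; omega
  obtain ⟨ht, hi⟩ := hi
  refine ⟨ht, ?_⟩
  rcases ha with rfl | rfl | rfl
  · obtain ⟨k, hk, -⟩ := hD.exists_bad t ht
    exact ⟨k, hk, Or.inl ⟨rfl, Or.inr (Or.inr (Or.inr (Or.inr (Or.inl
      ⟨rfl, hk, ht, rfl, by simp only; omega, rfl⟩))))⟩⟩
  · obtain ⟨k, hk, hb⟩ := hD.exists_bad t ht
    exact ⟨k, hk, Or.inl ⟨rfl, Or.inr (Or.inr (Or.inr (Or.inr (Or.inr (Or.inl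
      ⟨rfl, hk, ht, rfl, by simp only; omega, rfl, hb⟩)))))⟩⟩
  · obtain ⟨k, hk, hb⟩ := hD.exists_clash i (by omega)
    exact ⟨k, hk, Or.inl ⟨rfl, Or.inr (Or.inr (Or.inr (Or.inr (Or.inr (Or.inr (Or.inl
      ⟨rfl, hk, ht, rfl, by simp only; omega, rfl, hb⟩))))))⟩⟩

theorem Tw.columnClamp (hD : D.Proper) {x y : Vx} (h : D.Tw x y) (hx : D.InR x) (hy : D.InR y)
    (hu : D.Used x) (ha : x.a = 6 ∨ x.a = 7 ∨ x.a = 8) :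
    (y.a = 6 ∨ y.a = 7 ∨ y.a = 8) ∧ y.t = x.t := by
  have hc := h.symm.choice hy (h.used hx hu)
  obtain ⟨ht, i, hi, hE⟩ := hu.exists_choice hD ha
  have h' := (h ⟨9, x.t, i, 0⟩ ⟨by simp only; omega, hx.2.1, lt_M (Or.inl hi), D.F_pos⟩ hE.ne
    (fun e => by have := hc (by rw [← e]); omega)).1 (Or.inr hE)
  simp only [Adj, E, Clamp, Thin] at h'
  omega

theorem Tw.cellClamp (hD : D.Proper) {x y : Vx} (h : D.Tw x y) (hx : D.InR x) (hy : D.InR y)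
    (hu : D.Used x) (ha : x.a = 3 ∨ x.a = 5) : (y.a = 3 ∨ y.a = 5) ∧ y.t = x.t := by
  have hc := h.symm.selector hy (h.used hx hu)
  have hc' := h.symm.columnClamp hD hy hx (h.used hx hu)
  obtain ⟨i, hi, hE⟩ := hu.exists_selector ha
  have h' := (h ⟨2, x.t, i, 0⟩ ⟨by simp only; omega, hx.2.1, lt_M (by simp only; omega), D.F_pos⟩ hE.ne
    (fun e => by have := hc (by rw [← e]); omega)).1 (Or.inr hE)
  simp only [Adj, E, Clamp, Thin] at h'
  omega

/-- A link is adjacent to the item `0` of its cell; the other neighbours of that item are not twins of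
a link. -/
theorem Tw.link (hD : D.Proper) {x y : Vx} (h : D.Tw x y) (hx : D.InR x) (hy : D.InR y)
    (hu : D.Used x) (ha : x.a = 1) : y.a = 1 ∧ y.t = x.t := by
  have h1 := h.symm.item hy (h.used hx hu)
  have h2 := h.symm.root hy hx (h.used hx hu)
  have h3 := h.symm.cellClamp hD hy hx (h.used hx hu)
  obtain ⟨a, t, i, f⟩ := x
  obtain rfl : a = 1 := ha
  obtain ⟨z, -, hz⟩ := hu
  have hi : i = 0 ∧ t + D.N < D.T ∧ f < 2 := by simp only [Adj, E, Clamp, Thin] at hz; omega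
  have h' := (h ⟨4, t, 0, 0⟩ ⟨by simp only; omega, hx.2.1, D.M_pos, D.F_pos⟩
    (by simp) (fun e => by have := h1 (by rw [← e]); simp only at this; omega)).1
    (Or.inr (Or.inr (Or.inr (Or.inr (Or.inl ⟨rfl, rfl, rfl, hi.1, hi.2.2, Or.inl ⟨rfl, rfl⟩,
      hi.2.1⟩)))))
  simp only [Adj, E, Clamp, Thin] at h'
  simp only at h1 h2 h3 ⊢
  omega

/-- Twins that are not isolated are in the same bags. -/
theorem InBag.tw (hD : D.Proper) {x y : Vx} (h : D.Tw x y) (hx : D.InR x) (hy : D.InR y)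
    (hu : D.Used x) {s t : ℕ} (hyL : D.InBag s y) (hxt : D.InBag t x) : D.InBag t y := by
  have h0 := h.root hx hy hu
  have h1 := h.link hD hx hy hu
  have h2 := h.selector hx hu
  have h3 := h.cellClamp hD hx hy hu
  have h4 := h.item hx hu
  have h5 := h.columnClamp hD hx hy hu
  have h6 := h.choice hx hu
  have h7 := hx.1
  have key : (x.a = 0 ∧ y.a = 0) ∨ (y.t = x.t ∧ ((x.a = 1 ∧ y.a = 1) ∨
      (2 ≤ x.a ∧ x.a < 6 ∧ 2 ≤ y.a ∧ y.a < 6) ∨ (6 ≤ x.a ∧ 6 ≤ y.a))) := by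
    clear hyL hxt
    generalize x.a = a at *
    interval_cases a
    · exact Or.inl ⟨rfl, h0 rfl⟩
    · have := h1 rfl; omega
    · have := h2 rfl; omega
    · have := h3 (by omega); omega
    · have := h4 rfl; omega
    · have := h3 (by omega); omega
    · have := h5 (by omega); omega
    · have := h5 (by omega); omega
    · have := h5 (by omega); omega
    · have := h6 rfl; omega
  clear h0 h1 h2 h3 h4 h5 h6
  simp only [InBag] at hyL hxt ⊢
  rcases key with key | ⟨e, key | key | key⟩ <;> omega

theorem InBag.convex {x : Vx} {i j l : ℕ} (hij : i ≤ j) (hjl : j ≤ l) (hi : D.InBag i x)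
    (hl : D.InBag l x) : D.InBag j x := by
  have h1 := Nat.div_le_div_right (c := D.N) hij
  have h2 := Nat.div_le_div_right (c := D.N) hjl
  simp only [InBag] at *
  generalize i / D.N = u at *
  generalize j / D.N = v at *
  generalize l / D.N = w at *
  omega

end SelCSP

namespace SelCSP

variable {D : SelCSP}

/-- The copy of the vertex `x` that stands for its class in the bags. -/
def _root_.Vx.copy (x : Vx) : Vx := { x with f := 0 }

theorem InR.copy {x : Vx} (h : D.InR x) : D.InR x.copy := ⟨h.1, h.2.1, h.2.2.1, D.F_pos⟩

/-- The copies of a clamp, and the two copies of a link, are twins. -/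
theorem Used.tw_copy {x : Vx} (h : D.Used x) : D.Tw x x.copy := by
  intro z _ _ _
  obtain ⟨a, t, i, f⟩ := x
  obtain ⟨a', t', i', f'⟩ := z
  by_cases hf : f = 0
  · subst hf; rfl
  obtain ⟨y, -, h⟩ := h
  have : a = 3 ∨ (a = 1 ∧ f < 2) ∨ (5 ≤ a ∧ a < 9) := by
    simp only [Adj, E, Clamp, Thin] at h; omega
  rcases this with rfl | ⟨rfl, h'⟩ | h'
  · simp [Adj, E, Clamp, Thin, Vx.copy]
  · simp [Adj, E, Clamp, Thin, Vx.copy, h']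
  · have h1 : a ≠ 4 := by omega
    have h2 : a ≠ 0 := by omega
    have h3 : a ≠ 2 := by omega
    have h4 : a ≠ 9 := by omega
    have h5 : a ≠ 1 := by omega
    simp [Adj, E, Clamp, Thin, Vx.copy, h1, h2, h3, h4, h5]

theorem E.exists_bag (hD : D.Proper) {x y : Vx} (h : D.E x y) (hx : D.InR x) (hy : D.InR y) :
    ∃ t < D.T, D.InBag t x.copy ∧ D.InBag t y.copy := by
  obtain ⟨a, t, i, f⟩ := x
  obtain ⟨a', t', i', f'⟩ := y
  have ht : t < D.T := hx.2.1
  have ht' : t' < D.T := hy.2.1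
  have hN := D.N_pos
  have hmul : ∀ j < D.J, j * D.N < D.T ∧ j * D.N / D.N = j := fun j hj =>
    ⟨by rw [T, mul_comm]; exact Nat.mul_lt_mul_of_pos_left hj hN, Nat.mul_div_cancel _ hN⟩
  simp only [InBag, Vx.copy, true_and]
  rcases h with ⟨-, h⟩ | h
  · simp only at h
    rcases h with h | h | h | h | h | h | h | h
    · exact ⟨t, ht, by omega⟩
    · exact ⟨t, ht, by omega⟩
    · exact ⟨t, ht, by omega⟩
    · refine ⟨t' * D.N, (hmul t' (by omega)).1, ?_⟩
      rw [(hmul t' (by omega)).2]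
      omega
    · refine ⟨t * D.N, (hmul t (by omega)).1, ?_⟩
      rw [(hmul t (by omega)).2]
      omega
    · refine ⟨t * D.N, (hmul t (by omega)).1, ?_⟩
      rw [(hmul t (by omega)).2]
      omega
    · refine ⟨t * D.N, (hmul t (by omega)).1, ?_⟩
      rw [(hmul t (by omega)).2]
      omega
    · obtain ⟨rfl, -, rfl, hi, hj, h⟩ := h
      have hr := hD.row_lt _ hj _ hi
      refine ⟨t, ht, by omega, ?_⟩
      rw [h, Nat.mul_comm, Nat.mul_add_div hN, Nat.div_eq_of_lt hr]
      omega
  · simp only [Thin] at h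
    rcases h with h | h | h | h
    · exact ⟨t', ht', by omega⟩
    · exact ⟨t, ht, by omega⟩
    · exact ⟨t, ht, by omega⟩
    · exact ⟨t', ht', by omega⟩

theorem Adj.exists_bag (hD : D.Proper) {x y : Vx} (h : D.Adj x y) (hx : D.InR x) (hy : D.InR y) :
    ∃ t < D.T, D.InBag t x.copy ∧ D.InBag t y.copy := by
  rcases h with h | h
  · exact h.exists_bag hD hx hy
  · obtain ⟨t, ht, h1, h2⟩ := h.exists_bag hD hy hx
    exact ⟨t, ht, h2, h1⟩

theorem inBag_root (t : ℕ) {f : ℕ} (hf : f < 2) : D.InBag t ⟨0, 0, 0, f⟩ :=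
  Or.inl ⟨rfl, rfl, rfl, hf⟩

theorem not_used_iso : ¬ D.Used ⟨0, 0, 0, 1⟩ := by
  rintro ⟨y, -, h⟩
  simp [Adj, E, Clamp, Thin] at h

theorem tw_of_not_used {x y : Vx} (hx : ¬ D.Used x) (hy : ¬ D.Used y) : D.Tw x y :=
  fun z hz _ _ => iff_of_false (fun h => hx ⟨z, hz, h⟩) fun h => hy ⟨z, hz, h⟩

open Classical in
theorem mem_bag_iff (t : Fin D.inst.bags.length) (v : Fin D.n) :
    v ∈ D.inst.bags.get t ↔ D.InBag t (D.dec v) := by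
  have h : D.inst.bags.get t = (List.finRange D.n).map fun v : Fin D.n =>
      if D.InBag t (D.dec v) then v
      else vtx _ (D.inR_zero (a := 0) (f := 0) (by omega) (by omega)) :=
    (List.getElem_map _).trans (by rw [List.getElem_range])
  rw [h]
  refine List.mem_map.trans ⟨?_, fun h => ⟨v, List.mem_finRange v, if_pos h⟩⟩
  rintro ⟨u, -, rfl⟩
  split_ifs with h
  · exact h
  · rw [dec_vtx]
    exact inBag_root _ (by omega)

theorem mem_quotientBags {t : Fin D.inst.bags.length} {a : Quotient (twinclasses D.inst.graph)} :
    a ∈ D.inst.quotientBags t ↔ ∃ v : Fin D.inst.n, D.InBag t (D.dec v) ∧ ⟦v⟧ = a :=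
  exists_congr fun v => and_congr_left fun _ => mem_bag_iff t v

theorem length_bags : D.inst.bags.length = D.T := by simp [inst]

theorem isPathDecomposition (hD : D.Proper) :
    IsPathDecomposition (quotientGraph D.inst.graph (twinclasses D.inst.graph))
      D.inst.quotientBags := by
  have hsound : ∀ u v : Fin D.inst.n, D.Tw (D.dec u) (D.dec v) →
      Quotient.mk (twinclasses D.inst.graph) u = ⟦v⟧ := fun u v h =>
    Quotient.sound ((twins_iff u v).2 h)
  have hT := D.T_pos
  have hl := D.length_bags
  refine ⟨fun a => ?_, fun a b => ?_, fun a i j l hij hjl => ?_⟩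
  · induction a using Quotient.inductionOn with
    | h u =>
    have hu : D.InR (D.dec u) := inR_dec u.2
    by_cases h : D.Used (D.dec u)
    · obtain ⟨y, hy, h'⟩ := id h
      obtain ⟨t, ht, hb, -⟩ := h'.exists_bag hD hu hy
      refine ⟨⟨t, hl ▸ ht⟩, mem_quotientBags.2 ⟨vtx _ hu.copy, ?_, ?_⟩⟩
      · rwa [dec_vtx]
      · refine (hsound _ _ ?_).symm
        rw [dec_vtx]
        exact h.tw_copy
    · have hr : D.InR ⟨0, 0, 0, 1⟩ := inR_zero (by omega) (by omega)
      refine ⟨⟨0, hl ▸ hT⟩, mem_quotientBags.2 ⟨vtx _ hr, ?_, ?_⟩⟩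
      · rw [dec_vtx]
        exact inBag_root _ (by omega)
      · refine (hsound _ _ ?_).symm
        rw [dec_vtx]
        exact tw_of_not_used h not_used_iso
  · rintro ⟨-, u, v, rfl, rfl, h⟩
    have hu : D.InR (D.dec u) := inR_dec u.2
    have hv : D.InR (D.dec v) := inR_dec v.2
    have h := (D.adj_iff u v).1 h
    obtain ⟨t, ht, h1, h2⟩ := h.exists_bag hD hu hv
    refine ⟨⟨t, hl ▸ ht⟩, mem_quotientBags.2 ⟨vtx _ hu.copy, ?_, ?_⟩,
      mem_quotientBags.2 ⟨vtx _ hv.copy, ?_, ?_⟩⟩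
    · rwa [dec_vtx]
    · refine (hsound _ _ ?_).symm
      rw [dec_vtx]
      exact Used.tw_copy ⟨_, hv, h⟩
    · rwa [dec_vtx]
    · refine (hsound _ _ ?_).symm
      rw [dec_vtx]
      exact Used.tw_copy ⟨_, hu, h.symm⟩
  · simp only [mem_quotientBags]
    rintro ⟨u, hu, rfl⟩ ⟨v, hv, huv⟩
    have hru : D.InR (D.dec u) := inR_dec u.2
    have hrv : D.InR (D.dec v) := inR_dec v.2
    have htw := (twins_iff v u).1 (Quotient.exact huv)
    by_cases h : D.Used (D.dec u)
    · refine ⟨u, hu.convex hij hjl ?_, rfl⟩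
      exact InBag.tw hD htw hrv hru (htw.symm.used hru h) hu hv
    · have hr : D.InR ⟨0, 0, 0, 1⟩ := inR_zero (by omega) (by omega)
      refine ⟨vtx _ hr, ?_, hsound _ _ ?_⟩
      · rw [dec_vtx]
        exact inBag_root _ (by omega)
      · rw [dec_vtx]
        exact tw_of_not_used not_used_iso h

theorem ncard_quotientBags_le (t : Fin D.inst.bags.length) :
    (D.inst.quotientBags t).ncard ≤ D.N + 3 + 8 * D.M := by
  classical
  let S : Finset Vx := ({⟨0, 0, 0, 0⟩, ⟨0, 0, 0, 1⟩} ∪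
    (Finset.range (D.N + 1)).image fun k => ⟨1, t - k, 0, 0⟩) ∪
    (Finset.range 8 ×ˢ Finset.range D.M).image fun d =>
      ⟨d.1 + 2, if d.1 < 4 then t else t / D.N, d.2, 0⟩
  have hS : S.card ≤ 2 + (D.N + 1) + 8 * D.M := by
    refine (Finset.card_union_le _ _).trans (Nat.add_le_add ((Finset.card_union_le _ _).trans
      (Nat.add_le_add Finset.card_le_two (Finset.card_image_le.trans ?_)))
      (Finset.card_image_le.trans ?_))
    · simp
    · simp
  let B : Finset (Fin D.inst.n) := Finset.univ.filter fun v => D.InBag t (D.dec v)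
  have hB : B.card ≤ S.card := by
    refine Finset.card_le_card_of_injOn (fun v => D.dec v) (fun v hv => ?_)
      fun u _ v _ h => Fin.ext (dec_injective h)
    have hr : D.InR (D.dec v) := inR_dec v.2
    have hv : D.InBag t (D.dec v) := (Finset.mem_filter.1 hv).2
    change D.dec v ∈ _
    generalize D.dec v = x at hr hv ⊢
    simp only [Finset.coe_union, S, Finset.coe_image, Set.mem_union, Set.mem_image, Finset.mem_coe,
      Finset.mem_insert, Finset.mem_singleton, Finset.mem_product, Finset.mem_range, Vx.ext_iff]
    obtain ⟨ha, -, hi, -⟩ := hr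
    rcases hv with h | ⟨hf, h | h | h⟩
    · left; left; omega
    · left; right
      exact ⟨t - x.t, by omega, by omega⟩
    · right
      refine ⟨(x.a - 2, x.i), by simp only; omega, ?_⟩
      simp only [show x.a - 2 < 4 by omega, if_true, true_and]
      omega
    · right
      refine ⟨(x.a - 2, x.i), by simp only; omega, ?_⟩
      simp only [show ¬ x.a - 2 < 4 by omega, if_false, true_and]
      omega
  have hsub : D.inst.quotientBags t ⊆
      ((B.image fun v => (⟦v⟧ : Quotient (twinclasses D.inst.graph)) :
        Finset (Quotient (twinclasses D.inst.graph))) : Set _) := fun a ha => by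
    obtain ⟨v, hv, rfl⟩ := mem_quotientBags.1 ha
    exact Finset.mem_coe.2 (Finset.mem_image_of_mem _ (Finset.mem_filter.2 ⟨Finset.mem_univ _, hv⟩))
  refine (Set.ncard_le_ncard hsub (Finset.finite_toSet _)).trans ?_
  rw [Set.ncard_coe_finset]
  exact Finset.card_image_le.trans (by omega)

theorem exists_givenWidth (hD : D.Proper) : ∃ k ≤ D.N + 2 + 8 * D.M, D.inst.GivenWidth k := by
  have hl : 0 < D.inst.bags.length := D.length_bags ▸ D.T_pos
  obtain ⟨t, -, ht⟩ := Finset.exists_max_image Finset.univ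
    (fun t => (D.inst.quotientBags t).ncard) ⟨⟨0, hl⟩, Finset.mem_univ _⟩
  have h1 := D.ncard_quotientBags_le t
  have hpos : 0 < (D.inst.quotientBags t).ncard := by
    rw [Set.ncard_pos (Set.toFinite _)]
    have hr : D.InR ⟨0, 0, 0, 0⟩ := inR_zero (by omega) (by omega)
    exact ⟨_, mem_quotientBags.2 ⟨vtx _ hr, by rw [dec_vtx]; exact inBag_root _ (by omega), rfl⟩⟩
  refine ⟨(D.inst.quotientBags t).ncard - 1, by omega, isPathDecomposition hD, fun s => ?_, t, ?_⟩
  · have := ht s (Finset.mem_univ _)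
    omega
  · omega

end SelCSP

/-! ### The instance can be written down in polynomial time -/

open RAM

theorem List.flatMap_finRange {α : Type*} (n : ℕ) (h : ℕ → List α) :
    (List.finRange n).flatMap (fun u => h u.1) = (List.range n).flatMap h := by
  rw [← List.map_coe_finRange_eq_range, List.flatMap_map]

namespace SelCSP

open Classical in
theorem encode_inst (D : SelCSP) : D.inst.encode =
    [D.n] ++ ((List.range D.n).flatMap fun _ => [1]) ++ [D.budget] ++ [D.n * D.n] ++
    ((List.range D.n).flatMap fun u => (List.range D.n).flatMap fun v =>
      [if D.E (D.dec u) (D.dec v) then u else D.enc ⟨0, 0, 0, 0⟩] ++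
      [if D.E (D.dec u) (D.dec v) then v else D.enc ⟨7, 0, 0, 0⟩]) ++ [D.T] ++
    ((List.range D.T).flatMap fun t => [D.n] ++
      (List.range D.n).flatMap fun v => [if D.InBag t (D.dec v) then v else D.enc ⟨0, 0, 0, 0⟩]) := by
  simp only [← List.flatMap_finRange D.n]
  have h1 : List.ofFn D.inst.cost = (List.finRange D.n).flatMap fun _ => [1] := by
    rw [← List.map_eq_flatMap, List.ofFn_eq_map]
    rfl
  have h2 : D.inst.edges.length = D.n * D.n := by
    simp [inst, List.length_flatMap]
  have h3 : D.inst.bags.length = D.T := D.length_bags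
  rw [FVSInstance.encode, h1, h2, h3]
  congr 1
  · congr 2
    simp only [inst, List.flatMap_assoc, List.flatMap_map]
    refine congrArg₂ _ (funext fun u => congrArg₂ _ (funext fun v => ?_) rfl) rfl
    split_ifs <;> rfl
  · simp only [inst, List.flatMap_map]
    refine congrArg₂ _ (funext fun t => ?_) rfl
    simp only [List.length_map, List.length_finRange, List.map_map, List.singleton_append,
      ← List.map_eq_flatMap]
    refine congrArg _ (List.map_congr_left fun v _ => ?_)
    simp only [Function.comp_apply]
    split_ifs <;> rfl

/-- The components of the vertex `x w e` can be computed in polynomial time. -/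
structure PVx (x : List ℕ → (ℕ → ℕ) → Vx) : Prop where
  a : PComp fun w e => (x w e).a
  t : PComp fun w e => (x w e).t
  i : PComp fun w e => (x w e).i
  f : PComp fun w e => (x w e).f

/-- The constraint satisfaction problem `D w` can be read off from `w` in polynomial time. -/
structure PCSP (D : List ℕ → SelCSP) : Prop where
  N : PComp fun w _ => (D w).N
  J : PComp fun w _ => (D w).J
  K₁ : PComp fun w _ => (D w).K₁
  K₂ : PComp fun w _ => (D w).K₂
  row : PComp fun w e => (D w).row (e 0) (e 1)
  bad : PDec fun w e => (D w).bad (e 0) (e 1)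
  clash : PDec fun w e => (D w).clash (e 0) (e 1)

theorem _root_.RAM.PDec.comp₂ {op : List ℕ → ℕ → ℕ → Prop} (h : PDec fun w e => op w (e 0) (e 1))
    {f g : List ℕ → (ℕ → ℕ) → ℕ} (hf : PComp f) (hg : PComp g) :
    PDec fun w e => op w (f w e) (g w e) := by
  obtain ⟨c, hc, h⟩ := h
  have := hf.bind (hg.shift.bind (hc.rename fun i => if i = 0 then 1 else 0))
  exact ⟨_, this, fun w e => (h _ _).trans (by simp)⟩

namespace PCSP

variable {D : List ℕ → SelCSP} (hD : PCSP D) {x y : List ℕ → (ℕ → ℕ) → Vx}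
include hD

theorem T : PComp fun w _ => (D w).T := hD.N.mul hD.J

theorem M : PComp fun w _ => (D w).M := (hD.K₁.add hD.K₂).add (.const 32)

theorem budget : PComp fun w _ => (D w).budget :=
  (((PComp.const 16).mul hD.T).add ((PComp.const 5).mul (hD.T.sub hD.N))).add
    (hD.J.mul (hD.K₁.sub (.const 1)))

theorem F : PComp fun w _ => (D w).F := hD.budget.add (.const 2)

theorem n : PComp fun w _ => (D w).n := ((hD.T.mul (.const 10)).mul hD.M).mul hD.F

theorem dec {f : List ℕ → (ℕ → ℕ) → ℕ} (hf : PComp f) : PVx fun w e => (D w).dec (f w e) where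
  a := ((hf.div hD.F).div hD.M).mod (.const 10)
  t := ((hf.div hD.F).div hD.M).div (.const 10)
  i := (hf.div hD.F).mod hD.M
  f := hf.mod hD.F

theorem enc (hx : PVx x) : PComp fun w e => (D w).enc (x w e) :=
  ((((hx.t.mul (.const 10)).add hx.a).mul hD.M).add hx.i).mul hD.F |>.add hx.f

theorem act {f g : List ℕ → (ℕ → ℕ) → ℕ} (hf : PComp f) (hg : PComp g) :
    PDec fun w e => (D w).Act (f w e) (g w e) :=
  ((PDec.lt hg (.const 4)).and (.lt (hf.add hD.N) hD.T)).or
    ((PDec.le (.const 4) hg).and (.le hD.N hf))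

omit hD in
theorem itemOk {f g : List ℕ → (ℕ → ℕ) → ℕ} (hf : PComp f) (hg : PComp g) :
    PDec fun w e => ItemOk (f w e) (g w e) := by
  have hf' : ∀ k, PDec fun w e => f w e = k := fun k => .eq hf (.const k)
  have hg' : ∀ k, PDec fun w e => g w e = k := fun k => .eq hg (.const k)
  exact ((hf' 0).and ((hg' 0).or ((hg' 3).or (hg' 4)))).or
    (((hf' 1).and ((hg' 1).or (hg' 4))).or
    (((hf' 2).and ((hg' 1).or (hg' 3))).or
    (((hf' 3).and ((hg' 0).or (hg' 2))).or
    (((hf' 4).and ((hg' 1).or ((hg' 2).or (hg' 4)))).or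
    (((hf' 5).and (hg' 4)).or
    (((hf' 6).and ((hg' 1).or (hg' 3))).or
    ((hf' 7).and ((hg' 0).or ((hg' 2).or ((hg' 3).or (hg' 4)))))))))))

theorem clamp (hx : PVx x) (hy : PVx y) : PDec fun w e => (D w).Clamp (x w e) (y w e) := by
  have xa : ∀ k, PDec fun w e => (x w e).a = k := fun k => .eq hx.a (.const k)
  have ya : ∀ k, PDec fun w e => (y w e).a = k := fun k => .eq hy.a (.const k)
  have xi := hx.i
  have yi := hy.i
  have xt := hx.t
  have yt := hy.t
  have yx : PDec fun w e => (y w e).t = (x w e).t := .eq yt xt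
  have x0 : PDec fun w e => (x w e).i = 0 := .eq xi (.const 0)
  have y0 : PDec fun w e => (y w e).i = 0 := .eq yi (.const 0)
  have hj : PDec fun w e => (y w e).t < (D w).J := .lt yt hD.J
  have hj' : PDec fun w e => (x w e).t < (D w).J := .lt xt hD.J
  have hk : PDec fun w e => (x w e).i < (D w).K₁ := .lt xi hD.K₁
  have hc : PDec fun w e => (y w e).i < (D w).K₂ := .lt yi hD.K₂
  have hA := hD.act yt (yi.mod (.const 8))
  have h20 : PDec fun w e => (x w e).i < 20 := .lt xi (.const 20)
  have h32 : PDec fun w e => (y w e).i < 32 := .lt yi (.const 32)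
  exact (PDec.eq hx.f (.const 0)).and <|
    ((xa 2).and (h20.and ((ya 3).and ((PDec.eq yi (xi.div (.const 5))).and yx)))).or <|
    ((xa 2).and (h20.and ((ya 5).and (h32.and ((PDec.eq (yi.div (.const 8)) (xi.div (.const 5))).and
      (yx.and (hA.and (itemOk (yi.mod (.const 8)) (xi.mod (.const 5))).not))))))).or <|
    ((xa 4).and ((PDec.eq xi (yi.mod (.const 8))).and ((ya 5).and (h32.and (yx.and hA))))).or <|
    ((xa 0).and ((PDec.eq xt (.const 0)).and (x0.and ((ya 7).and (y0.and hj))))).or <|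
    ((xa 9).and (hk.and (hj'.and ((ya 6).and (y0.and yx))))).or <|
    ((xa 9).and (hk.and (hj'.and ((ya 7).and (y0.and (yx.and (hD.bad.comp₂ xt xi))))))).or <|
    ((xa 9).and (hk.and (hj'.and ((ya 8).and (hc.and (yx.and (hD.clash.comp₂ yi xi))))))).or <|
    ((xa 2).and ((PDec.eq xi (yi.mod (.const 5))).and ((ya 8).and (hc.and (hj.and
      (PDec.eq xt ((yt.mul hD.N).add (hD.row.comp₂ yt yi))))))))

theorem thin (hx : PVx x) (hy : PVx y) : PDec fun w e => (D w).Thin (x w e) (y w e) := by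
  have xa : ∀ k, PDec fun w e => (x w e).a = k := fun k => .eq hx.a (.const k)
  have ya : ∀ k, PDec fun w e => (y w e).a = k := fun k => .eq hy.a (.const k)
  have xi : ∀ k, PDec fun w e => (x w e).i = k := fun k => .eq hx.i (.const k)
  have yi : ∀ k, PDec fun w e => (y w e).i = k := fun k => .eq hy.i (.const k)
  have xf : PDec fun w e => (x w e).f = 0 := .eq hx.f (.const 0)
  have yf : PDec fun w e => (y w e).f = 0 := .eq hy.f (.const 0)
  have xt := hx.t
  have yt := hy.t
  exact ((xa 0).and ((PDec.eq xt (.const 0)).and ((xi 0).and (xf.and ((ya 4).and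
      (((yi 0).or (yi 4)).and (yf.and (hD.act yt hy.i)))))))).or <|
    ((xa 4).and ((ya 4).and ((PDec.eq xt yt).and (xf.and (yf.and
      ((((xi 0).and (yi 1)).or ((xi 4).and (yi 5))).and (hD.act xt hx.i))))))).or <|
    ((xa 4).and (xf.and ((ya 1).and ((yi 0).and ((PDec.lt hy.f (.const 2)).and
      ((((xi 0).and (.eq xt yt)).or ((xi 4).and (.eq xt (yt.add hD.N)))).and
      (.lt (yt.add hD.N) hD.T))))))).or <|
    (xa 1).and ((xi 0).and ((PDec.lt hx.f (.const 2)).and ((ya 4).and (yf.and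
      (((((yi 1).or (yi 2)).and (.eq yt xt)).or (((yi 5).or (yi 6)).and
      (.eq yt (xt.add hD.N)))).and (.lt (xt.add hD.N) hD.T))))))

theorem inBag {f : List ℕ → (ℕ → ℕ) → ℕ} (hf : PComp f) (hx : PVx x) :
    PDec fun w e => (D w).InBag (f w e) (x w e) := by
  have xa : ∀ k, PDec fun w e => (x w e).a = k := fun k => .eq hx.a (.const k)
  have x0 : PDec fun w e => (x w e).i = 0 := .eq hx.i (.const 0)
  exact ((xa 0).and ((PDec.eq hx.t (.const 0)).and (x0.and (.lt hx.f (.const 2))))).or <|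
    (PDec.eq hx.f (.const 0)).and <|
    ((xa 1).and (x0.and ((PDec.le hx.t hf).and (.le hf (hx.t.add hD.N))))).or <|
    ((PDec.le (.const 2) hx.a).and ((PDec.lt hx.a (.const 6)).and (.eq hx.t hf))).or <|
    (PDec.le (.const 6) hx.a).and (.eq hx.t (hf.div hD.N))

omit hD in
theorem vx (a t i f : ℕ) : PVx fun _ _ => ⟨a, t, i, f⟩ := ⟨.const a, .const t, .const i, .const f⟩

open Classical in
/-- The instance of Feedback Vertex Set can be written in polynomial time. -/
theorem encode : PGen fun w _ => (D w).inst.encode := by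
  simp only [encode_inst]
  have hr : PComp fun w _ => (D w).enc ⟨0, 0, 0, 0⟩ := hD.enc (vx 0 0 0 0)
  have hr' : PComp fun w _ => (D w).enc ⟨7, 0, 0, 0⟩ := hD.enc (vx 7 0 0 0)
  have v0 := PComp.var 0
  have v1 := PComp.var 1
  have hE : PDec fun w e => (D w).E ((D w).dec (e 1)) ((D w).dec (e 0)) :=
    (hD.clamp (hD.dec v1) (hD.dec v0)).or (hD.thin (hD.dec v1) (hD.dec v0))
  have hB : PDec fun w e => (D w).InBag (e 1) ((D w).dec (e 0)) := hD.inBag v1 (hD.dec v0)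
  have h1 := PGen.flatMap hD.n (.flatMap hD.n ((PGen.emit (hE.ite v1 hr)).append
    (.emit (hE.ite v0 hr'))))
  have h2 := PGen.flatMap hD.T ((PGen.emit hD.n).append
    (.flatMap hD.n (PGen.emit (hB.ite v0 hr))))
  exact (((((PGen.emit hD.n).append (.flatMap hD.n (.emit (.const 1)))).append
    (.emit hD.budget)).append (.emit (hD.n.mul hD.n))).append h1).append (.emit hD.T) |>.append h2

end PCSP

end SelCSP

/-! ### Satisfiability as a constraint satisfaction problem -/

theorem Nat.iterate_div (b k x : ℕ) : (fun x => x / b)^[k] x = x / b ^ k := by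
  induction k with
  | zero => simp
  | succ k ih => rw [Function.iterate_succ_apply', ih, Nat.div_div_eq_div_mul, pow_succ]

theorem Nat.sum_digits (b x k : ℕ) : ∑ i ∈ Finset.range k, x / b ^ i % b * b ^ i = x % b ^ k := by
  induction k with
  | zero => simp [Nat.mod_one]
  | succ k ih => rw [Finset.sum_range_succ, ih, Nat.mod_pow_succ, mul_comm]

/-- A monotone process with few values is constant for some time. -/
theorem exists_forall_eq_of_mono {N m : ℕ} {st : ℕ → ℕ}
    (h5 : ∀ t < N * ((4 * N + 2) * (m + 1)), st t < 5)
    (hmono : ∀ t, t + N < N * ((4 * N + 2) * (m + 1)) → st t ≤ st (t + N)) :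
    ∃ r < 4 * N + 2, ∀ c ≤ m, ∀ i < N,
      st ((r * (m + 1) + c) * N + i) = st (r * (m + 1) * N + i) := by
  have hlt : ∀ j < (4 * N + 2) * (m + 1), ∀ i < N, j * N + i < N * ((4 * N + 2) * (m + 1)) :=
    fun j hj i hi => by
      calc j * N + i < (j + 1) * N := by rw [add_mul, one_mul]; omega
        _ ≤ (4 * N + 2) * (m + 1) * N := Nat.mul_le_mul_right _ hj
        _ = _ := mul_comm _ _
  have hcol : ∀ i < N, ∀ j k, j + k < (4 * N + 2) * (m + 1) →
      st (j * N + i) ≤ st ((j + k) * N + i) := fun i hi j k => by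
    induction k with
    | zero => exact fun _ => le_rfl
    | succ k ih =>
      intro hk
      refine (ih (by omega)).trans ((hmono _ ?_).trans (le_of_eq (congrArg _ (by ring))))
      calc (j + k) * N + i + N = (j + (k + 1)) * N + i := by ring
        _ < _ := hlt _ hk i hi
  have hrep : ∀ r, r + 1 < 4 * N + 2 → (r + 1) * (m + 1) < (4 * N + 2) * (m + 1) := fun r hr =>
    Nat.mul_lt_mul_of_pos_right hr (by omega)
  by_contra! hcon
  -- otherwise the sum over a column grows by one from each repetition to the next
  have hsum : ∀ r < 4 * N + 2, r ≤ ∑ i ∈ Finset.range N, st (r * (m + 1) * N + i) := fun r => by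
    induction r with
    | zero => exact fun _ => Nat.zero_le _
    | succ r ih =>
      intro hr
      refine (ih (by omega)).trans_lt ?_
      obtain ⟨c, hc, i, hi, hne⟩ := hcon r (by omega)
      have hr' := hrep r hr
      have e : r * (m + 1) + (m + 1) = (r + 1) * (m + 1) := by ring
      refine Finset.sum_lt_sum (fun i hi => ?_) ⟨i, Finset.mem_range.2 hi, ?_⟩
      · have := hcol i (Finset.mem_range.1 hi) (r * (m + 1)) (m + 1) (by omega)
        rwa [e] at this
      · have h1 := hcol i hi (r * (m + 1)) c (by omega)
        have h2 := hcol i hi (r * (m + 1) + c) (m + 1 - c) (by omega)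
        rw [show r * (m + 1) + c + (m + 1 - c) = (r + 1) * (m + 1) by omega] at h2
        omega
  have h1 := hsum (4 * N + 1) (by omega)
  have h2 : ∑ i ∈ Finset.range N, st ((4 * N + 1) * (m + 1) * N + i) ≤ N * 4 := by
    refine (Finset.sum_le_card_nsmul _ _ 4 fun i hi => ?_).trans (by simp)
    have := h5 _ (hlt ((4 * N + 1) * (m + 1)) (Nat.mul_lt_mul_of_pos_right (by omega) (by omega)) i
      (Finset.mem_range.1 hi))
    omega
  omega

/-- The formula has `n` variables and `m` clauses with at most `q` literals each; `len c` is the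
length of the clause `c`, and `lit c l` is the code of its literal `l`. Each `p` consecutive
variables are represented by `g` variables with the values `0, ..., 4`. There are `m + 1`
constraints, and all of them are repeated `4 * N + 2` times: one constraint for each clause, and an
additional one that is easy to satisfy.

A choice is a number `l * 5 ^ g + τ`, where `l` is a literal of the clause and `τ` encodes the values
of the variables that represent the variable of this literal; the choices with `l = q + 1` are always
bad. -/
def satCSP (p g q : ℕ) (hg : 0 < g) (n m : ℕ) (len : ℕ → ℕ) (lit : ℕ → ℕ → ℕ) : SelCSP where
  N := g * (n / p + 1)
  J := (4 * (g * (n / p + 1)) + 2) * (m + 1)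
  K₁ := (q + 2) * 5 ^ g
  K₂ := 5 * ((q + 2) * g)
  row j c := g * (if j % (m + 1) < m ∧ c / 5 / g < len (j % (m + 1)) then
    lit (j % (m + 1)) (c / 5 / g) / 2 / p else 0) + c / 5 % g
  bad j κ := ¬ (κ / 5 ^ g ≤ q ∧ (j % (m + 1) < m → κ / 5 ^ g < len (j % (m + 1)) ∧
    κ % 5 ^ g / 2 ^ (lit (j % (m + 1)) (κ / 5 ^ g) / 2 % p) % 2 =
      lit (j % (m + 1)) (κ / 5 ^ g) % 2))
  clash c κ := c / 5 / g = κ / 5 ^ g ∧ κ % 5 ^ g / 5 ^ (c / 5 % g) % 5 ≠ c % 5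
  N_pos := by positivity
  J_pos := by positivity

namespace SelCSP

variable {p g q n m : ℕ} {hg : 0 < g} {len : ℕ → ℕ} {lit : ℕ → ℕ → ℕ}

theorem proper_satCSP (hlit : ∀ c < m, ∀ l < len c, lit c l / 2 < n) :
    (satCSP p g q hg n m len lit).Proper := by
  have h5 : 0 < 5 ^ g := by positivity
  constructor
  · intro j _ c hc
    simp only [satCSP] at hc ⊢
    have h1 : c / 5 % g < g := Nat.mod_lt _ hg
    have h2 : (if j % (m + 1) < m ∧ c / 5 / g < len (j % (m + 1)) then
        lit (j % (m + 1)) (c / 5 / g) / 2 / p else 0) ≤ n / p := by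
      split_ifs with h
      · exact Nat.div_le_div_right (hlit _ h.1 _ h.2).le
      · exact Nat.zero_le _
    calc _ < g * _ + g := Nat.add_lt_add_left h1 _
      _ ≤ g * (n / p) + g := Nat.add_le_add_right (Nat.mul_le_mul_left _ h2) _
      _ = _ := by ring
  · intro j _
    refine ⟨(q + 1) * 5 ^ g, Nat.mul_lt_mul_of_pos_right (by omega) h5, fun h => ?_⟩
    have := h.1
    rw [Nat.mul_div_cancel _ h5] at this
    omega
  · intro c hc
    simp only [satCSP] at hc ⊢
    have hl : c / 5 / g < q + 2 := by
      rw [Nat.div_lt_iff_lt_mul hg, Nat.div_lt_iff_lt_mul (by omega)]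
      omega
    have hi : c / 5 % g < g := Nat.mod_lt _ hg
    obtain ⟨t, ht, hne⟩ : ∃ t < 2, t ≠ c % 5 := by
      by_cases h : c % 5 = 0
      exacts [⟨1, by omega, by omega⟩, ⟨0, by omega, by omega⟩]
    have hlt : t * 5 ^ (c / 5 % g) < 5 ^ g :=
      calc t * 5 ^ (c / 5 % g) < 5 * 5 ^ (c / 5 % g) :=
            Nat.mul_lt_mul_of_pos_right (by omega) (by positivity)
        _ = 5 ^ (c / 5 % g + 1) := by ring
        _ ≤ 5 ^ g := Nat.pow_le_pow_right (by omega) hi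
    refine ⟨5 ^ g * (c / 5 / g) + t * 5 ^ (c / 5 % g), ?_, ?_, ?_⟩
    · calc _ < 5 ^ g * (c / 5 / g) + 5 ^ g := by omega
        _ = (c / 5 / g + 1) * 5 ^ g := by ring
        _ ≤ _ := Nat.mul_le_mul_right _ hl
    · rw [Nat.mul_add_div h5, Nat.div_eq_of_lt hlt, add_zero]
    · rw [Nat.mul_add_mod, Nat.mod_eq_of_lt hlt, Nat.mul_div_cancel _ (by positivity)]
      rwa [Nat.mod_eq_of_lt (by omega)]

theorem hasSolution_satCSP (hp : 0 < p) (hpg : 2 ^ p ≤ 5 ^ g)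
    (hlit : ∀ c < m, ∀ l < len c, lit c l / 2 < n) (hlen : ∀ c < m, len c ≤ q) (A : ℕ → Bool)
    (hA : ∀ c < m, ∃ l < len c, A (lit c l / 2) = decide (lit c l % 2 = 1)) :
    (satCSP p g q hg n m len lit).inst.HasSolution := by
  have h5 : 0 < 5 ^ g := by positivity
  let τ : ℕ → ℕ := fun G => Nat.ofBits fun k : Fin p => A (G * p + k)
  have hτ : ∀ G, τ G < 5 ^ g := fun G => (Nat.ofBits_lt_two_pow _).trans_le hpg
  have hbit : ∀ v b, A v = decide (b % 2 = 1) → τ (v / p) / 2 ^ (v % p) % 2 = b % 2 := fun v b h => by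
    have h1 := Nat.testBit_ofBits_lt (fun k : Fin p => A (v / p * p + k)) (v % p) (Nat.mod_lt _ hp)
    rw [Nat.testBit_eq_decide_div_mod_eq] at h1
    simp only [Nat.div_add_mod', h, decide_eq_decide] at h1
    change τ (v / p) / 2 ^ (v % p) % 2 = 1 ↔ _ at h1
    omega
  refine hasSolution_of_holds (σ := fun r => τ (r / g) / 5 ^ (r % g) % 5) (proper_satCSP hlit).row_lt
    (fun i _ => Nat.mod_lt _ (by omega)) fun j _ => ?_
  have key : ∃ l ≤ q, j % (m + 1) < m → l < len (j % (m + 1)) ∧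
      A (lit (j % (m + 1)) l / 2) = decide (lit (j % (m + 1)) l % 2 = 1) := by
    by_cases h : j % (m + 1) < m
    · obtain ⟨l, hl, h'⟩ := hA _ h
      exact ⟨l, hl.le.trans (hlen _ h), fun _ => ⟨hl, h'⟩⟩
    · exact ⟨0, Nat.zero_le _, fun h' => absurd h' h⟩
  obtain ⟨l, hl, hj⟩ := key
  let G := if j % (m + 1) < m ∧ l < len (j % (m + 1)) then lit (j % (m + 1)) l / 2 / p else 0
  have e1 : (5 ^ g * l + τ G) / 5 ^ g = l := by
    rw [Nat.mul_add_div h5, Nat.div_eq_of_lt (hτ _), add_zero]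
  have e2 : (5 ^ g * l + τ G) % 5 ^ g = τ G := by
    rw [Nat.mul_add_mod, Nat.mod_eq_of_lt (hτ _)]
  refine ⟨5 ^ g * l + τ G, ?_, ?_, fun c _ h => ?_⟩
  · calc 5 ^ g * l + τ G < 5 ^ g * l + 5 ^ g := Nat.add_lt_add_left (hτ _) _
      _ = (l + 1) * 5 ^ g := by ring
      _ ≤ _ := Nat.mul_le_mul_right _ (by omega)
  · simp only [satCSP, not_not, e1, e2]
    refine ⟨hl, fun h => ⟨(hj h).1, ?_⟩⟩
    simp only [G, h, (hj h).1, and_self, if_true]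
    exact hbit _ _ (hj h).2
  · simp only [satCSP, e1, e2] at h ⊢
    obtain ⟨rfl, h⟩ := h
    rwa [Nat.mul_add_div hg, Nat.mul_add_mod, Nat.mod_mod, Nat.div_eq_of_lt (Nat.mod_lt _ hg),
      add_zero]

theorem exists_assignment
    (hlit : ∀ c < m, ∀ l < len c, lit c l / 2 < n)
    (h : (satCSP p g q hg n m len lit).inst.HasSolution) :
    ∃ A : ℕ → Bool, ∀ c < m, ∃ l < len c, A (lit c l / 2) = decide (lit c l % 2 = 1) := by
  have h5 : 0 < 5 ^ g := by positivity
  have hD := proper_satCSP (p := p) (q := q) (hg := hg) hlit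
  obtain ⟨X, hX, hac⟩ := h
  obtain ⟨st, hst5, hmono, hst⟩ := exists_states (D := satCSP p g q hg n m len lit) (X := X)
    ((Finset.card_eq_sum_ones X).le.trans hX) hac hD.row_lt
    (show 0 < (q + 2) * 5 ^ g by positivity)
  obtain ⟨r, hr, hconst⟩ := exists_forall_eq_of_mono (m := m)
    hst5 hmono
  set N := (satCSP p g q hg n m len lit).N with hN
  let σ : ℕ → ℕ := fun i => st (r * (m + 1) * N + i)
  refine ⟨fun v => decide ((∑ i ∈ Finset.range g, σ (g * (v / p) + i) * 5 ^ i) / 2 ^ (v % p) % 2 = 1),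
    fun c hc => ?_⟩
  have hj : r * (m + 1) + c < (satCSP p g q hg n m len lit).J :=
    calc r * (m + 1) + c < (r + 1) * (m + 1) := by rw [add_mul r, one_mul]; omega
      _ ≤ _ := Nat.mul_le_mul_right _ hr
  have hmod : (r * (m + 1) + c) % (m + 1) = c := Nat.mul_add_mod_of_lt (by omega)
  obtain ⟨κ, hκ, hgood, hclash⟩ := hst _ hj
  have hrow : ∀ b i, b ≤ n / p → i < g → g * b + i < N := fun b i hb hi =>
    calc g * b + i < g * (b + 1) := by rw [mul_add, mul_one]; omega
      _ ≤ _ := Nat.mul_le_mul_left _ (by omega)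
  simp only [satCSP, not_not, hmod] at hgood
  obtain ⟨hl, hgood⟩ := hgood.2 hc
  refine ⟨κ / 5 ^ g, hl, ?_⟩
  set v := lit c (κ / 5 ^ g) / 2 with hv
  have hvp : v / p ≤ n / p := Nat.div_le_div_right (hlit c hc _ hl).le
  have hdig : ∀ i < g, σ (g * (v / p) + i) = κ % 5 ^ g / 5 ^ i % 5 := fun i hi => by
    have hN' := hrow _ _ hvp hi
    have hs : σ (g * (v / p) + i) < 5 := hst5 _ <| by
      calc r * (m + 1) * N + (g * (v / p) + i) < (r * (m + 1) + 1) * N := by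
            rw [add_mul _ 1, one_mul]; omega
        _ ≤ (satCSP p g q hg n m len lit).J * N := Nat.mul_le_mul_right _ (by omega)
        _ = _ := mul_comm _ _
    by_contra hne
    have hκl : κ / 5 ^ g < q + 2 := by rwa [Nat.div_lt_iff_lt_mul h5]
    have e1 : ((κ / 5 ^ g * g + i) * 5 + σ (g * (v / p) + i)) / 5 = κ / 5 ^ g * g + i := by
      omega
    have e2 : (κ / 5 ^ g * g + i) / g = κ / 5 ^ g := by
      rw [mul_comm, Nat.mul_add_div hg, Nat.div_eq_of_lt hi, add_zero]
    have e3 : (κ / 5 ^ g * g + i) % g = i := by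
      rw [Nat.mul_add_mod_of_lt hi]
    have e4 : ((κ / 5 ^ g * g + i) * 5 + σ (g * (v / p) + i)) % 5 = σ (g * (v / p) + i) := by
      omega
    refine hclash ((κ / 5 ^ g * g + i) * 5 + σ (g * (v / p) + i)) ?_ ?_ ?_
    · calc (κ / 5 ^ g * g + i) * 5 + σ (g * (v / p) + i) < 5 * (κ / 5 ^ g * g + i + 1) := by omega
        _ ≤ 5 * ((κ / 5 ^ g + 1) * g) := Nat.mul_le_mul_left _ (by rw [add_mul _ 1]; omega)
        _ ≤ _ := Nat.mul_le_mul_left _ (Nat.mul_le_mul_right _ hκl)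
    · simp only [satCSP, e1, e2, e3, e4]
      exact ⟨trivial, fun h => hne h.symm⟩
    · simp only [satCSP, e1, e2, e3, e4, hmod]
      rw [if_pos ⟨hc, hl⟩]
      exact hconst c hc.le _ hN'
  have hsum : ∑ i ∈ Finset.range g, σ (g * (v / p) + i) * 5 ^ i = κ % 5 ^ g := by
    rw [← Nat.mod_mod κ, ← Nat.sum_digits]
    exact Finset.sum_congr rfl fun i hi => by rw [hdig i (Finset.mem_range.1 hi)]
  simp only [hsum, hgood]

end SelCSP

/-! ### Reading the formula -/

open RAM

/-- The position of the clause `c` in the encoding `w` of a formula. -/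
def clausePos (w : List ℕ) (c : ℕ) : ℕ := (fun x => x + 1 + w.getD x 0)^[c] 2

theorem RAM.PComp.div_pow {f k : List ℕ → (ℕ → ℕ) → ℕ} (hf : PComp f) (b : ℕ) (hk : PComp k) :
    PComp fun w e => f w e / b ^ k w e := by
  obtain ⟨V, hV, hfV⟩ := hf.1
  have := PComp.iterate hk hf ((PComp.var 0).div (.const b)) hV fun w e B hw he k _ => by
    simp only [push_zero, Nat.iterate_div]
    exact (Nat.div_le_self _ _).trans (hfV w e B hw he)
  simpa only [push_zero, Nat.iterate_div] using this

theorem pComp_clausePos {f : List ℕ → (ℕ → ℕ) → ℕ} (hf : PComp f) :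
    PComp fun w e => clausePos w (f w e) := by
  obtain ⟨V, hV, hfV⟩ := hf.1
  have := PComp.iterate hf (.const 2) (((PComp.var 0).add (.const 1)).add (.read (.var 0)))
    ((PolyBd.const 2).add (hV.mul (PolyBd.id.add (.const 1)))) fun w e B hw he k hk => by
    simp only [push_zero]
    have h1 : (fun x => x + 1 + w.getD x 0)^[k] 2 ≤ 2 + k * (B + 1) := by
      clear hk
      induction k with
      | zero => simp
      | succ k ih =>
        rw [Function.iterate_succ_apply']
        have := hw.getD ((fun x => x + 1 + w.getD x 0)^[k] 2)
        rw [add_mul, one_mul]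
        omega
    exact h1.trans (Nat.add_le_add_left (Nat.mul_le_mul_right _ (hk.trans (hfV w e B hw he))) _)
  simp only [push_zero] at this
  exact this

/-- The constraint satisfaction problem for the formula with the encoding `w`. -/
def wordCSP (p g q : ℕ) (hg : 0 < g) (w : List ℕ) : SelCSP :=
  satCSP p g q hg (w.getD 0 0) (w.getD 1 0) (fun c => w.getD (clausePos w c) 0)
    fun c l => w.getD (clausePos w c + 1 + l) 0

theorem pCSP_wordCSP (p g q : ℕ) (hg : 0 < g) : SelCSP.PCSP (wordCSP p g q hg) := by
  have hn : PComp fun w _ => w.getD 0 0 := .read (.const 0)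
  have hm : PComp fun w _ => w.getD 1 0 := .read (.const 1)
  have hN : PComp fun w _ => g * (w.getD 0 0 / p + 1) :=
    (PComp.const g).mul ((hn.div (.const p)).add (.const 1))
  have v0 := PComp.var 0
  have v1 := PComp.var 1
  have hlen : ∀ {f}, PComp f → PComp fun w e => w.getD (clausePos w (f w e)) 0 := fun hf =>
    .read (pComp_clausePos hf)
  have hlit : ∀ {f l}, PComp f → PComp l →
      PComp fun w e => w.getD (clausePos w (f w e) + 1 + l w e) 0 := fun hf hl =>
    .read (((pComp_clausePos hf).add (.const 1)).add hl)
  have hc := v0.mod (hm.add (.const 1))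
  have hi := v1.div (.const 5)
  have hl := v1.div (.const (5 ^ g))
  have hτ := v1.mod (.const (5 ^ g))
  refine ⟨hN, (((PComp.const 4).mul hN).add (.const 2)).mul (hm.add (.const 1)), .const _, .const _,
    ?_, ?_, ?_⟩
  · exact ((PComp.const g).mul (((PDec.lt hc hm).and (.lt (hi.div (.const g)) (hlen hc))).ite
      (((hlit hc (hi.div (.const g))).div (.const 2)).div (.const p)) (.const 0))).add
      (hi.mod (.const g))
  · exact ((PDec.le hl (.const q)).and ((PDec.lt hc hm).imp ((PDec.lt hl (hlen hc)).and
      (.eq ((hτ.div_pow 2 (((hlit hc hl).div (.const 2)).mod (.const p))).mod (.const 2))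
      ((hlit hc hl).mod (.const 2)))))).not
  · exact (PDec.eq ((v0.div (.const 5)).div (.const g)) hl).and
      (PDec.eq ((hτ.div_pow 5 ((v0.div (.const 5)).mod (.const g))).mod (.const 5))
      (v0.mod (.const 5))).not

theorem List.getD_add_eq (w : List ℕ) (a k : ℕ) : w.getD (a + k) 0 = (w.drop a).getD k 0 := by
  simp [List.getD_eq_getElem?_getD]

theorem drop_iterate {w : List ℕ} (c : ℕ) : ∀ {a : ℕ} {L : List (List ℕ)},
    w.drop a = L.flatMap (fun l => l.length :: l) → c ≤ L.length →
    w.drop ((fun x => x + 1 + w.getD x 0)^[c] a) = (L.drop c).flatMap fun l => l.length :: l := by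
  induction c with
  | zero => exact fun h _ => h
  | succ c ih =>
    intro a L h hc
    obtain _ | ⟨l, L⟩ := L
    · simp at hc
    · rw [Function.iterate_succ_apply, List.drop_succ_cons]
      refine ih ?_ (by simpa using hc)
      have h0 : w.getD a 0 = l.length := by
        have := List.getD_add_eq w a 0
        rw [h] at this
        simpa using this
      rw [h0, add_assoc, ← List.drop_drop, h]
      simp [Nat.add_comm 1]

namespace CNF

/-- The code of a literal. -/
def code {n : ℕ} (l : Fin n × Bool) : ℕ := 2 * l.1.val + (if l.2 then 1 else 0)

theorem code_div {n : ℕ} (l : Fin n × Bool) : code l / 2 = l.1 := by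
  simp only [code]; split_ifs <;> omega

theorem code_mod {n : ℕ} (l : Fin n × Bool) : decide (code l % 2 = 1) = l.2 := by
  obtain ⟨v, b⟩ := l
  cases b <;> simp [code]

variable (φ : CNF)

theorem getD_zero : φ.encode.getD 0 0 = φ.n := rfl

theorem drop_clausePos {c : ℕ} (hc : c < φ.clauses.length) : ∃ s,
    φ.encode.drop (clausePos φ.encode c) =
      φ.clauses[c].length :: (φ.clauses[c].map code ++ s) := by
  have h : φ.encode.drop 2 = (φ.clauses.map (List.map code)).flatMap fun l => l.length :: l := by
    simp only [encode, List.flatMap_map, List.length_map]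
    rfl
  have h' := drop_iterate c h (by simpa using hc.le)
  rw [← List.map_drop, List.drop_eq_getElem_cons hc] at h'
  simp only [List.map_cons, List.flatMap_cons, List.length_map] at h'
  exact ⟨_, h'⟩

theorem getD_clausePos {c : ℕ} (hc : c < φ.clauses.length) :
    φ.encode.getD (clausePos φ.encode c) 0 = φ.clauses[c].length := by
  obtain ⟨s, h⟩ := φ.drop_clausePos hc
  have := List.getD_add_eq φ.encode (clausePos φ.encode c) 0
  rw [h] at this
  simpa using this

theorem getD_clausePos_add {c l : ℕ} (hc : c < φ.clauses.length) (hl : l < φ.clauses[c].length) :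
    φ.encode.getD (clausePos φ.encode c + 1 + l) 0 = code φ.clauses[c][l] := by
  obtain ⟨s, h⟩ := φ.drop_clausePos hc
  rw [add_assoc, List.getD_add_eq, h, Nat.add_comm 1]
  simp [List.getD_eq_getElem?_getD, List.getElem?_append_left, hl]

theorem hasSolution_wordCSP {p g q : ℕ} (hg : 0 < g) (hp : 0 < p) (hpg : 2 ^ p ≤ 5 ^ g)
    (hφ : φ.IsQCNF q) : (wordCSP p g q hg φ.encode).Proper ∧
      ((wordCSP p g q hg φ.encode).inst.HasSolution ↔ φ.Satisfiable) := by
  have hlit : ∀ c < φ.clauses.length, ∀ l < φ.encode.getD (clausePos φ.encode c) 0,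
      φ.encode.getD (clausePos φ.encode c + 1 + l) 0 / 2 < φ.n := fun c hc l hl => by
    rw [φ.getD_clausePos hc] at hl
    rw [φ.getD_clausePos_add hc hl, code_div]
    exact (φ.clauses[c][l].1).2
  refine ⟨SelCSP.proper_satCSP hlit, fun h => ?_, ?_⟩
  · obtain ⟨A, hA⟩ := SelCSP.exists_assignment hlit h
    refine ⟨fun v => A v, fun C hC => ?_⟩
    obtain ⟨c, hc, rfl⟩ := List.mem_iff_getElem.1 hC
    obtain ⟨l, hl, h⟩ := hA c hc
    rw [φ.getD_clausePos hc] at hl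
    rw [φ.getD_clausePos_add hc hl, code_div, code_mod] at h
    exact ⟨_, List.getElem_mem hl, h⟩
  · rintro ⟨τ, hτ⟩
    refine SelCSP.hasSolution_satCSP hp hpg hlit (fun c hc => ?_)
      (fun v => if h : v < φ.n then τ ⟨v, h⟩ else false) fun c hc => ?_
    · change c < φ.clauses.length at hc
      rw [φ.getD_clausePos hc]
      exact hφ _ (List.getElem_mem hc)
    · change c < φ.clauses.length at hc
      obtain ⟨x, hx, h⟩ := hτ _ (List.getElem_mem hc)
      obtain ⟨l, hl, rfl⟩ := List.mem_iff_getElem.1 hx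
      refine ⟨l, by rwa [φ.getD_clausePos hc], ?_⟩
      rw [φ.getD_clausePos_add hc hl, code_mod, ← h]
      simp only [code_div, Fin.is_lt, dif_pos]

end CNF

/-! ### Bounds -/

open RAM

theorem PolyBd.pow {T : ℕ → ℕ} (hT : PolyBd T) (k : ℕ) : PolyBd fun B => T B ^ k := by
  induction k with
  | zero => simpa using PolyBd.const 1
  | succ k ih => simpa only [pow_succ] using ih.mul hT

theorem PolyBd.exists_le_pow {T : ℕ → ℕ} (hT : PolyBd T) {r : ℝ} (hr : 1 < r) :
    ∃ C : ℝ, 0 ≤ C ∧ ∀ n : ℕ, (T n : ℝ) ≤ C * r ^ n := by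
  obtain ⟨E, hE⟩ := hT
  have h := (isLittleO_pow_const_const_pow_of_one_lt (R := ℝ) E hr).isBigO
  rw [Asymptotics.isBigO_nat_atTop_iff (fun n hn => absurd hn (by positivity))] at h
  obtain ⟨C, hC⟩ := h
  have hC0 : 0 ≤ C := by
    have := (norm_nonneg _).trans (hC 0)
    simpa using this
  refine ⟨C * r ^ 2, by positivity, fun n => ?_⟩
  have h1 := hC (n + 2)
  have hr0 : 0 < r := by linarith
  rw [Real.norm_of_nonneg (by positivity), Real.norm_of_nonneg (by positivity)] at h1
  calc (T n : ℝ) ≤ ((n + 2 : ℕ) : ℝ) ^ E := by exact_mod_cast hE n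
    _ ≤ _ := h1
    _ = _ := by ring

theorem RAM.Exec.one_le {P : Prog} {s s' : State} {t : ℕ} (h : Exec P s t s') : 1 ≤ t := by
  induction h <;> omega

theorem RAM.inputSize_le {w : List ℕ} {V : ℕ} (h1 : w.length ≤ V) (h2 : ∀ x ∈ w, x ≤ V) :
    inputSize w ≤ V * (V + 1) := by
  refine (List.sum_le_card_nsmul _ (V + 1) fun y hy => ?_).trans ?_
  · obtain ⟨x, hx, rfl⟩ := List.mem_map.1 hy
    exact Nat.add_le_add_right ((size_le_self x).trans (h2 x hx)) 1
  · rw [List.length_map, smul_eq_mul]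
    exact Nat.mul_le_mul_right _ h1

namespace CNF

variable {φ : CNF} {q : ℕ}

/-- The number of clauses is polynomial in the number of variables, since the clauses are pairwise
distinct. -/
theorem length_clauses_le (h : φ.IsQCNF q) : φ.clauses.length ≤ (2 * φ.n + 1) ^ q := by
  classical
  rw [← List.toFinset_card_of_nodup φ.nodup]
  have hc : (Finset.univ : Finset (Fin q → Option (Fin φ.n × Bool))).card = (2 * φ.n + 1) ^ q := by
    simp [mul_comm]
  rw [← hc]
  refine Finset.card_le_card_of_injOn (fun l (i : Fin q) => l[i.1]?) (fun _ _ => Finset.mem_univ _)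
    fun c hc c' hc' e => List.ext_getElem? fun i => ?_
  have h1 := h c (List.mem_toFinset.1 hc)
  have h2 := h c' (List.mem_toFinset.1 hc')
  by_cases hi : i < q
  · exact congrFun e ⟨i, hi⟩
  · rw [List.getElem?_eq_none (by omega), List.getElem?_eq_none (by omega)]

/-- A bound for the length and the letters of the encoding of a formula with `n` variables. -/
def bound (q n : ℕ) : ℕ := (2 * n + 1) ^ q * (q + 1) + (2 * n + q + 2)

theorem polyBd_bound (q : ℕ) : PolyBd (bound q) := by
  have h : PolyBd fun n => 2 * n := (PolyBd.const 2).mul .id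
  exact (((h.add (.const 1)).pow q).mul (.const (q + 1))).add ((h.add (.const q)).add (.const 2))

theorem wb_encode (h : φ.IsQCNF q) : WB φ.encode (bound q φ.n) := by
  have hm := length_clauses_le h
  have hm' : φ.clauses.length * (q + 1) ≤ (2 * φ.n + 1) ^ q * (q + 1) := Nat.mul_le_mul_right _ hm
  constructor
  · have : (φ.clauses.flatMap fun c => c.length :: c.map fun l =>
        2 * l.1.val + (if l.2 then 1 else 0)).length ≤ φ.clauses.length * (q + 1) := by
      rw [List.length_flatMap]
      refine (List.sum_le_card_nsmul _ (q + 1) fun y hy => ?_).trans (by simp)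
      obtain ⟨c, hc, rfl⟩ := List.mem_map.1 hy
      simpa using h c hc
    simp only [encode, List.length_append, List.length_cons, List.length_nil, bound]
    omega
  · intro x hx
    have hm2 : (2 * φ.n + 1) ^ q ≤ (2 * φ.n + 1) ^ q * (q + 1) := Nat.le_mul_of_pos_right _ (by omega)
    simp only [encode, List.mem_append, List.mem_cons, List.not_mem_nil, or_false,
      List.mem_flatMap, List.mem_map] at hx
    simp only [bound]
    obtain (rfl | rfl) | ⟨c, hc, rfl | ⟨l, -, rfl⟩⟩ := hx
    · omega
    · omega
    · have := h c hc
      omega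
    · have := l.1.2
      split_ifs <;> omega

end CNF

/-- If bases below `5` are possible, then a formula with `n` variables is solved by way of an
instance of width `g * (n / p + 1) + O(1)`, where blocks of `p` bits become blocks of `g` digits. -/
theorem exists_block {a : ℝ} (h1 : 1 ≤ a) (h5 : a < 5) : ∃ g p : ℕ, 0 < g ∧ 0 < p ∧ 2 ^ p ≤ 5 ^ g ∧
    ∀ n : ℕ, a ^ (g * (n / p + 1)) ≤ 2 ^ p * (2 : ℝ) ^ ((1 - 1 / p : ℝ) * n) := by
  obtain ⟨g, hg⟩ := exists_pow_lt_of_lt_one (show (0 : ℝ) < 1 / 4 by norm_num)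
    (show a / 5 < 1 by linarith)
  have hg0 : 0 < g := by
    rcases Nat.eq_zero_or_pos g with rfl | h
    · norm_num at hg
    · exact h
  have hne : 5 ^ g ≠ 0 := by positivity
  have hle : 2 ^ Nat.log 2 (5 ^ g) ≤ 5 ^ g := Nat.pow_log_le_self 2 hne
  have hlt : 5 ^ g < 2 ^ (Nat.log 2 (5 ^ g) + 1) := Nat.lt_pow_succ_log_self (by omega) _
  have hp : 0 < Nat.log 2 (5 ^ g) := Nat.log_pos (by omega)
    ((by omega : 2 ≤ 5).trans (Nat.le_self_pow hg0.ne' 5))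
  generalize Nat.log 2 (5 ^ g) = p at hle hlt hp
  refine ⟨g, p, hg0, hp, hle, fun n => ?_⟩
  have ha : a ^ g ≤ (2 : ℝ) ^ (p - 1 : ℝ) := by
    rw [div_pow, div_lt_iff₀ (by positivity)] at hg
    have : (5 : ℝ) ^ g < 2 ^ (p + 1) := by exact_mod_cast hlt
    rw [pow_succ] at this
    rw [Real.rpow_sub_one (by norm_num), Real.rpow_natCast]
    linarith
  have hp' : (0 : ℝ) < p := by exact_mod_cast hp
  have hp1 : (1 : ℝ) ≤ p := by exact_mod_cast hp
  have hdiv : ((n / p : ℕ) : ℝ) ≤ n / p := Nat.cast_div_le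
  calc a ^ (g * (n / p + 1)) = (a ^ g) ^ (n / p + 1) := pow_mul _ _ _
    _ ≤ ((2 : ℝ) ^ (p - 1 : ℝ)) ^ (n / p + 1) := pow_le_pow_left₀ (by positivity) ha _
    _ = (2 : ℝ) ^ ((p - 1 : ℝ) * ((n / p : ℕ) + 1)) := by
      rw [← Real.rpow_mul_natCast (by norm_num)]
      push_cast
      rfl
    _ ≤ (2 : ℝ) ^ ((p : ℝ) + (1 - 1 / p : ℝ) * n) := by
      refine Real.rpow_le_rpow_of_exponent_le (by norm_num) ?_
      have e : (1 - 1 / p : ℝ) * n = (p - 1) * (n / p) := by field_simp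
      rw [e]
      have := mul_le_mul_of_nonneg_left hdiv (by linarith : (0 : ℝ) ≤ p - 1)
      linarith
    _ = _ := by rw [Real.rpow_add (by norm_num), Real.rpow_natCast]

/-- An instance of width `1`: an edge, whose ends are twins, and an isolated vertex. -/
def pathInstance : FVSInstance where
  n := 3
  edges := [(0, 1)]
  edges_ne := by simp
  cost := fun _ => 1
  cost_pos := fun _ => one_pos
  budget := 0
  bags := [[0, 1, 2]]

theorem pathInstance_givenWidth : pathInstance.GivenWidth 1 := by
  have hG : ∀ u v : Fin 3, pathInstance.graph.Adj u v ↔ (u = 0 ∧ v = 1) ∨ (u = 1 ∧ v = 0) := by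
    have h : ∀ u v : Fin 3, (u ≠ v ∧ ((u, v) ∈ [((0 : Fin 3), (1 : Fin 3))] ∨
        (v, u) ∈ [((0 : Fin 3), (1 : Fin 3))])) ↔ (u = 0 ∧ v = 1) ∨ (u = 1 ∧ v = 0) := by decide
    exact h
  have hcases : ∀ u : Fin 3, u = 0 ∨ u = 1 ∨ u = 2 := by decide
  have hmem : ∀ (t : Fin 1) (a : Quotient (twinclasses pathInstance.graph)),
      a ∈ pathInstance.quotientBags t := fun t a => by
    have h : ∀ (t : Fin 1) (u : Fin 3), u ∈ [[(0 : Fin 3), 1, 2]].get t := by decide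
    obtain ⟨u, rfl⟩ := Quotient.exists_rep a
    exact ⟨u, h t u, rfl⟩
  have h01 : (Quotient.mk (twinclasses pathInstance.graph) (0 : Fin 3)) =
      Quotient.mk (twinclasses pathInstance.graph) (1 : Fin 3) := by
    refine Quotient.sound ((twins_iff_forall _ _ _).2 fun (w : Fin 3) h0 h1 =>
      (hG _ _).trans (Iff.trans ?_ (hG _ _).symm))
    rcases hcases w with rfl | rfl | rfl
    exacts [absurd rfl h0, absurd rfl h1, by decide]
  have h02 : (Quotient.mk (twinclasses pathInstance.graph) (0 : Fin 3)) ≠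
      Quotient.mk (twinclasses pathInstance.graph) (2 : Fin 3) := fun h => by
    have h := (twins_iff_forall _ _ _).1 (Quotient.exact h) (1 : Fin 3)
      (by decide : (1 : Fin 3) ≠ 0) (by decide : (1 : Fin 3) ≠ 2)
    have h' := (hG _ _).symm.trans (h.trans (hG _ _))
    revert h'
    decide
  have huniv : ∀ t : Fin 1, (pathInstance.quotientBags t).ncard = 2 := fun t => by
    rw [Set.ncard_eq_two]
    refine ⟨_, _, h02, Set.ext fun a => iff_of_true (hmem t a) ?_⟩
    obtain ⟨u, rfl⟩ := Quotient.exists_rep a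
    rcases hcases u with rfl | rfl | rfl
    exacts [Or.inl rfl, Or.inl h01.symm, Or.inr rfl]
  exact ⟨⟨fun a => ⟨(0 : Fin 1), hmem _ a⟩, fun a b _ => ⟨(0 : Fin 1), hmem _ a, hmem _ b⟩,
    fun a _ j _ _ _ _ _ => hmem j a⟩, fun t => (huniv t).le, (0 : Fin 1), huniv 0⟩

/-! ### The reduction -/

open RAM

theorem add_le_of_le_mul {t t' c c₁ c₂ u v A X Y Z : ℝ} (h₁ : t' ≤ c₁ * X) (h : t ≤ c * u * v)
    (hu : u ≤ A * Y) (hv : v ≤ c₂ * Z) (hYZ : Y * Z = X) (hc : 0 ≤ c) (hv0 : 0 ≤ v) (hA : 0 ≤ A)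
    (hY : 0 ≤ Y) : t' + t ≤ (c₁ + c * A * c₂) * X :=
  calc t' + t ≤ c₁ * X + c * (A * Y) * (c₂ * Z) := by
        refine add_le_add h₁ (h.trans (mul_le_mul (mul_le_mul_of_nonneg_left hu hc) hv hv0 ?_))
        positivity
    _ = _ := by rw [← hYZ]; ring

/-- The constants `g` and `p` are independent of `q`: larger clauses only add to the width a constant
that depends on `q`. -/
theorem qSatSolvable_of_solvesUnitCostFVS {P : Prog} {a a' : ℝ} (h : SolvesUnitCostFVS P a')
    (ha' : 0 ≤ a') (haa' : a' ≤ a) (ha : 1 ≤ a) {g p : ℕ} (hg : 0 < g) (hp : 0 < p)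
    (hpg : 2 ^ p ≤ 5 ^ g)
    (hap : ∀ n : ℕ, a ^ (g * (n / p + 1)) ≤ 2 ^ p * (2 : ℝ) ^ ((1 - 1 / p : ℝ) * n)) (q : ℕ) :
    QSatSolvable q (1 - 1 / (2 * p)) := by
  obtain ⟨C, hC⟩ := h
  have hgen := (pCSP_wordCSP p g q hg).encode
  obtain ⟨Q, T, hT, hQ⟩ := hgen.exists_prog
  obtain ⟨V, hV, hgV⟩ := hgen.1
  have hB := CNF.polyBd_bound q
  have hV' := hV.comp hB
  have hS := (hV'.mul (hV'.add (.const 1))).pow C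
  let K := 2 + 8 * ((q + 2) * 5 ^ g + 5 * ((q + 2) * g) + 32)
  have hp' : (0 : ℝ) < p := by exact_mod_cast hp
  have hr : 1 < (2 : ℝ) ^ (1 / (2 * p) : ℝ) :=
    Real.one_lt_rpow (by norm_num) (by positivity)
  obtain ⟨C₁, hC₁, h₁⟩ := (hT.comp hB).exists_le_pow hr
  obtain ⟨C₂, hC₂, h₂⟩ := hS.exists_le_pow hr
  refine ⟨.seq Q P, C₁ + C * (2 ^ p * a ^ K) * C₂, fun φ hφ => ?_⟩
  obtain ⟨hproper, hiff⟩ := φ.hasSolution_wordCSP hg hp hpg hφ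
  have hwb := CNF.wb_encode hφ
  set D := wordCSP p g q hg φ.encode with hD
  obtain ⟨k, hk, hwidth⟩ := SelCSP.exists_givenWidth hproper
  obtain ⟨t, s, hP, ht, hs⟩ := hC D.inst k (fun _ => rfl) hwidth
  obtain ⟨t', ht', hQ⟩ := hQ _ _ hwb
  refine ⟨t' + t, s, hQ.seq hP, ?_, hs.trans hiff⟩
  have hsize : (inputSize D.inst.encode) ^ C ≤
      (V (CNF.bound q φ.n) * (V (CNF.bound q φ.n) + 1)) ^ C := by
    obtain ⟨e1, e2⟩ := hgV φ.encode (fun _ => 0) _ hwb fun _ => Nat.zero_le _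
    exact Nat.pow_le_pow_left (inputSize_le e1 e2) C
  have hsize' : ((inputSize D.inst.encode : ℕ) : ℝ) ^ C ≤
      C₂ * ((2 : ℝ) ^ (1 / (2 * p) : ℝ)) ^ φ.n := le_trans (by exact_mod_cast hsize) (h₂ φ.n)
  have hrn : ((2 : ℝ) ^ (1 / (2 * p) : ℝ)) ^ φ.n = (2 : ℝ) ^ (1 / (2 * p) * φ.n : ℝ) :=
    (Real.rpow_mul_natCast (by norm_num) _ _).symm
  have hk' : a' ^ k ≤ 2 ^ p * a ^ K * (2 : ℝ) ^ ((1 - 1 / p : ℝ) * φ.n) := by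
    calc a' ^ k ≤ a ^ k := pow_le_pow_left₀ ha' haa' _
      _ ≤ a ^ (g * (φ.n / p + 1) + K) := pow_le_pow_right₀ ha (by
          refine hk.trans (le_of_eq ?_)
          simp only [hD, wordCSP, satCSP, SelCSP.M, K, CNF.getD_zero]
          ring)
      _ = a ^ (g * (φ.n / p + 1)) * a ^ K := pow_add _ _ _
      _ ≤ 2 ^ p * (2 : ℝ) ^ ((1 - 1 / p : ℝ) * φ.n) * a ^ K :=
          mul_le_mul_of_nonneg_right (hap φ.n) (by positivity)
      _ = _ := by ring
  -- half of the gain `2 ^ (- n / p)` absorbs the polynomial factors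
  have hexp : (2 : ℝ) ^ ((1 - 1 / p : ℝ) * φ.n) * (2 : ℝ) ^ (1 / (2 * p) * φ.n : ℝ) =
      (2 : ℝ) ^ ((1 - 1 / (2 * p) : ℝ) * φ.n) := by
    rw [← Real.rpow_add (by norm_num)]
    congr 1
    field_simp
    ring
  have hone : (2 : ℝ) ^ (1 / (2 * p) * φ.n : ℝ) ≤ (2 : ℝ) ^ ((1 - 1 / (2 * p) : ℝ) * φ.n) := by
    refine Real.rpow_le_rpow_of_exponent_le (by norm_num)
      (mul_le_mul_of_nonneg_right ?_ (Nat.cast_nonneg _))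
    have hp1 : (1 : ℝ) ≤ p := by exact_mod_cast hp
    rw [le_sub_iff_add_le, ← add_div, div_le_one (by positivity)]
    linarith
  rw [hrn] at hsize'
  have hT' : (t' : ℝ) ≤ C₁ * (2 : ℝ) ^ ((1 - 1 / (2 * p) : ℝ) * φ.n) :=
    calc (t' : ℝ) ≤ (T (CNF.bound q φ.n) : ℝ) := by exact_mod_cast ht'
      _ ≤ C₁ * (2 : ℝ) ^ (1 / (2 * p) * φ.n : ℝ) := hrn ▸ h₁ φ.n
      _ ≤ _ := mul_le_mul_of_nonneg_left hone hC₁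
  rw [Nat.cast_add]
  exact add_le_of_le_mul hT' ht hk' hsize' hexp (Nat.cast_nonneg _)
    (pow_nonneg (Nat.cast_nonneg _) _) (by positivity) (by positivity)

theorem mainTheorem4 (hSETH : SETH) (ε : ℝ) (hε : 0 < ε) :
    ¬ ∃ P : RAM.Prog, SolvesUnitCostFVS P (5 - ε) := by
  rintro ⟨P, hP⟩
  rcases lt_or_ge 0 (5 - ε) with h0 | h0
  · obtain ⟨g, p, hg, hp, hpg, hap⟩ := exists_block (le_max_right (5 - ε) 1)
      (max_lt (by linarith) (by norm_num))
    obtain ⟨q, hq⟩ := hSETH (1 - 1 / (2 * p)) (by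
      have : (0 : ℝ) < p := by exact_mod_cast hp
      have : (0 : ℝ) < 1 / (2 * p) := by positivity
      linarith)
    exact hq (qSatSolvable_of_solvesUnitCostFVS hP h0.le (le_max_left _ _) (le_max_right _ _) hg hp
      hpg hap q)
  · -- a bound on the running time that is not positive cannot be met
    obtain ⟨C, hC⟩ := hP
    obtain ⟨t, s, hrun, ht, -⟩ := hC pathInstance 1 (fun _ => rfl) pathInstance_givenWidth
    have h1 : (1 : ℝ) ≤ t := by exact_mod_cast hrun.one_le
    have h2 : C * (5 - ε) ^ 1 * (inputSize pathInstance.encode : ℝ) ^ C ≤ 0 :=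
      mul_nonpos_of_nonpos_of_nonneg (mul_nonpos_of_nonneg_of_nonpos (by positivity) (by simpa using h0))
        (by positivity)
    linarith
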